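/- A rendez-vous protocol is a tuple $P=(Q,\Sigma,q_{in},q_f,T)$ with $Q$ a finite set of states, $\Sigma$ a finite message alphabet, $q_{in},q_f\in Q$, and $T\subseteq Q\times(\{\tau\}\cup\{!m,?m\mid m\in\Sigma\})\times Q$. A configuration is a non-empty multiset $C$ over $Q$; it is initial if it contains only copies of $q_{in}$. A step $C\to C'$ is one of the following: (internal) $C'=C-\{q\}+\{q'\}$ with $(q,\tau,q')\in T$ and $C(q)>0$; (rendez-vous) $C'=C-\{q_1,q_2\}+\{q_1',q_2'\}$ with $(q_1,!m,q_1'),(q_2,?m,q_2')\in T$ and $\{q_1,q_2\}\le C$ as multisets; (non-blocking request) $C'=C-\{q\}+\{q'\}$ with $(q,!m,q')\in T$, $C(q)>0$, and $(C-\{q\})(q_2)=0$ for every $(q_2,?m,q_2')\in T$. Call $C$ coverable if $C_0\to^*C'$ for some initial $C_0$ and some $C'\ge C$. CCover asks, given $P$ and a configuration $C$, whether $C$ is coverable; SCover asks, given $P$, whether $C_0\to^*C_f$ for some initial $C_0$ and some $C_f$ with $C_f(q_f)>0$. $P$ is wait-only if $Q$ can be partitioned into active states $Q_A\ni q_{in}$,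 from which no transition is a reception $?m$, and waiting states $Q_W$, from which every transition is a reception. An abstract set of configurations is a pair $\gamma=(S,Toks)$ with $S\subseteq Q$, $Toks\subseteq Q_W\times\Sigma$, and $q\notin S$ for all $(q,m)\in Toks$. Let $R(q)=\{m\mid (q,?m,q')\in T\text{ for some }q'\}$ and $st(Toks)=\{q\mid (q,m)\in Toks\text{ for some } m\}$. Distinct $q_1,q_2\in st(Toks)$ are conflict-free in $\gamma$ if there are $(q_1,m_1),(q_2,m_2)\in Toks$ with $m_1\ne m_2$, $m_1\notin R(q_2)$, $m_2\notin R(q_1)$. Let $[\![\gamma]\!]$ be the set of configurations $C$ such that every $q$ with $C(q)>0$ is in $S$, or is in $st(Toks)$ with $C(q)=1$ and conflict-free with each $q'\in st(Toks)\setminus\{q\}$ such that $C(q')=1$. Say that $a$ is *sent in* $S$ if some $(p,!a,p')\in T$ has $p\in S$, and *received in* $S$ if some $(q,?a,q')\in T$ has $q\in S$. Let $S''\supseteq S$ and $Toks''\supseteq Toks$ be the smallest sets such that: 1. if $(p,\tau,p')\in T$ with $p\in S$, then $p'\in S''$; 2. if $(p,!a,p')\in T$ with $p\in S$, then $p'\in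 S''$ if $a\notin R(p')$ or $a$ is received in $S$, and $(p',a)\in Toks''$ otherwise; 3. if $(q,?a,q')\in T$ with $q\in S$ or $(q,a)\in Toks$, and $a$ is sent in $S$, then $q'\in S''$; 4. if $(q,?a,q')\in T$, $(q,m)\in Toks$, $m\ne a$ and $a$ is sent in $S$, then $q'\in S''$ if $m\notin R(q')$, and $(q',m)\in Toks''$ if $m\in R(q')$. Let $S'\supseteq S''$ be the smallest set that contains $q_1$ in each of these cases: 5. $(q_1,m_1),(q_2,m_2)\in Toks''$, $m_1\ne m_2$, $m_2\notin R(q_1)$, $m_1\in R(q_2)$; 6. $(q_1,m_1),(q_2,m_2),(q_3,m_2)\in Toks''$, $m_1\neq m_2$, $(q_2,?m_1,q_3)\in T$; 7. $(q_1,m_1),(q_2,m_2),(q_3,m_3)\in Toks''$, $m_1,m_2,m_3$ pairwise distinct, $m_1\in R(q_3)\setminus R(q_2)$, $m_2\in R(q_3)\setminus R(q_1)$, $m_3\in R(q_1)\cap R(q_2)$. Put $F(\gamma)=(S',\{(q,m)\in Toks''\mid q\notin S'\})$, $\gamma_0=(\{q_{in}\},\emptyset)$ and $\gamma_{i+1}=F(\gamma_i)$.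 **Theorem.** (a) CCover and SCover restricted to wait-only protocols are in PTIME: there are deterministic Turing machines, running in time polynomial in the length of the input, that decide for a protocol $P$ and a configuration $C$ (respectively for a protocol $P$) whether $P$ is wait-only and $C$ is coverable (respectively whether $P$ is wait-only and a positive instance of SCover). Here states, messages and transitions are listed explicitly, and the multiplicities $C(q)$ are written in binary. (b) For every wait-only protocol and every partition $Q_A,Q_W$ as above, every $\gamma_i$ is an abstract set of configurations; with $N=|Q|^2\cdot\max(1,|\Sigma|)$, $\gamma_i=\gamma_N$ is a fixpoint of $F$ for all $i\ge N$; and a configuration $C$ is coverable if and only if some $C''\in[\![\gamma_N]\!]$ satisfies $C''\ge C$. -/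

import Mathlib

namespace Rendezvous

/-! ## Rendez-vous protocols and their non-blocking semantics -/

/-- The primitives over the message alphabet `M`: internal action, request `!m`, reception `?m`. -/
inductive Action (M : Type*) where
  | tau : Action M
  | send (m : M) : Action M
  | recv (m : M) : Action M

/-- A rendez-vous protocol with states `Q` and message alphabet `M`
(both are assumed finite wherever protocols are used below). -/
structure Protocol (Q M : Type*) where
  init : Q
  final : Q
  T : Set (Q × Action M × Q)

namespace Protocol

variable {Q M : Type*} [DecidableEq Q]

/-- One step between configurations; configurations are (nonempty) multisets of states.
Steps preserve the number of processes. -/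
inductive Step (P : Protocol Q M) : Multiset Q → Multiset Q → Prop
  | internal (C : Multiset Q) (q q' : Q)
      (ht : (q, Action.tau, q') ∈ P.T) (hq : 0 < C.count q) :
      Step P C (C - {q} + {q'})
  | rendezvous (C : Multiset Q) (m : M) (q₁ q₁' q₂ q₂' : Q)
      (hs : (q₁, Action.send m, q₁') ∈ P.T) (hr : (q₂, Action.recv m, q₂') ∈ P.T)
      (h₁ : 0 < C.count q₁) (h₂ : 0 < C.count q₂) (h₁₂ : 2 ≤ C.count q₁ + C.count q₂) :
      Step P C (C - {q₁, q₂} + {q₁', q₂'})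
  | nonblocking (C : Multiset Q) (m : M) (q q' : Q)
      (hs : (q, Action.send m, q') ∈ P.T) (hq : 0 < C.count q)
      (hfree : ∀ q₂ q₂', (q₂, Action.recv m, q₂') ∈ P.T → (C - {q}).count q₂ = 0) :
      Step P C (C - {q} + {q'})

/-- The reflexive transitive closure of the step relation. -/
def Reaches (P : Protocol Q M) : Multiset Q → Multiset Q → Prop :=
  Relation.ReflTransGen P.Step

/-- Initial configurations: at least one process, and all of them in the initial state. -/
def IsInitial (P : Protocol Q M) (C : Multiset Q) : Prop :=
  C ≠ 0 ∧ ∀ q, q ≠ P.init → C.count q = 0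

/-- State coverability. -/
def SCover (P : Protocol Q M) : Prop :=
  ∃ C₀ Cf, P.IsInitial C₀ ∧ 0 < Cf.count P.final ∧ P.Reaches C₀ Cf

/-- Configuration coverability. -/
def CCover (P : Protocol Q M) (C : Multiset Q) : Prop :=
  ∃ C₀ C', P.IsInitial C₀ ∧ C ≤ C' ∧ P.Reaches C₀ C'

/-- `A` is the set of active states, its complement the set of waiting states, of a partition
that witnesses that `P` is wait-only. -/
def WaitOnlyWith (P : Protocol Q M) (A : Set Q) : Prop :=
  P.init ∈ A ∧
  (∀ q ∈ A, ∀ q' m q'', (q', Action.recv m, q'') ∈ P.T → q' ≠ q) ∧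
  (∀ q ∉ A,
    (∀ q' m q'', (q', Action.send m, q'') ∈ P.T → q' ≠ q) ∧
    (∀ q' q'', (q', Action.tau, q'') ∈ P.T → q' ≠ q))

def WaitOnly (P : Protocol Q M) : Prop := ∃ A : Set Q, P.WaitOnlyWith A

/-! ## The abstraction -/

/-- The messages that can be received in state `q`. -/
def Rec (P : Protocol Q M) (q : Q) : Set M :=
  {m | ∃ q', (q, Action.recv m, q') ∈ P.T}

end Protocol

/-- The data `(S, Toks)` of an abstract set of configurations. -/
@[ext] structure AbsSet (Q M : Type*) where
  S : Set Q
  Toks : Set (Q × M)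

namespace AbsSet

variable {Q M : Type*} [DecidableEq Q]

/-- The side conditions on `(S, Toks)`, for the set `A` of active states. -/
def IsAbstract (A : Set Q) (γ : AbsSet Q M) : Prop :=
  ∀ q m, (q, m) ∈ γ.Toks → q ∉ A ∧ q ∉ γ.S

/-- The states that occur in `Toks`. -/
def st (γ : AbsSet Q M) : Set Q := {q | ∃ m, (q, m) ∈ γ.Toks}

def ConflictFree (P : Protocol Q M) (γ : AbsSet Q M) (q₁ q₂ : Q) : Prop :=
  ∃ m₁ m₂, m₁ ≠ m₂ ∧ (q₁, m₁) ∈ γ.Toks ∧ (q₂, m₂) ∈ γ.Toks ∧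
    m₁ ∉ P.Rec q₂ ∧ m₂ ∉ P.Rec q₁

/-- `C` respects `γ`, that is, `C ∈ ⟦γ⟧`. -/
def Respects (P : Protocol Q M) (γ : AbsSet Q M) (C : Multiset Q) : Prop :=
  ∀ q, 0 < C.count q →
    q ∈ γ.S ∨
    (q ∈ γ.st ∧ C.count q = 1 ∧
      ∀ q' ∈ γ.st \ {q}, C.count q' = 1 → γ.ConflictFree P q q')

end AbsSet

namespace Protocol

variable {Q M : Type*}

/-- Some state of `S` can send `a`. -/
def CanSend (P : Protocol Q M) (S : Set Q) (a : M) : Prop :=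
  ∃ p p', (p, Action.send a, p') ∈ P.T ∧ p ∈ S

/-- Some state of `S` can receive `a`. -/
def CanReceive (P : Protocol Q M) (S : Set Q) (a : M) : Prop :=
  ∃ q q', (q, Action.recv a, q') ∈ P.T ∧ q ∈ S

/-- The intermediate set `S''` computed from `γ = (S, Toks)`. -/
inductive S2 (P : Protocol Q M) (γ : AbsSet Q M) : Q → Prop
  | base (q : Q) : q ∈ γ.S → S2 P γ q
  | internal (p p' : Q) : (p, Action.tau, p') ∈ P.T → p ∈ γ.S → S2 P γ p'
  | send (p p' : Q) (a : M) : (p, Action.send a, p') ∈ P.T → p ∈ γ.S →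
      (a ∉ P.Rec p' ∨ P.CanReceive γ.S a) → S2 P γ p'
  | recv (q q' : Q) (a : M) : (q, Action.recv a, q') ∈ P.T →
      (q ∈ γ.S ∨ (q, a) ∈ γ.Toks) → P.CanSend γ.S a → S2 P γ q'
  | tokEnd (q q' : Q) (a m : M) : (q, Action.recv a, q') ∈ P.T → (q, m) ∈ γ.Toks → m ≠ a →
      P.CanSend γ.S a → m ∉ P.Rec q' → S2 P γ q'

/-- The intermediate set `Toks''` computed from `γ = (S, Toks)`. -/
inductive Toks2 (P : Protocol Q M) (γ : AbsSet Q M) : Q × M → Prop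
  | base (t : Q × M) : t ∈ γ.Toks → Toks2 P γ t
  | newTok (p p' : Q) (a : M) : (p, Action.send a, p') ∈ P.T → p ∈ γ.S →
      a ∈ P.Rec p' → ¬ P.CanReceive γ.S a → Toks2 P γ (p', a)
  | tokStep (q q' : Q) (a m : M) : (q, Action.recv a, q') ∈ P.T → (q, m) ∈ γ.Toks → m ≠ a →
      P.CanSend γ.S a → m ∈ P.Rec q' → Toks2 P γ (q', m)

/-- The set `S'` of `F γ`. -/
inductive S1 (P : Protocol Q M) (γ : AbsSet Q M) : Q → Prop
  | base (q : Q) : P.S2 γ q → S1 P γ q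
  | twoToks (q₁ q₂ : Q) (m₁ m₂ : M) :
      P.Toks2 γ (q₁, m₁) → P.Toks2 γ (q₂, m₂) → m₁ ≠ m₂ →
      m₂ ∉ P.Rec q₁ → m₁ ∈ P.Rec q₂ → S1 P γ q₁
  | threeToks (q₁ q₂ q₃ : Q) (m₁ m₂ : M) :
      P.Toks2 γ (q₁, m₁) → P.Toks2 γ (q₂, m₂) → P.Toks2 γ (q₃, m₂) → m₁ ≠ m₂ →
      (q₂, Action.recv m₁, q₃) ∈ P.T → S1 P γ q₁
  | threeToks' (q₁ q₂ q₃ : Q) (m₁ m₂ m₃ : M) :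
      P.Toks2 γ (q₁, m₁) → P.Toks2 γ (q₂, m₂) → P.Toks2 γ (q₃, m₃) →
      m₁ ≠ m₂ → m₁ ≠ m₃ → m₂ ≠ m₃ →
      m₁ ∉ P.Rec q₂ → m₁ ∈ P.Rec q₃ → m₂ ∉ P.Rec q₁ → m₂ ∈ P.Rec q₃ →
      m₃ ∈ P.Rec q₂ → m₃ ∈ P.Rec q₁ → S1 P γ q₁

/-- The abstraction function `F`. -/
def F (P : Protocol Q M) (γ : AbsSet Q M) : AbsSet Q M where
  S := {q | P.S1 γ q}
  Toks := {t | P.Toks2 γ t ∧ ¬ P.S1 γ t.1}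

/-- The sequence `γ₀ = ({q_in}, ∅)`, `γ_{i+1} = F γ_i`. -/
def absSeq (P : Protocol Q M) (i : ℕ) : AbsSet Q M :=
  P.F^[i] ⟨{P.init}, ∅⟩

end Protocol

/-- The number of iterations of `F`: `|Q|² · |Σ|`, read as `|Q|²` for an empty alphabet. -/
def iterBound (Q M : Type*) [Fintype Q] [Fintype M] : ℕ :=
  Fintype.card Q ^ 2 * max 1 (Fintype.card M)

/-! ## Inputs as words, and polynomial time -/

/-- The input alphabet. -/
inductive Sym where
  | tally : Sym
  | sep : Sym
  | tau : Sym
  | send : Sym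
  | recv : Sym
  | bit (b : Bool) : Sym

/-- Unary numerals with an end marker. -/
def encUnary (n : ℕ) : List Sym := List.replicate n Sym.tally ++ [Sym.sep]

/-- Binary numerals with an end marker. -/
def encBinary (n : ℕ) : List Sym := (Computability.encodeNat n).map Sym.bit ++ [Sym.sep]

def encTransition {n k : ℕ} : Fin n × Action (Fin k) × Fin n → List Sym
  | (q, Action.tau, q') => Sym.tau :: (encUnary q ++ encUnary q')
  | (q, Action.send m, q') => Sym.send :: (encUnary q ++ encUnary m ++ encUnary q')
  | (q, Action.recv m, q') => Sym.recv :: (encUnary q ++ encUnary m ++ encUnary q')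

/-- A protocol as a concrete input: the states are `0, …, numStates - 1`, the messages are
`0, …, numMsgs - 1`, and the set of transitions is given by a list. -/
structure ProtocolInput where
  numStates : ℕ
  numMsgs : ℕ
  init : Fin numStates
  final : Fin numStates
  trans : List (Fin numStates × Action (Fin numMsgs) × Fin numStates)

def ProtocolInput.toProtocol (I : ProtocolInput) :
    Protocol (Fin I.numStates) (Fin I.numMsgs) where
  init := I.init
  final := I.final
  T := {t | t ∈ I.trans}

/-- The word that describes a protocol; its length is at least `|Q| + |Σ| + |T|`. -/
def ProtocolInput.encode (I : ProtocolInput) : List Sym :=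
  encUnary I.numStates ++ encUnary I.numMsgs ++ encUnary I.init ++ encUnary I.final ++
    I.trans.flatMap encTransition

/-- An input of configuration coverability: a protocol and a configuration. -/
structure ConfigInput extends ProtocolInput where
  config : Multiset (Fin numStates)
  config_ne : config ≠ 0

/-- The word that describes a protocol and a configuration; the number of processes in each
state is written in binary. -/
def ConfigInput.encode (I : ConfigInput) : List Sym :=
  I.toProtocolInput.encode ++
    (List.finRange I.numStates).flatMap fun q => encBinary (I.config.count q)

/-- The decision problem `p` on inputs `α`, written as words by `enc`, is in PTIME: a Turing
machine computes the answer to every input in a number of steps that is bounded by a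
polynomial in the length of its encoding. -/
def InPTime {α Γ : Type} (enc : α → List Γ) (p : α → Prop) : Prop :=
  ∃ f : α → Bool, (∀ a, f a = true ↔ p a) ∧
    Nonempty (Turing.TM2ComputableInPolyTime enc Computability.encodeBool f)

end Rendezvous

/-!
The iteration of `F` decides coverability because the abstract sets `γ_i` are sound at every stage
and complete at the fixpoint.

*Soundness* (`Protocol.ccover_of_respects`). By induction on `i`, arbitrarily many processes can be
put into all states of `S` simultaneously (`Protocol.Free`), and every token `(q, m)` comes from a
process in a state of `S` that requests `m` and then reaches `q` by receiving messages that can be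
sent in `S` (`Protocol.Path`). A request can always be made when no process that has to be kept
receives it: superfluous processes may receive it, and nothing is lost by that
(`Protocol.CCover.send`). Hence a token `(q, m)` can be realised next to any processes that do not
receive `m` (`Protocol.Lead.place`), and also at the expense of one process that does
(`Protocol.Lead.placeRecv`). Each rule of `F` that adds a state `u` to `S` follows by repeating such
a manoeuvre, which produces one more process in `u` and preserves those that are already there
(`Protocol.lead_of_S1`).

*Completeness* (`Protocol.respects_of_reaches`). At a fixpoint, `⟦γ⟧` contains the initial
configurations and is closed under steps: any step that would leave it exhibits an instance of one
of the rules of `F`. Since `⟦γ⟧` is also closed under smaller configurations, a configuration is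
coverable if and only if it belongs to `⟦γ⟧` itself (`Protocol.ccover_iff_respects`).

*Stabilisation* (`Protocol.exists_fixedPt`). `S` never shrinks, `Toks` grows while `S` is constant,
and all tokens sit on states outside `S`; a weighted count of states and tokens therefore increases
strictly until the fixpoint is reached.

*Polynomial time.* One application of `F`, and the final membership test, are first-order
definable over the numbers below the length `L` of the input, with atomic formulas that look up a
symbol of the input, or of an `L × L` table that holds `γ_i`. `Ev` is the class of predicates that
some structured stack program evaluates in polynomial time; it is closed under the connectives
and under quantification over the numbers below `L`. Structured programs are compiled to the
Turing machines of Mathlib (`Prog.inPTime_of_runs`), and iterating a definable update of the table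
`L³` times before a definable test stays in polynomial time (`inPTime_of_iterate`). The protocol
is read off the input as a protocol on `ℕ` (`wordProtocol`), which is the given one up to a renaming
of states and messages (`wordProtocol_encode`), and `F` commutes with renamings
(`tableAbs_iterate`). Only the multiplicities `0`, `1` and "at least `2`" matter for membership in
`⟦γ⟧`, and these are visible in the first two digits of a binary numeral (`hasBit_encode`).
-/

namespace Rendezvous

/-! ### Wait-only protocols and invariants of the iteration -/

namespace Protocol

variable {Q M : Type*} {P : Protocol Q M} {A : Set Q} {γ : AbsSet Q M}

theorem WaitOnlyWith.send_mem (h : P.WaitOnlyWith A) {q q' : Q} {m : M}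
    (ht : (q, Action.send m, q') ∈ P.T) : q ∈ A := by
  by_contra hq
  exact (h.2.2 q hq).1 _ _ _ ht rfl

theorem WaitOnlyWith.tau_mem (h : P.WaitOnlyWith A) {q q' : Q}
    (ht : (q, Action.tau, q') ∈ P.T) : q ∈ A := by
  by_contra hq
  exact (h.2.2 q hq).2 _ _ ht rfl

theorem WaitOnlyWith.notMem_of_rec (h : P.WaitOnlyWith A) {q : Q} {m : M}
    (hm : m ∈ P.Rec q) : q ∉ A := by
  obtain ⟨q', ht⟩ := hm
  exact fun hq => h.2.1 q hq _ _ _ ht rfl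

theorem absSeq_succ (P : Protocol Q M) (i : ℕ) : P.absSeq (i + 1) = P.F (P.absSeq i) :=
  Function.iterate_succ_apply' _ _ _

/-- A token `(q, m)` records that `q` still receives the message `m` whose request led to it. -/
theorem rec_of_toks2 (hγ : ∀ t ∈ γ.Toks, t.2 ∈ P.Rec t.1) {t : Q × M} (h : P.Toks2 γ t) :
    t.2 ∈ P.Rec t.1 := by
  cases h with
  | base _ h => exact hγ _ h
  | newTok p p' a _ _ h _ => exact h
  | tokStep q q' a m _ _ _ _ h => exact h

theorem rec_of_mem_absSeq (P : Protocol Q M) (i : ℕ) :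
    ∀ t ∈ (P.absSeq i).Toks, t.2 ∈ P.Rec t.1 := by
  induction i with
  | zero => exact fun t ht => ht.elim
  | succ i ih =>
    rw [absSeq_succ]
    exact fun t ht => rec_of_toks2 ih ht.1

theorem notMem_absSeq_of_mem_toks (P : Protocol Q M) (i : ℕ) :
    ∀ t ∈ (P.absSeq i).Toks, t.1 ∉ (P.absSeq i).S := by
  cases i with
  | zero => exact fun t ht => ht.elim
  | succ i =>
    rw [absSeq_succ]
    exact fun t ht => ht.2

theorem WaitOnlyWith.isAbstract_absSeq (h : P.WaitOnlyWith A) (i : ℕ) :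
    (P.absSeq i).IsAbstract A := fun _ _ hm =>
  ⟨h.notMem_of_rec (rec_of_mem_absSeq P i _ hm), notMem_absSeq_of_mem_toks P i _ hm⟩

/-! ### Stabilisation of the iteration -/

theorem S_subset_F (P : Protocol Q M) (γ : AbsSet Q M) : γ.S ⊆ (P.F γ).S :=
  fun q hq => S1.base q (S2.base q hq)

theorem toks_subset_F (P : Protocol Q M) {γ : AbsSet Q M} (hS : (P.F γ).S = γ.S)
    (hγ : ∀ t ∈ γ.Toks, t.1 ∉ γ.S) : γ.Toks ⊆ (P.F γ).Toks := fun t ht =>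
  ⟨Toks2.base t ht, fun h => hγ t ht (hS ▸ h : t.1 ∈ γ.S)⟩

/-- A measure of progress. An enlargement of `S` by one state outweighs the loss of all tokens,
since at least one state (the initial one) never carries a token. -/
noncomputable def rank [Fintype Q] [Fintype M] (γ : AbsSet Q M) : ℕ :=
  γ.S.ncard * (Fintype.card Q * max 1 (Fintype.card M)) + γ.Toks.ncard

theorem init_mem_absSeq (P : Protocol Q M) (i : ℕ) : P.init ∈ (P.absSeq i).S := by
  induction i with
  | zero => exact rfl
  | succ i ih => rw [absSeq_succ]; exact S_subset_F P _ ih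

theorem card_toks_le [Fintype Q] [Fintype M] (γ : AbsSet Q M) (hγ : ∀ t ∈ γ.Toks, t.1 ∉ γ.S) :
    γ.Toks.ncard + γ.S.ncard * max 1 (Fintype.card M) ≤
      Fintype.card Q * max 1 (Fintype.card M) := by
  classical
  have h1 : γ.Toks ⊆ γ.Sᶜ ×ˢ (Set.univ : Set M) := fun t ht => ⟨hγ t ht, trivial⟩
  have h2 := Set.ncard_le_ncard h1 (Set.toFinite _)
  rw [Set.ncard_prod, Set.ncard_univ, Nat.card_eq_fintype_card] at h2
  have h3 := Set.ncard_add_ncard_compl γ.S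
  rw [Nat.card_eq_fintype_card] at h3
  have h4 : γ.Sᶜ.ncard * Fintype.card M ≤ γ.Sᶜ.ncard * max 1 (Fintype.card M) :=
    Nat.mul_le_mul_left _ (le_max_right _ _)
  rw [← h3, add_mul]
  omega

theorem rank_le [Fintype Q] [Fintype M] (P : Protocol Q M) (i : ℕ) :
    rank (P.absSeq i) ≤ iterBound Q M := by
  have h := card_toks_le _ (notMem_absSeq_of_mem_toks P i)
  unfold rank iterBound
  set s := (P.absSeq i).S.ncard
  set t := (P.absSeq i).Toks.ncard
  set n := Fintype.card Q
  set k := max 1 (Fintype.card M)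
  have hk : 1 ≤ k := le_max_left _ _
  have hs : s ≤ n := by
    have := Set.ncard_le_card (P.absSeq i).S
    rwa [Nat.card_eq_fintype_card] at this
  obtain ⟨d, hd⟩ := Nat.exists_eq_add_of_le hs
  have h1 : t ≤ d * k := by rw [hd, add_mul] at h; omega
  rcases Nat.eq_zero_or_pos n with h0 | h0
  · have hd0 : d = 0 := by omega
    have hs0 : s = 0 := by omega
    subst hd0
    rw [hs0, zero_mul, zero_add]
    exact h1.trans (by simp)
  · calc s * (n * k) + t ≤ s * (n * k) + d * k := by omega
      _ ≤ s * (n * k) + d * (n * k) := by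
        gcongr
        exact Nat.le_mul_of_pos_left _ h0
      _ = n ^ 2 * k := by rw [← add_mul, ← hd]; ring

/-- As long as the iteration is not stationary, the measure of progress grows: if `S` grows, the
gain is `|Q| * max 1 |Σ|`, which exceeds the number of tokens lost by `card_toks_le`. -/
theorem rank_lt [Fintype Q] [Fintype M] (P : Protocol Q M) (i : ℕ)
    (h : P.absSeq (i + 1) ≠ P.absSeq i) : rank (P.absSeq i) < rank (P.absSeq (i + 1)) := by
  have hS := S_subset_F P (P.absSeq i)
  rw [← absSeq_succ] at hS
  have hc := card_toks_le _ (notMem_absSeq_of_mem_toks P i)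
  have h1 : 0 < (P.absSeq i).S.ncard :=
    (Set.ncard_pos (Set.toFinite _)).2 ⟨_, init_mem_absSeq P i⟩
  have hk : 1 ≤ max 1 (Fintype.card M) := le_max_left _ _
  unfold rank
  rcases hS.eq_or_ssubset with heq | hlt
  · have hT := toks_subset_F P (γ := P.absSeq i) (by rw [← absSeq_succ, heq])
      (notMem_absSeq_of_mem_toks P i)
    rw [← absSeq_succ] at hT
    rcases hT.eq_or_ssubset with heq' | hlt'
    · exact absurd (AbsSet.ext heq.symm heq'.symm) h
    · rw [heq]
      exact Nat.add_lt_add_left (Set.ncard_lt_ncard hlt' (Set.toFinite _)) _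
  · have h2 := Set.ncard_lt_ncard hlt (Set.toFinite _)
    set s := (P.absSeq i).S.ncard
    set k := max 1 (Fintype.card M)
    have h3 : (s + 1) * (Fintype.card Q * k) ≤
        (P.absSeq (i + 1)).S.ncard * (Fintype.card Q * k) := Nat.mul_le_mul_right _ h2
    have h4 : 1 ≤ s * k := Nat.mul_pos h1 hk
    rw [add_mul, one_mul] at h3
    omega

theorem exists_fixedPt [Fintype Q] [Fintype M] (P : Protocol Q M) :
    ∃ i ≤ iterBound Q M, P.absSeq (i + 1) = P.absSeq i := by
  by_contra! h
  have : ∀ i ≤ iterBound Q M + 1, i ≤ rank (P.absSeq i) := by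
    intro i
    induction i with
    | zero => simp
    | succ i ih =>
      intro hi
      have := rank_lt P i (h i (by omega))
      have := ih (by omega)
      omega
  have h1 := this _ le_rfl
  have h2 := rank_le P (iterBound Q M + 1)
  omega

theorem absSeq_eq_of_le (P : Protocol Q M) {i j : ℕ} (h : P.absSeq (i + 1) = P.absSeq i)
    (hij : i ≤ j) : P.absSeq j = P.absSeq i := by
  induction j, hij using Nat.le_induction with
  | base => rfl
  | succ j _ ih => rw [absSeq_succ, ih, ← absSeq_succ, h]

theorem absSeq_eq [Fintype Q] [Fintype M] (P : Protocol Q M) {i : ℕ}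
    (hi : iterBound Q M ≤ i) : P.absSeq i = P.absSeq (iterBound Q M) := by
  obtain ⟨j, hj, h⟩ := exists_fixedPt P
  rw [absSeq_eq_of_le P h (hj.trans hi), absSeq_eq_of_le P h hj]

theorem isFixedPt_absSeq [Fintype Q] [Fintype M] (P : Protocol Q M) {i : ℕ}
    (hi : iterBound Q M ≤ i) : Function.IsFixedPt P.F (P.absSeq i) := by
  unfold Function.IsFixedPt
  rw [← absSeq_succ, absSeq_eq P hi, absSeq_eq P (hi.trans i.le_succ)]

end Protocol

/-! ### The fixpoint is closed under steps -/

namespace Protocol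

variable {Q M : Type*} {P : Protocol Q M} {A : Set Q} {γ : AbsSet Q M}

theorem mem_S_of_S2 (hF : P.F γ = γ) {q : Q} (h : P.S2 γ q) : q ∈ γ.S := by
  rw [← hF]; exact S1.base q h

theorem mem_S_of_S1 (hF : P.F γ = γ) {q : Q} (h : P.S1 γ q) : q ∈ γ.S := by
  rw [← hF]; exact h

theorem mem_toks_of_toks2 (hF : P.F γ = γ) {t : Q × M} (h : P.Toks2 γ t) (ht : t.1 ∉ γ.S) :
    t ∈ γ.Toks := by
  rw [← hF]; exact ⟨h, fun h' => ht (mem_S_of_S1 hF h')⟩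

/-- Two tokens with different messages of a fixpoint either both receive, or both ignore, each
other's message. -/
theorem rec_of_rec (hF : P.F γ = γ) (hγ : γ.IsAbstract A) {q₁ q₂ : Q} {m₁ m₂ : M}
    (h₁ : (q₁, m₁) ∈ γ.Toks) (h₂ : (q₂, m₂) ∈ γ.Toks) (hne : m₁ ≠ m₂) (h : m₁ ∈ P.Rec q₂) :
    m₂ ∈ P.Rec q₁ := by
  by_contra h'
  exact (hγ _ _ h₁).2 (mem_S_of_S1 hF
    (S1.twoToks q₁ q₂ m₁ m₂ (.base _ h₁) (.base _ h₂) hne h' h))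

end Protocol

namespace AbsSet

variable {Q M : Type*} {P : Protocol Q M} {A : Set Q} {γ : AbsSet Q M}

theorem ConflictFree.symm {q₁ q₂ : Q} (h : γ.ConflictFree P q₁ q₂) : γ.ConflictFree P q₂ q₁ := by
  obtain ⟨m₁, m₂, h, h₁, h₂, h₃, h₄⟩ := h
  exact ⟨m₂, m₁, h.symm, h₂, h₁, h₄, h₃⟩

variable [DecidableEq Q]

/-- Membership in `⟦γ⟧`, phrased in terms of the processes outside `S` only. -/
theorem respects_iff (hγ : γ.IsAbstract A) {C : Multiset Q} :
    γ.Respects P C ↔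
      (∀ r, r ∉ γ.S → 0 < C.count r → r ∈ γ.st ∧ C.count r = 1) ∧
      ∀ r r', r ∉ γ.S → r' ∉ γ.S → 0 < C.count r → 0 < C.count r' → r ≠ r' →
        γ.ConflictFree P r r' := by
  constructor
  · intro h
    have h1 : ∀ r, r ∉ γ.S → 0 < C.count r → r ∈ γ.st ∧ C.count r = 1 := fun r hr hc =>
      ((h r hc).resolve_left hr).imp_right And.left
    refine ⟨h1, fun r r' hr hr' hc hc' hne => ?_⟩
    exact ((h r hc).resolve_left hr).2.2 r' ⟨(h1 r' hr' hc').1, hne.symm⟩ (h1 r' hr' hc').2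
  · rintro ⟨h1, h2⟩ r hc
    by_cases hr : r ∈ γ.S
    · exact Or.inl hr
    · refine Or.inr ⟨(h1 r hr hc).1, (h1 r hr hc).2, fun r' hr' hc' => ?_⟩
      obtain ⟨m, hm⟩ := hr'.1
      exact h2 r r' hr (hγ _ _ hm).2 hc (by omega) (Ne.symm hr'.2)

theorem Respects.mono (hγ : γ.IsAbstract A) {C D : Multiset Q} (h : γ.Respects P D)
    (hCD : C ≤ D) : γ.Respects P C := by
  rw [respects_iff hγ] at h ⊢
  have hle := fun r => Multiset.count_le_of_le r hCD
  refine ⟨fun r hr hc => ?_, fun r r' hr hr' hc hc' hne =>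
    h.2 r r' hr hr' (hc.trans_le (hle r)) (hc'.trans_le (hle r')) hne⟩
  have := h.1 r hr (hc.trans_le (hle r))
  exact ⟨this.1, by have := hle r; omega⟩

/-- A configuration of `⟦γ⟧` stays in `⟦γ⟧` when one process in state `n` is added that fits, and
other processes move into `S` or disappear. -/
theorem Respects.add_one (hγ : γ.IsAbstract A) {C C' : Multiset Q} (h : γ.Respects P C) (n : Q)
    (hle : ∀ r, r ∉ γ.S → r ≠ n → C'.count r ≤ C.count r)
    (hn : n ∈ γ.S ∨ n ∈ γ.st ∧ C'.count n ≤ 1 ∧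
      ∀ r, r ∉ γ.S → r ≠ n → 0 < C'.count r → γ.ConflictFree P n r) :
    γ.Respects P C' := by
  rw [respects_iff hγ] at h ⊢
  constructor
  · intro r hr hc
    by_cases hrn : r = n
    · subst hrn
      have := hn.resolve_left hr
      exact ⟨this.1, by have := this.2.1; omega⟩
    · have h1 := hle r hr hrn
      have h2 := h.1 r hr (by omega)
      exact ⟨h2.1, by omega⟩
  · intro r r' hr hr' hc hc' hne
    by_cases hrn : r = n
    · subst hrn
      exact (hn.resolve_left hr).2.2 r' hr' hne.symm hc'
    · by_cases hrn' : r' = n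
      · subst hrn'
        exact ((hn.resolve_left hr').2.2 r hr hne hc).symm
      · exact h.2 r r' hr hr' (hc.trans_le (hle r hr hrn)) (hc'.trans_le (hle r' hr' hrn')) hne

end AbsSet

namespace Protocol

variable {Q M : Type*} [DecidableEq Q] {P : Protocol Q M} {A : Set Q} {γ : AbsSet Q M}

theorem respects_internal (hF : P.F γ = γ) (hP : P.WaitOnlyWith A) (hγ : γ.IsAbstract A)
    {C : Multiset Q} (h : γ.Respects P C) {q q' : Q} (ht : (q, Action.tau, q') ∈ P.T)
    (hq : 0 < C.count q) : γ.Respects P (C - {q} + {q'}) := by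
  have hqS : q ∈ γ.S := by
    refine (h q hq).resolve_right ?_
    rintro ⟨⟨m, hm⟩, -⟩
    exact (hγ _ _ hm).1 (hP.tau_mem ht)
  refine h.add_one hγ q' (fun r hr hr' => ?_) (Or.inl (mem_S_of_S2 hF (S2.internal q q' ht hqS)))
  rw [Multiset.count_add, Multiset.count_sub, Multiset.count_singleton r q', if_neg hr']; omega

theorem mem_S_of_send (hP : P.WaitOnlyWith A) (hγ : γ.IsAbstract A)
    {C : Multiset Q} (h : γ.Respects P C) {q q' : Q} {m : M}
    (ht : (q, Action.send m, q') ∈ P.T) (hq : 0 < C.count q) : q ∈ γ.S := by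
  refine (h q hq).resolve_right ?_
  rintro ⟨⟨m, hm⟩, -⟩
  exact (hγ _ _ hm).1 (hP.send_mem ht)

/-- A sender that is not answered may end in a new token `(q', m)`. It is in conflict with none of
the others, as none of them receives `m`. -/
theorem respects_nonblocking (hF : P.F γ = γ) (hP : P.WaitOnlyWith A) (hγ : γ.IsAbstract A)
    (hrec : ∀ t ∈ γ.Toks, t.2 ∈ P.Rec t.1)
    {C : Multiset Q} (h : γ.Respects P C) {q q' : Q} {m : M}
    (ht : (q, Action.send m, q') ∈ P.T) (hq : 0 < C.count q)
    (hfree : ∀ q₂ q₂', (q₂, Action.recv m, q₂') ∈ P.T → (C - {q}).count q₂ = 0) :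
    γ.Respects P (C - {q} + {q'}) := by
  have hqS := mem_S_of_send hP hγ h ht hq
  refine h.add_one hγ q' (fun r hr hr' => ?_) ?_
  · rw [Multiset.count_add, Multiset.count_sub, Multiset.count_singleton r q', if_neg hr']; omega
  by_cases hS : q' ∈ γ.S
  · exact Or.inl hS
  right
  have hm : m ∈ P.Rec q' := by
    by_contra hm
    exact hS (mem_S_of_S2 hF (S2.send q q' m ht hqS (Or.inl hm)))
  have hcr : ¬ P.CanReceive γ.S m := fun hc =>
    hS (mem_S_of_S2 hF (S2.send q q' m ht hqS (Or.inr hc)))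
  have htok : (q', m) ∈ γ.Toks :=
    mem_toks_of_toks2 hF (Toks2.newTok q q' m ht hqS hm hcr) hS
  have hfree' : ∀ r, m ∈ P.Rec r → (C - {q}).count r = 0 := fun r ⟨r', hr'⟩ => hfree r r' hr'
  refine ⟨⟨m, htok⟩, ?_, fun r hr hne hc => ?_⟩
  · rw [Multiset.count_add, hfree' q' hm]; simp
  have hc' : 0 < (C - {q}).count r := by
    simpa [Multiset.count_singleton, hne] using hc
  have hmr : m ∉ P.Rec r := fun hmr => by have := hfree' r hmr; omega
  have hcC : 0 < C.count r := hc'.trans_le (Multiset.count_le_of_le r (Multiset.sub_le_self _ _))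
  obtain ⟨b, hb⟩ := ((h r hcC).resolve_left hr).1
  have hbm : m ≠ b := by rintro rfl; exact hmr (hrec _ hb)
  exact ⟨m, b, hbm, htok, hb, hmr, fun hbq => hmr (rec_of_rec hF hγ hb htok hbm.symm hbq)⟩

/-- After a rendez-vous, at most one of the two processes is outside `S`: if both were,
`S1.threeToks` would put the sender into `S`. A remaining conflict of the sender with another
process `r` is excluded by `S1.threeToks'`, applied to the receiver, `r` and the sender. -/
theorem respects_rendezvous (hF : P.F γ = γ) (hP : P.WaitOnlyWith A) (hγ : γ.IsAbstract A)
    {C : Multiset Q} (h : γ.Respects P C) {q₁ q₁' q₂ q₂' : Q} {m : M}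
    (hs : (q₁, Action.send m, q₁') ∈ P.T) (hr : (q₂, Action.recv m, q₂') ∈ P.T)
    (h₁ : 0 < C.count q₁) (h₂ : 0 < C.count q₂) :
    γ.Respects P (C - {q₁, q₂} + {q₁', q₂'}) := by
  have hS₁ := mem_S_of_send hP hγ h hs h₁
  have hsend : P.CanSend γ.S m := ⟨q₁, q₁', hs, hS₁⟩
  have hcount : ∀ r, r ∉ γ.S → (C - {q₁, q₂} + {q₁', q₂'}).count r =
      C.count r - (if r = q₂ then 1 else 0) +
        ((if r = q₂' then 1 else 0) + if r = q₁' then 1 else 0) := by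
    intro r hr
    have : r ≠ q₁ := by rintro rfl; exact hr hS₁
    rw [Multiset.count_add, Multiset.count_sub]
    simp only [Multiset.insert_eq_cons, Multiset.count_cons, Multiset.count_singleton, this,
      if_false]
    omega
  have hCF := ((AbsSet.respects_iff hγ).1 h).2
  by_cases hS₂ : q₂ ∈ γ.S
  · have h2' : q₂' ∈ γ.S := mem_S_of_S2 hF (S2.recv q₂ q₂' m hr (Or.inl hS₂) hsend)
    have h1' : q₁' ∈ γ.S :=
      mem_S_of_S2 hF (S2.send q₁ q₁' m hs hS₁ (Or.inr ⟨q₂, q₂', hr, hS₂⟩))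
    refine h.add_one hγ q₁' (fun r hrS hne => ?_) (Or.inl h1')
    have h3 : r ≠ q₂' := by rintro rfl; exact hrS h2'
    rw [hcount r hrS, if_neg hne, if_neg h3]; omega
  obtain ⟨⟨a, ha⟩, hc₂, -⟩ := (h q₂ h₂).resolve_left hS₂
  have hmq₂ : m ∈ P.Rec q₂ := ⟨q₂', hr⟩
  -- the tokens of the receiver move along the reception
  have hq₂' : q₂' ∉ γ.S → ∀ b, (q₂, b) ∈ γ.Toks → b ≠ m ∧ b ∈ P.Rec q₂' ∧ (q₂', b) ∈ γ.Toks := by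
    intro hS b hb
    have hbm : b ≠ m := by
      rintro rfl
      exact hS (mem_S_of_S2 hF (S2.recv q₂ q₂' b hr (Or.inr hb) hsend))
    have hbr : b ∈ P.Rec q₂' := by
      by_contra hbr
      exact hS (mem_S_of_S2 hF (S2.tokEnd q₂ q₂' m b hr hb hbm hsend hbr))
    exact ⟨hbm, hbr, mem_toks_of_toks2 hF (Toks2.tokStep q₂ q₂' m b hr hb hbm hsend hbr) hS⟩
  by_cases hS₁' : q₁' ∈ γ.S
  · refine h.add_one hγ q₂' (fun r hrS hne => ?_) ?_
    · have h3 : r ≠ q₁' := by rintro rfl; exact hrS hS₁'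
      rw [hcount r hrS, if_neg hne, if_neg h3]; omega
    by_cases hS₂' : q₂' ∈ γ.S
    · exact Or.inl hS₂'
    right
    obtain ⟨ham, har, hat⟩ := hq₂' hS₂' a ha
    have hold : ∀ r, r ∉ γ.S → r ≠ q₂ → 0 < C.count r → r ≠ q₂' ∧ γ.ConflictFree P q₂' r := by
      intro r hrS hne hc
      obtain ⟨c, b, hcb, hc1, hb, hcr, hbq⟩ := hCF q₂ r hS₂ hrS h₂ hc hne.symm
      obtain ⟨-, hcr', hct⟩ := hq₂' hS₂' c hc1
      refine ⟨?_, c, b, hcb, hct, hb, hcr, fun hb' => ?_⟩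
      · rintro rfl; exact hcr hcr'
      · exact hcr (rec_of_rec hF hγ hb hct hcb.symm hb')
    refine ⟨⟨a, hat⟩, ?_, fun r hrS hne hc => ?_⟩
    · have h3 : q₂' ≠ q₁' := by rintro h3; exact hS₂' (h3 ▸ hS₁')
      rw [hcount _ hS₂', if_pos rfl, if_neg h3]
      split_ifs with h4
      · rw [h4]; omega
      · have : ¬ 0 < C.count q₂' := fun h0 => (hold q₂' hS₂' h4 h0).1 rfl
        omega
    · have h3 : r ≠ q₁' := by rintro rfl; exact hrS hS₁'
      rw [hcount r hrS, if_neg hne, if_neg h3] at hc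
      split_ifs at hc with h4
      · subst h4; omega
      · exact (hold r hrS h4 (by omega)).2
  -- the sender ends in a token `(q₁', m)`, and the receiver in `S`
  have hmr : m ∈ P.Rec q₁' := by
    by_contra hmr
    exact hS₁' (mem_S_of_S2 hF (S2.send q₁ q₁' m hs hS₁ (Or.inl hmr)))
  have hcr : ¬ P.CanReceive γ.S m := fun hc =>
    hS₁' (mem_S_of_S2 hF (S2.send q₁ q₁' m hs hS₁ (Or.inr hc)))
  have htok : (q₁', m) ∈ γ.Toks :=
    mem_toks_of_toks2 hF (Toks2.newTok q₁ q₁' m hs hS₁ hmr hcr) hS₁'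
  have hS₂' : q₂' ∈ γ.S := by
    by_contra hS₂'
    obtain ⟨ham, -, hat⟩ := hq₂' hS₂' a ha
    exact hS₁' (mem_S_of_S1 hF (S1.threeToks q₁' q₂ q₂' m a (.base _ htok) (.base _ ha)
      (.base _ hat) ham.symm hr))
  have hold : ∀ r, r ∉ γ.S → r ≠ q₂ → 0 < C.count r → r ≠ q₁' ∧ γ.ConflictFree P q₁' r := by
    intro r hrS hne hc
    obtain ⟨c, b, hcb, hct, hb, hcr', hbq⟩ := hCF q₂ r hS₂ hrS h₂ hc hne.symm
    have hbm : m ≠ b := by rintro rfl; exact hbq hmq₂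
    have hmr' : m ∉ P.Rec r := by
      intro hmr'
      have hbr : b ∈ P.Rec q₁' := rec_of_rec hF hγ htok hb hbm hmr'
      have hcm : c ≠ m := by rintro rfl; exact hcr' hmr'
      have hcq : c ∈ P.Rec q₁' := rec_of_rec hF hγ htok hct hcm.symm hmq₂
      exact hS₂ (mem_S_of_S1 hF (S1.threeToks' q₂ r q₁' c b m (.base _ hct) (.base _ hb)
        (.base _ htok) hcb hcm hbm.symm hcr' hcq hbq hbr hmr' hmq₂))
    refine ⟨?_, m, b, hbm, htok, hb, hmr', fun hb' => ?_⟩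
    · rintro rfl; exact hmr' hmr
    · exact hmr' (rec_of_rec hF hγ hb htok hbm.symm hb')
  refine h.add_one hγ q₁' (fun r hrS hne => ?_) (Or.inr ⟨⟨m, htok⟩, ?_, fun r hrS hne hc => ?_⟩)
  · have h3 : r ≠ q₂' := by rintro rfl; exact hrS hS₂'
    rw [hcount r hrS, if_neg hne, if_neg h3]; omega
  · have h3 : q₁' ≠ q₂' := by rintro h3; exact hS₁' (h3 ▸ hS₂')
    rw [hcount _ hS₁', if_pos rfl, if_neg h3]
    split_ifs with h4
    · rw [h4]; omega
    · have : ¬ 0 < C.count q₁' := fun h0 => (hold q₁' hS₁' h4 h0).1 rfl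
      omega
  · have h3 : r ≠ q₂' := by rintro rfl; exact hrS hS₂'
    rw [hcount r hrS, if_neg hne, if_neg h3] at hc
    split_ifs at hc with h4
    · subst h4; omega
    · exact (hold r hrS h4 (by omega)).2

/-- Completeness of the abstraction: `⟦γ⟧` contains every reachable configuration. -/
theorem respects_of_reaches (hF : P.F γ = γ) (hP : P.WaitOnlyWith A) (hγ : γ.IsAbstract A)
    (hrec : ∀ t ∈ γ.Toks, t.2 ∈ P.Rec t.1) (hinit : P.init ∈ γ.S) {C₀ C : Multiset Q}
    (h₀ : P.IsInitial C₀) (h : P.Reaches C₀ C) : γ.Respects P C := by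
  induction h with
  | refl =>
    intro q hq
    by_cases hqi : q = P.init
    · exact Or.inl (hqi ▸ hinit)
    · have := h₀.2 q hqi; omega
  | tail _ hstep ih =>
    cases hstep with
    | internal q q' ht hq => exact respects_internal hF hP hγ ih ht hq
    | rendezvous m q₁ q₁' q₂ q₂' hs hr h₁ h₂ h₁₂ =>
      exact respects_rendezvous hF hP hγ ih hs hr h₁ h₂
    | nonblocking m q q' hs hq hfree => exact respects_nonblocking hF hP hγ hrec ih hs hq hfree

end Protocol

namespace Protocol

/-! ### How tokens arise -/

section Paths

variable {Q M : Type*} {P : Protocol Q M} {γ : AbsSet Q M}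

/-- `Path P S m q`: a process in a state of `S` that requests `m`, and then only receives messages
that can be sent in `S`, may get to `q`. -/
inductive Path (P : Protocol Q M) (S : Set Q) (m : M) : Q → Prop
  | start (p p' : Q) : (p, Action.send m, p') ∈ P.T → p ∈ S → Path P S m p'
  | step (q q' : Q) (a : M) : Path P S m q → (q, Action.recv a, q') ∈ P.T → P.CanSend S a →
      Path P S m q'

theorem Path.mono {S S' : Set Q} (h : S ⊆ S') {m : M} {q : Q} (hp : P.Path S m q) :
    P.Path S' m q := by
  induction hp with
  | start p p' ht hp => exact .start p p' ht (h hp)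
  | step q q' a _ hr ha ih =>
    obtain ⟨p, p', hp, hpS⟩ := ha
    exact .step q q' a ih hr ⟨p, p', hp, h hpS⟩

theorem Path.canSend {S : Set Q} {m : M} {q : Q} (hp : P.Path S m q) : P.CanSend S m := by
  induction hp with
  | start p p' ht hp => exact ⟨p, p', ht, hp⟩
  | step _ _ _ _ _ _ ih => exact ih

theorem path_of_toks2 (hp : ∀ t ∈ γ.Toks, P.Path γ.S t.2 t.1) {t : Q × M} (h : P.Toks2 γ t) :
    P.Path γ.S t.2 t.1 := by
  cases h with
  | base _ h => exact hp _ h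
  | newTok p p' a ht hpS _ _ => exact .start p p' ht hpS
  | tokStep q q' a m hr ht _ ha _ => exact .step q q' a (hp _ ht) hr ha

/-- As `rec_of_rec`, for all members of the sequence but not only for fixpoints: `F` removes
all tokens that violate it, by `S1.twoToks`. -/
theorem rec_of_rec_absSeq (P : Protocol Q M) (i : ℕ) {q₁ q₂ : Q} {m₁ m₂ : M}
    (h₁ : (q₁, m₁) ∈ (P.absSeq i).Toks) (h₂ : (q₂, m₂) ∈ (P.absSeq i).Toks) (hne : m₁ ≠ m₂)
    (h : m₁ ∈ P.Rec q₂) : m₂ ∈ P.Rec q₁ := by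
  cases i with
  | zero => exact h₁.elim
  | succ i =>
    rw [absSeq_succ] at h₁ h₂
    by_contra h'
    exact h₁.2 (S1.twoToks q₁ q₂ m₁ m₂ h₁.1 h₂.1 hne h' h)

end Paths

/-! ### Coverable configurations can be extended -/

section Cover

variable {Q M : Type*} [DecidableEq Q] {P : Protocol Q M}

theorem CCover.mono {C D : Multiset Q} (h : P.CCover D) (hCD : C ≤ D) : P.CCover C := by
  obtain ⟨C₀, C', h₀, hle, hr⟩ := h
  exact ⟨C₀, C', h₀, hCD.trans hle, hr⟩

theorem CCover.congr {C D : Multiset Q} (h : P.CCover C) (e : C = D := by abel) : P.CCover D :=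
  e ▸ h

theorem CCover.tau {q q' : Q} {X : Multiset Q} (ht : (q, Action.tau, q') ∈ P.T)
    (h : P.CCover ({q} + X)) : P.CCover ({q'} + X) := by
  obtain ⟨C₀, C', h₀, hle, hr⟩ := h
  obtain ⟨E, rfl⟩ := Multiset.le_iff_exists_add.1 hle
  refine ⟨C₀, _, h₀, ?_, hr.tail (Step.internal _ q q' ht (by simp))⟩
  rw [add_assoc, add_tsub_cancel_left]
  exact Multiset.le_iff_exists_add.2 ⟨E, by abel⟩

theorem CCover.rendezvous {q₁ q₁' q₂ q₂' : Q} {m : M} {X : Multiset Q}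
    (hs : (q₁, Action.send m, q₁') ∈ P.T) (hr : (q₂, Action.recv m, q₂') ∈ P.T)
    (h : P.CCover ({q₁} + {q₂} + X)) : P.CCover ({q₁'} + {q₂'} + X) := by
  obtain ⟨C₀, C', h₀, hle, hreach⟩ := h
  obtain ⟨E, rfl⟩ := Multiset.le_iff_exists_add.1 hle
  have h1 : 0 < ({q₁} + {q₂} + X + E).count q₁ := Multiset.count_pos.2 (by simp)
  have h2 : 0 < ({q₁} + {q₂} + X + E).count q₂ := Multiset.count_pos.2 (by simp)
  refine ⟨C₀, _, h₀, ?_, hreach.tail (Step.rendezvous _ m q₁ q₁' q₂ q₂' hs hr h1 h2 (by omega))⟩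
  have e : ∀ a b : Q, ({a, b} : Multiset Q) = {a} + {b} := fun _ _ => rfl
  rw [e, e, show ({q₁} + {q₂} + X + E : Multiset Q) = {q₁} + {q₂} + (X + E) by abel,
    add_tsub_cancel_left]
  exact Multiset.le_iff_exists_add.2 ⟨E, by abel⟩

/-- A request can be made as soon as no process that has to be kept receives it: it is either
received by one of the processes that need not be kept, or by nobody. -/
theorem CCover.send {q q' : Q} {m : M} {X : Multiset Q}
    (hs : (q, Action.send m, q') ∈ P.T) (hX : ∀ x ∈ X, m ∉ P.Rec x)
    (h : P.CCover ({q} + X)) : P.CCover ({q'} + X) := by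
  by_cases hE : ∃ r r', (r, Action.recv m, r') ∈ P.T ∧ P.CCover ({q} + {r} + X)
  · obtain ⟨r, r', hr, h⟩ := hE
    refine (CCover.rendezvous hs hr h).mono ?_
    rw [add_right_comm]
    exact Multiset.le_add_right _ _
  · obtain ⟨C₀, C', h₀, hle, hreach⟩ := h
    obtain ⟨E, rfl⟩ := Multiset.le_iff_exists_add.1 hle
    refine ⟨C₀, _, h₀, ?_, hreach.tail (Step.nonblocking _ m q q' hs (by simp) ?_)⟩
    · rw [add_assoc, add_tsub_cancel_left]
      exact Multiset.le_iff_exists_add.2 ⟨E, by abel⟩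
    · intro r r' hr
      rw [add_assoc, add_tsub_cancel_left, Multiset.count_eq_zero]
      intro hmem
      rcases Multiset.mem_add.1 hmem with hmem | hmem
      · exact hX r hmem ⟨r', hr⟩
      · refine hE ⟨r, r', hr, C₀, _, h₀, ?_, hreach⟩
        obtain ⟨E', rfl⟩ := Multiset.exists_cons_of_mem hmem
        rw [show ({q} : Multiset Q) + X + (r ::ₘ E') = {q} + {r} + X + E' by
          rw [← Multiset.singleton_add]; abel]
        exact Multiset.le_add_right _ _

/-- `Free P Y`: all configurations over `Y` are coverable, that is, arbitrarily many processes can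
be put into the states of `Y`, simultaneously. -/
def Free (P : Protocol Q M) (Y : Set Q) : Prop :=
  ∀ C : Multiset Q, (∀ q ∈ C, q ∈ Y) → P.CCover C

/-- `Lead P Y X X'`: at the expense of processes in states of `Y`, the processes `X` can be turned
into the processes `X'`. -/
def Lead (P : Protocol Q M) (Y : Set Q) (X X' : Multiset Q) : Prop :=
  ∀ C : Multiset Q, (∀ q ∈ C, q ∈ Y) →
    ∃ D : Multiset Q, (∀ q ∈ D, q ∈ Y) ∧ (P.CCover (D + X) → P.CCover (C + X'))

namespace Lead

variable {S Y : Set Q} {X X' X'' : Multiset Q}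

theorem refl : Lead P Y X X := fun C hC => ⟨C, hC, id⟩

theorem trans (h : Lead P Y X X') (h' : Lead P Y X' X'') : Lead P Y X X'' := by
  intro C hC
  obtain ⟨D, hD, hDC⟩ := h' C hC
  obtain ⟨E, hE, hED⟩ := h D hD
  exact ⟨E, hE, fun hh => hDC (hED hh)⟩

theorem congr (h : Lead P Y X X') (e : X' = X'' := by abel) : Lead P Y X X'' := e ▸ h

theorem drop (h : X' ≤ X) : Lead P Y X X' := fun C hC =>
  ⟨C, hC, fun hh => hh.mono (add_le_add_right h C)⟩

theorem take {y : Q} (hy : y ∈ Y) : Lead P Y X ({y} + X) := fun C hC =>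
  ⟨C + {y}, by
    intro q hq
    rcases Multiset.mem_add.1 hq with hq | hq
    · exact hC q hq
    · rwa [Multiset.mem_singleton.1 hq], fun h => h.congr⟩

theorem tau {q q' : Q} (ht : (q, Action.tau, q') ∈ P.T) : Lead P Y ({q} + X) ({q'} + X) :=
  fun C hC => ⟨C, hC, fun h => (CCover.tau ht (h.congr (D := {q} + (C + X)))).congr⟩

theorem rendezvous {q₁ q₁' q₂ q₂' : Q} {m : M}
    (hs : (q₁, Action.send m, q₁') ∈ P.T) (hr : (q₂, Action.recv m, q₂') ∈ P.T) :
    Lead P Y ({q₁} + {q₂} + X) ({q₁'} + {q₂'} + X) := fun C hC =>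
  ⟨C, hC, fun h => (CCover.rendezvous hs hr (h.congr (D := {q₁} + {q₂} + (C + X)))).congr⟩

/-- A request with an arbitrary supply of processes in `Y`: if some state of `Y` receives it, then
a process in that state is sacrificed. -/
theorem send {q q' : Q} {m : M} (hs : (q, Action.send m, q') ∈ P.T)
    (hX : ∀ x ∈ X, m ∉ P.Rec x) : Lead P Y ({q} + X) ({q'} + X) := by
  by_cases hY : ∃ y ∈ Y, m ∈ P.Rec y
  · obtain ⟨y, hy, y', hy'⟩ := hY
    refine (take hy).trans (.trans ?_ (drop (X := {q'} + {y'} + X) ?_))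
    · have := rendezvous (Y := Y) (X := X) hs hy'
      rwa [show ({q} : Multiset Q) + {y} + X = {y} + ({q} + X) by abel] at this
    · rw [add_right_comm]; exact Multiset.le_add_right _ _
  · refine fun C hC => ⟨C, hC, fun h => ?_⟩
    refine (CCover.send hs ?_ (h.congr (D := {q} + (C + X)))).congr
    intro x hx hm
    rcases Multiset.mem_add.1 hx with hx | hx
    · exact hY ⟨x, hC x hx, hm⟩
    · exact hX x hx hm

/-- A reception of a message that can be sent in `S`, at the expense of one sender. -/
theorem recv {q q' : Q} {a : M} (hSY : S ⊆ Y) (ha : P.CanSend S a)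
    (hr : (q, Action.recv a, q') ∈ P.T) : Lead P Y ({q} + X) ({q'} + X) := by
  obtain ⟨p, p', hp, hpS⟩ := ha
  refine (take (hSY hpS)).trans (.trans ?_ (drop (X := {p'} + {q'} + X) ?_))
  · rw [← add_assoc]; exact rendezvous hp hr
  · rw [add_assoc]; exact Multiset.le_add_left _ _

end Lead

/-- A token `(q, m)` can be placed next to processes that do not receive `m`. -/
theorem Lead.place {S Y : Set Q} (hSY : S ⊆ Y) {X : Multiset Q} {m : M} {q : Q}
    (hp : P.Path S m q) (hX : ∀ x ∈ X, m ∉ P.Rec x) : P.Lead Y X ({q} + X) := by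
  induction hp with
  | start p p' ht hp => exact (take (hSY hp)).trans (send ht hX)
  | step q q' a _ hr ha ih => exact ih.trans (recv hSY ha hr)

/-- A token `(q, m)` can be placed at the expense of a process that receives `m`. -/
theorem Lead.placeRecv {S Y : Set Q} (hSY : S ⊆ Y) {X : Multiset Q} {m : M} {q r r' : Q}
    (hp : P.Path S m q) (hr : (r, Action.recv m, r') ∈ P.T) :
    P.Lead Y ({r} + X) ({q} + {r'} + X) := by
  induction hp with
  | start p p' ht hp =>
    refine (take (hSY hp)).trans ?_
    rw [← add_assoc]
    exact rendezvous ht hr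
  | step q q' a _ hr' ha ih =>
    refine ih.trans ?_
    rw [add_assoc, add_assoc]
    exact recv hSY ha hr'

/-- A state of which any number of copies can be produced from `Y` may be added to `Y`. -/
theorem Free.insert {Y : Set Q} (hY : P.Free Y) {u : Q}
    (hu : ∀ k, P.Lead Y 0 (Multiset.replicate k u)) : P.Free (insert u Y) := by
  intro C hC
  obtain ⟨D, hD, h⟩ := hu (C.count u) (C.filter fun q => ¬ q = u) (by
    intro q hq
    rw [Multiset.mem_filter] at hq
    exact (hC q hq.1).resolve_left hq.2)
  refine (h ((hY D hD).congr (add_zero D).symm)).congr ?_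
  rw [← Multiset.filter_eq', add_comm]
  exact Multiset.filter_add_not _ _

/-- Several states are added one after the other; only finitely many of them are needed for a
given configuration. -/
theorem Free.of_lead {S Z : Set Q} (hS : P.Free S)
    (h : ∀ Y, S ⊆ Y → ∀ u ∈ Z, ∀ k, P.Lead Y 0 (Multiset.replicate k u)) : P.Free Z := by
  have : ∀ C : Multiset Q, (∀ q ∈ C, q ∈ Z) → P.Free (S ∪ {q | q ∈ C}) := by
    intro C
    induction C using Multiset.induction with
    | empty => intro _; simpa using hS
    | cons a C ih =>
      intro hC
      have := (ih fun q hq => hC q (Multiset.mem_cons_of_mem hq)).insert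
        (h _ Set.subset_union_left a (hC a (Multiset.mem_cons_self a C)))
      refine fun D hD => this D fun q hq => ?_
      rcases hD q hq with h1 | h1
      · exact Or.inr (Or.inl h1)
      · rcases Multiset.mem_cons.1 h1 with h2 | h2
        · exact Or.inl h2
        · exact Or.inr (Or.inr h2)
  exact fun C hC => this C hC C fun q hq => Or.inr hq

/-- Repeating a transformation that adds one process in state `u`, while keeping `X`. -/
theorem Lead.replicate {Y : Set Q} {u : Q} {X : Multiset Q} (h₀ : P.Lead Y 0 X)
    (h : ∀ k, P.Lead Y (X + Multiset.replicate k u) (X + Multiset.replicate (k + 1) u)) (k : ℕ) :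
    P.Lead Y 0 (Multiset.replicate k u) := by
  refine Lead.trans (X' := X + Multiset.replicate k u) ?_ (drop (Multiset.le_add_left _ _))
  induction k with
  | zero => simpa using h₀
  | succ k ih => exact ih.trans (h k)

theorem Lead.replicate_zero {Y : Set Q} {u : Q}
    (h : ∀ k, P.Lead Y (Multiset.replicate k u) ({u} + Multiset.replicate k u)) (k : ℕ) :
    P.Lead Y 0 (Multiset.replicate k u) :=
  Lead.replicate (X := 0) refl (fun k => by
    rw [zero_add, zero_add, Multiset.replicate_succ, ← Multiset.singleton_add]; exact h k) k

end Cover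

/-! ### Soundness of the abstraction -/

section Sound

variable {Q M : Type*} [DecidableEq Q] {P : Protocol Q M} {γ : AbsSet Q M}

/-- Every state that is put into `S''` can be produced in any number from `S`. -/
theorem lead_of_S2 (hp : ∀ t ∈ γ.Toks, P.Path γ.S t.2 t.1) {Y : Set Q} (hSY : γ.S ⊆ Y) {u : Q}
    (hu : P.S2 γ u) (k : ℕ) : P.Lead Y 0 (Multiset.replicate k u) := by
  cases hu with
  | base _ h => exact Lead.replicate_zero (fun k => Lead.take (hSY h)) k
  | internal p _ ht hpS =>
    exact Lead.replicate_zero (fun k => (Lead.take (hSY hpS)).trans (Lead.tau ht)) k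
  | send p _ a ht hpS h =>
    refine Lead.replicate_zero (fun k => ?_) k
    refine (Lead.take (hSY hpS)).trans ?_
    rcases h with h | ⟨r, r', hr, hrS⟩
    · exact Lead.send ht fun x hx => by rwa [Multiset.eq_of_mem_replicate hx]
    · refine (Lead.take (hSY hrS)).trans ?_
      rw [← add_assoc, add_comm ({r} : Multiset Q)]
      refine (Lead.rendezvous ht hr).trans (Lead.drop ?_)
      rw [add_right_comm]; exact Multiset.le_add_right _ _
  | recv q _ a hr hq ha =>
    rcases hq with hq | hq
    · exact Lead.replicate_zero (fun k => (Lead.take (hSY hq)).trans (Lead.recv hSY ha hr)) k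
    · -- one process is kept in `q`; each new one takes its place when it moves on to `u`
      refine Lead.replicate (X := {q}) ?_ (fun k => ?_) k
      · simpa using Lead.place hSY (X := 0) (hp _ hq) (by simp)
      · refine (Lead.placeRecv hSY (hp _ hq) hr).congr ?_
        rw [Multiset.replicate_succ, ← Multiset.singleton_add, add_assoc]
  | tokEnd q _ a m hr hq hne ha hm =>
    refine Lead.replicate_zero (fun k => ?_) k
    refine (Lead.place hSY (hp _ hq) fun x hx => ?_).trans (Lead.recv hSY ha hr)
    rwa [Multiset.eq_of_mem_replicate hx]

/-- Every state that is put into `S'` can be produced in any number from `S`. -/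
theorem lead_of_S1 (hp : ∀ t ∈ γ.Toks, P.Path γ.S t.2 t.1)
    (hrec : ∀ t ∈ γ.Toks, t.2 ∈ P.Rec t.1) {Y : Set Q} (hSY : γ.S ⊆ Y)
    {u : Q} (hu : P.S1 γ u) (k : ℕ) : P.Lead Y 0 (Multiset.replicate k u) := by
  have two : ∀ {q₂ : Q} {m₁ m₂ : M}, P.Toks2 γ (u, m₁) → P.Toks2 γ (q₂, m₂) →
      m₂ ∉ P.Rec u → m₁ ∈ P.Rec q₂ → P.Lead Y 0 (Multiset.replicate k u) := by
    intro q₂ m₁ m₂ h₁ h₂ hm₂ ⟨r', hr⟩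
    refine Lead.replicate_zero (fun k => ?_) k
    refine (Lead.place hSY (path_of_toks2 hp h₂) fun x hx => ?_).trans ?_
    · rwa [Multiset.eq_of_mem_replicate hx]
    · refine (Lead.placeRecv hSY (path_of_toks2 hp h₁) hr).trans (Lead.drop ?_)
      rw [add_right_comm]; exact Multiset.le_add_right _ _
  cases hu with
  | base h => exact lead_of_S2 hp hSY h k
  | twoToks q₂ m₁ m₂ h₁ h₂ hne hm₂ hm₁ => exact two h₁ h₂ hm₂ hm₁
  | threeToks q₂ q₃ m₁ m₂ h₁ h₂ h₃ hne hr =>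
    by_cases hm₂ : m₂ ∈ P.Rec u
    · -- one process is kept in `q₃`: it gives way to one in `q₂`, which returns to `q₃`
      obtain ⟨r', hr'⟩ := rec_of_toks2 hrec h₃
      refine Lead.replicate (X := {q₃}) ?_ (fun k => ?_) k
      · simpa using Lead.place hSY (X := 0) (path_of_toks2 hp h₃) (by simp)
      · refine (Lead.placeRecv hSY (path_of_toks2 hp h₂) hr').trans ?_
        rw [add_assoc]
        refine (Lead.placeRecv hSY (path_of_toks2 hp h₁) hr).trans (Lead.drop ?_)
        rw [Multiset.replicate_succ, ← Multiset.singleton_add, Multiset.le_iff_exists_add]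
        exact ⟨{r'}, by abel⟩
    · exact two h₁ h₂ hm₂ ⟨q₃, hr⟩
  | threeToks' q₂ q₃ m₁ m₂ m₃ h₁ h₂ h₃ _ _ _ _ h₁₃ h₂₁ _ h₃₂ _ =>
    -- a process in `q₂` absorbs the request of one that goes to `q₃`,
    -- which in turn absorbs the request of one that goes to `u`
    obtain ⟨r, hr⟩ := h₃₂
    obtain ⟨r', hr'⟩ := h₁₃
    refine Lead.replicate_zero (fun k => ?_) k
    refine (Lead.place hSY (path_of_toks2 hp h₂) fun x hx => ?_).trans ?_
    · rwa [Multiset.eq_of_mem_replicate hx]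
    refine (Lead.placeRecv hSY (path_of_toks2 hp h₃) hr).trans ?_
    rw [add_assoc]
    refine (Lead.placeRecv hSY (path_of_toks2 hp h₁) hr').trans (Lead.drop ?_)
    rw [Multiset.le_iff_exists_add]
    exact ⟨{r'} + {r}, by abel⟩

theorem free_init (P : Protocol Q M) : P.Free {P.init} := by
  intro C hC
  refine ⟨Multiset.replicate (C.card + 1) P.init, _, ⟨?_, fun q hq => ?_⟩, ?_, .refl⟩
  · rw [Multiset.replicate_succ]; exact Multiset.cons_ne_zero
  · exact Multiset.count_eq_zero.2 fun h => hq (Multiset.eq_of_mem_replicate h)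
  · have h : C = Multiset.replicate C.card P.init := Multiset.eq_replicate.2 ⟨rfl, hC⟩
    conv_lhs => rw [h]
    exact Multiset.replicate_le_replicate _ |>.2 (Nat.le_succ _)

/-- The invariants of soundness: the states of `S` can be populated arbitrarily, and tokens arise
from `S`. -/
theorem free_absSeq (P : Protocol Q M) (i : ℕ) : P.Free (P.absSeq i).S ∧
    ∀ t ∈ (P.absSeq i).Toks, P.Path (P.absSeq i).S t.2 t.1 := by
  induction i with
  | zero => exact ⟨free_init P, fun t ht => ht.elim⟩
  | succ i ih =>
    rw [absSeq_succ]
    exact ⟨ih.1.of_lead fun Y hY u hu k =>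
        lead_of_S1 ih.2 (rec_of_mem_absSeq P i) hY hu k,
      fun t ht => (path_of_toks2 ih.2 ht.1).mono (S_subset_F P _)⟩

/-- Pairwise conflict-free states can be populated one after the other, in any order. -/
theorem lead_conflictFree (P : Protocol Q M) (i : ℕ) (K : Multiset Q) (hK : K.Nodup)
    (hst : ∀ q ∈ K, q ∈ (P.absSeq i).st)
    (hcf : ∀ q ∈ K, ∀ q' ∈ K, q ≠ q' → (P.absSeq i).ConflictFree P q q') :
    P.Lead (P.absSeq i).S 0 K := by
  induction K using Multiset.induction with
  | empty => exact Lead.refl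
  | cons q K ih =>
    rw [Multiset.nodup_cons] at hK
    refine (ih hK.2 (fun q hq => hst q (Multiset.mem_cons_of_mem hq)) fun q hq q' hq' =>
      hcf q (Multiset.mem_cons_of_mem hq) q' (Multiset.mem_cons_of_mem hq')).trans ?_
    obtain ⟨m, hm⟩ := hst q (Multiset.mem_cons_self q K)
    rw [← Multiset.singleton_add]
    refine Lead.place subset_rfl ((free_absSeq P i).2 _ hm) fun x hx hmx => ?_
    obtain ⟨m₁, m₂, -, -, hm₂, -, hm₂q⟩ := hcf q (Multiset.mem_cons_self q K) x
      (Multiset.mem_cons_of_mem hx) (by rintro rfl; exact hK.1 hx)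
    have hne : m ≠ m₂ := by rintro rfl; exact hm₂q (rec_of_mem_absSeq P i _ hm)
    exact hm₂q (rec_of_rec_absSeq P i hm hm₂ hne hmx)

/-- Soundness of the abstraction: all configurations in `⟦γ_i⟧` are coverable. -/
theorem ccover_of_respects (P : Protocol Q M) (i : ℕ) {C : Multiset Q}
    (h : (P.absSeq i).Respects P C) : P.CCover C := by
  classical
  have hin : ∀ q ∈ C.filter (¬ · ∈ (P.absSeq i).S), 0 < C.count q ∧ q ∉ (P.absSeq i).S := by
    intro q hq
    rw [Multiset.mem_filter] at hq
    exact ⟨Multiset.count_pos.2 hq.1, hq.2⟩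
  have hL := lead_conflictFree P i (C.filter (¬ · ∈ (P.absSeq i).S)) ?_ ?_ ?_
  · obtain ⟨D, hD, hDC⟩ := hL (C.filter (· ∈ (P.absSeq i).S)) fun q hq =>
      (Multiset.mem_filter.1 hq).2
    refine (hDC (((free_absSeq P i).1 D hD).congr (add_zero D).symm)).congr ?_
    exact Multiset.filter_add_not _ _
  · rw [Multiset.nodup_iff_count_le_one]
    intro q
    by_cases hq : q ∈ C.filter (¬ · ∈ (P.absSeq i).S)
    · obtain ⟨h1, h2⟩ := hin q hq
      exact (Multiset.count_le_of_le q (Multiset.filter_le _ _)).trans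
        ((h q h1).resolve_left h2).2.1.le
    · rw [Multiset.count_eq_zero.2 hq]; exact Nat.zero_le _
  · intro q hq
    obtain ⟨h1, h2⟩ := hin q hq
    exact ((h q h1).resolve_left h2).1
  · intro q hq q' hq' hne
    obtain ⟨h1, h2⟩ := hin q hq
    obtain ⟨h1', h2'⟩ := hin q' hq'
    have h3 := (h q' h1').resolve_left h2'
    exact ((h q h1).resolve_left h2).2.2 q' ⟨h3.1, hne.symm⟩ h3.2.1

end Sound

/-- Coverability is membership in the fixpoint of `F`. -/
theorem ccover_iff_respects {Q M : Type*} [Fintype Q] [Fintype M] [DecidableEq Q]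
    {P : Protocol Q M} {A : Set Q} (hP : P.WaitOnlyWith A) {i : ℕ} (hi : iterBound Q M ≤ i)
    (C : Multiset Q) : P.CCover C ↔ (P.absSeq i).Respects P C := by
  refine ⟨fun ⟨C₀, C', h₀, hle, hr⟩ => ?_, ccover_of_respects P i⟩
  exact (respects_of_reaches (isFixedPt_absSeq P hi) hP (hP.isAbstract_absSeq i)
    (rec_of_mem_absSeq P i) (init_mem_absSeq P i) h₀ hr).mono (hP.isAbstract_absSeq i) hle

end Protocol

/-! ### Structured programs over stacks -/

/-- Structured programs that manipulate stacks over the alphabet `G`, indexed by `K`. Branches and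
loops test the top of a stack, which is `none` for an empty stack. -/
inductive Prog (K G : Type) where
  | push (k : K) (a : G) : Prog K G
  | pop (k : K) : Prog K G
  | move (k k' : K) : Prog K G
  | seq (p q : Prog K G) : Prog K G
  | ite (k : K) (f : Option G → Bool) (p q : Prog K G) : Prog K G
  | loop (k : K) (f : Option G → Bool) (p : Prog K G) : Prog K G

namespace Prog

open Turing Function

variable {K G : Type}

/-- `Runs p S S' t`: started on the stacks `S`, the program `p` stops after `t` steps, and leaves
the stacks `S'`. -/
inductive Runs [DecidableEq K] : Prog K G → (K → List G) → (K → List G) → ℕ → Prop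
  | push (k : K) (a : G) (S : K → List G) : Runs (push k a) S (update S k (a :: S k)) 1
  | pop (k : K) (S : K → List G) : Runs (pop k) S (update S k (S k).tail) 1
  | move_nil (k k' : K) (S : K → List G) (h : S k = []) : Runs (move k k') S S 1
  | move_cons (k k' : K) (S : K → List G) (a : G) (l : List G) (h : S k = a :: l) (hk : k' ≠ k) :
      Runs (move k k') S (update (update S k l) k' (a :: S k')) 1
  | seq {p q : Prog K G} {S S' S'' : K → List G} {t t' : ℕ} (h : Runs p S S' t)
      (h' : Runs q S' S'' t') : Runs (seq p q) S S'' (t + t')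
  | ite_true {k : K} {f : Option G → Bool} {p q : Prog K G} {S S' : K → List G} {t : ℕ}
      (hf : f (S k).head? = true) (h : Runs p S S' t) : Runs (ite k f p q) S S' (1 + t)
  | ite_false {k : K} {f : Option G → Bool} {p q : Prog K G} {S S' : K → List G} {t : ℕ}
      (hf : f (S k).head? = false) (h : Runs q S S' t) : Runs (ite k f p q) S S' (1 + t)
  | loop_true {k : K} {f : Option G → Bool} {p : Prog K G} {S S' S'' : K → List G} {t t' : ℕ}
      (hf : f (S k).head? = true) (h : Runs p S S' t) (h' : Runs (loop k f p) S' S'' t') :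
      Runs (loop k f p) S S'' (1 + (t + t'))
  | loop_false {k : K} {f : Option G → Bool} {p : Prog K G} {S : K → List G}
      (hf : f (S k).head? = false) : Runs (loop k f p) S S 1

/-! ### Structured programs are run by Turing machines -/

/-- The control states of the machine that runs a program. -/
def Lab : Prog K G → Type
  | push _ _ => Unit
  | pop _ => Unit
  | move _ _ => Unit
  | seq p q => Lab p ⊕ Lab q
  | ite _ _ p q => Option (Lab p ⊕ Lab q)
  | loop _ _ p => Option (Lab p)

/-- There are finitely many control states. -/
@[reducible]
def labFintype : (p : Prog K G) → Fintype (Lab p)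
  | push _ _ => inferInstanceAs (Fintype Unit)
  | pop _ => inferInstanceAs (Fintype Unit)
  | move _ _ => inferInstanceAs (Fintype Unit)
  | seq p q =>
    letI := labFintype p
    letI := labFintype q
    inferInstanceAs (Fintype (Lab p ⊕ Lab q))
  | ite _ _ p q =>
    letI := labFintype p
    letI := labFintype q
    inferInstanceAs (Fintype (Option (Lab p ⊕ Lab q)))
  | loop _ _ p =>
    letI := labFintype p
    inferInstanceAs (Fintype (Option (Lab p)))

/-- The control state in which a program starts. -/
def entry : (p : Prog K G) → Lab p
  | push _ _ => ()
  | pop _ => ()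
  | move _ _ => ()
  | seq p _ => Sum.inl (entry p)
  | ite _ _ _ _ => none
  | loop _ _ _ => none

/-- The stacks of the machine: those of the program, and an output stack. -/
def StackType (K G : Type) : Option K → Type
  | none => Bool
  | some _ => G

/-- The machine instructions of a program whose control states are embedded into `Λ` by `emb`, and
which continues at `exit`. The internal state of the machine is the last symbol read. -/
def code [Inhabited G] {Λ : Type} :
    (p : Prog K G) → (emb : Lab p → Λ) → (exit : Λ) → Lab p →
      TM2.Stmt (StackType K G) Λ (Option G)
  | push k a, _, exit, _ => .push (some k) (fun _ => a) (.goto fun _ => exit)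
  | pop k, _, exit, _ => .pop (some k) (fun v _ => v) (.goto fun _ => exit)
  | move k k', _, exit, _ =>
    .pop (some k) (fun _ (o : Option G) => o) (.branch Option.isSome
      (.push (some k') (fun v => (v.getD default : G)) (.goto fun _ => exit)) (.goto fun _ => exit))
  | seq p q, emb, exit, l =>
    Sum.elim (code p (fun l => emb (.inl l)) (emb (.inr (entry q))))
      (code q (fun l => emb (.inr l)) exit) l
  | ite k f p q, emb, exit, l =>
    Option.elim l
      (.peek (some k) (fun _ (o : Option G) => o) (.branch f
        (.goto fun _ => emb (some (.inl (entry p)))) (.goto fun _ => emb (some (.inr (entry q))))))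
      (Sum.elim (code p (fun l => emb (some (.inl l))) exit)
        (code q (fun l => emb (some (.inr l))) exit))
  | loop k f p, emb, exit, l =>
    Option.elim l
      (.peek (some k) (fun _ (o : Option G) => o) (.branch f
        (.goto fun _ => emb (some (entry p))) (.goto fun _ => exit)))
      (code p (fun l => emb (some l)) (emb none))

/-- The stacks of the machine, given the output and the stacks of the program. -/
def stks (out : List Bool) (S : K → List G) : (k : Option K) → List (StackType K G k)
  | none => out
  | some k => S k

theorem update_stks [DecidableEq K] (out : List Bool) (S : K → List G) (k : K) (l : List G) :
    update (stks out S) (some k) l = stks out (update S k l) := by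
  funext k'
  cases k' with
  | none => exact update_of_ne (a := (none : Option K)) (a' := some k) (by simp) _ _
  | some k' =>
    by_cases h : k' = k
    · subst h; exact (update_self _ _ _).trans (update_self (β := fun _ => List G) k' l S).symm
    · exact (update_of_ne (fun h' => h (Option.some.inj h')) _ _).trans
        (update_of_ne (β := fun _ => List G) h l S).symm

theorem update_stks_none [DecidableEq K] (out out' : List Bool) (S : K → List G) :
    update (stks out S) none out' = stks out' S := by
  funext k'
  cases k' with
  | none => exact update_self _ _ _
  | some k' => exact update_of_ne (a := some k') (a' := (none : Option K)) (by simp) _ _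

/-- `t` steps of a stack machine. -/
def StepsTo {K : Type} [DecidableEq K] {Γ : K → Type} {Λ σ : Type} (m : Λ → TM2.Stmt Γ Λ σ)
    (t : ℕ) (c c' : TM2.Cfg Γ Λ σ) : Prop :=
  (flip bind (TM2.step m))^[t] (some c) = some c'

theorem StepsTo.trans {K : Type} [DecidableEq K] {Γ : K → Type} {Λ σ : Type}
    {m : Λ → TM2.Stmt Γ Λ σ} {t t' : ℕ} {c c' c'' : TM2.Cfg Γ Λ σ}
    (h : StepsTo m t c c') (h' : StepsTo m t' c' c'') : StepsTo m (t + t') c c'' := by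
  unfold StepsTo at *
  rw [add_comm, iterate_add_apply, h, h']

theorem StepsTo.one {K : Type} [DecidableEq K] {Γ : K → Type} {Λ σ : Type}
    {m : Λ → TM2.Stmt Γ Λ σ} {l : Λ} {v : σ} {S : ∀ k, List (Γ k)} {s : TM2.Stmt Γ Λ σ}
    {c : TM2.Cfg Γ Λ σ} (hm : m l = s) (h : TM2.stepAux s v S = c) :
    StepsTo m 1 ⟨some l, v, S⟩ c := by
  subst hm h; rfl

/-- The compiled code simulates the program, step by step. -/
theorem stepsTo_of_runs [DecidableEq K] [Inhabited G] {Λ : Type}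
    {m : Λ → TM2.Stmt (StackType K G) Λ (Option G)} (out : List Bool) {p : Prog K G}
    {S S' : K → List G} {t : ℕ} (h : Runs p S S' t) :
    ∀ (emb : Lab p → Λ) (exit : Λ), (∀ l, m (emb l) = code p emb exit l) → ∀ v, ∃ v',
      StepsTo m t ⟨some (emb (entry p)), v, stks out S⟩ ⟨some exit, v', stks out S'⟩ := by
  induction h with
  | push k a S =>
    intro emb exit hm v
    exact ⟨v, .one (hm _) (congrArg (TM2.Cfg.mk (some exit) v) (update_stks out S k _))⟩
  | pop k S =>
    intro emb exit hm v
    exact ⟨v, .one (hm _) (congrArg (TM2.Cfg.mk (some exit) v) (update_stks out S k _))⟩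
  | move_nil k k' S h =>
    intro emb exit hm v
    refine ⟨none, .one (hm _) ?_⟩
    have e : stks out S (some k) = ([] : List G) := h
    have e' : update (stks out S) (some k) ([] : List G) = stks out S := by
      rw [← e]; exact update_eq_self _ _
    simp only [code, TM2.stepAux]
    rw [e]
    exact congrArg (TM2.Cfg.mk (some exit) none) e'
  | move_cons k k' S a l h hk =>
    intro emb exit hm v
    refine ⟨some a, .one (hm _) ?_⟩
    have e : stks out S (some k) = (a :: l : List G) := h
    simp only [code, TM2.stepAux]
    rw [e]
    refine congrArg (TM2.Cfg.mk (some exit) (some a)) ?_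
    refine (congrArg (fun S' : (k : Option K) → List (StackType K G k) =>
      update S' (some k') (a :: S' (some k') : List G)) (update_stks out S k l)).trans ?_
    refine (update_stks out _ k' _).trans (congrArg (fun x => stks out (update _ k' (a :: x))) ?_)
    exact update_of_ne hk _ _
  | seq h h' ih ih' =>
    intro emb exit hm v
    obtain ⟨v', h1⟩ := ih (fun l => emb (.inl l)) (emb (.inr (entry _)))
      (fun l => hm (.inl l)) v
    obtain ⟨v'', h2⟩ := ih' (fun l => emb (.inr l)) exit (fun l => hm (.inr l)) v'
    exact ⟨v'', h1.trans h2⟩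
  | @ite_true k f p q S S' t hf h ih =>
    intro emb exit hm v
    obtain ⟨v', h1⟩ := ih (fun l => emb (some (.inl l))) exit (fun l => hm (some (.inl l)))
      (S k).head?
    refine ⟨v', StepsTo.trans ?_ h1⟩
    have key : ∀ b, f (S k).head? = b →
        TM2.stepAux (code (ite k f p q) emb exit none) v (stks out S) =
          bif b then ⟨some (emb (some (.inl (entry p)))), (S k).head?, stks out S⟩
          else ⟨some (emb (some (.inr (entry q)))), (S k).head?, stks out S⟩ := by
      rintro _ rfl; rfl
    exact .one (hm _) (key _ hf)
  | @ite_false k f p q S S' t hf h ih =>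
    intro emb exit hm v
    obtain ⟨v', h1⟩ := ih (fun l => emb (some (.inr l))) exit (fun l => hm (some (.inr l)))
      (S k).head?
    refine ⟨v', StepsTo.trans ?_ h1⟩
    have key : ∀ b, f (S k).head? = b →
        TM2.stepAux (code (ite k f p q) emb exit none) v (stks out S) =
          bif b then ⟨some (emb (some (.inl (entry p)))), (S k).head?, stks out S⟩
          else ⟨some (emb (some (.inr (entry q)))), (S k).head?, stks out S⟩ := by
      rintro _ rfl; rfl
    exact .one (hm _) (key _ hf)
  | @loop_true k f p S S' S'' t t' hf h h' ih ih' =>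
    intro emb exit hm v
    obtain ⟨v', h1⟩ := ih (fun l => emb (some l)) (emb none) (fun l => hm (some l)) (S k).head?
    obtain ⟨v'', h2⟩ := ih' emb exit hm v'
    refine ⟨v'', StepsTo.trans ?_ (h1.trans h2)⟩
    have key : ∀ b, f (S k).head? = b →
        TM2.stepAux (code (loop k f p) emb exit none) v (stks out S) =
          bif b then ⟨some (emb (some (entry p))), (S k).head?, stks out S⟩
          else ⟨some exit, (S k).head?, stks out S⟩ := by
      rintro _ rfl; rfl
    exact .one (hm _) (key _ hf)
  | @loop_false k f p S hf =>
    intro emb exit hm v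
    refine ⟨(S k).head?, ?_⟩
    have key : ∀ b, f (S k).head? = b →
        TM2.stepAux (code (loop k f p) emb exit none) v (stks out S) =
          bif b then ⟨some (emb (some (entry p))), (S k).head?, stks out S⟩
          else ⟨some exit, (S k).head?, stks out S⟩ := by
      rintro _ rfl; rfl
    exact .one (hm _) (key _ hf)

end Prog

instance : Inhabited Sym := ⟨Sym.tally⟩

instance : DecidableEq Sym := fun a b => by
  cases a <;> cases b <;>
    first
    | exact isTrue rfl
    | exact decidable_of_iff (_ = _) (Sym.bit.injEq _ _).symm.to_iff
    | exact isFalse (by simp)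

instance : Fintype Sym :=
  Fintype.ofList [.tally, .sep, .tau, .send, .recv, .bit true, .bit false]
    (by rintro (_ | _ | _ | _ | _ | (_ | _)) <;> simp)

namespace Prog

open Turing Function

variable {K : Type}

/-- The bit coded by the last symbol read. -/
def readBit : Option Sym → Bool
  | some (.bit b) => b
  | _ => false

/-- The machine that runs `p` on an input on the stack `kin`, and then outputs the bit on the
stack `kres`. -/
def machine [DecidableEq K] [Fintype K] (p : Prog K Sym) (kin kres : K) : FinTM2 :=
  letI := labFintype p
  { K := Option K
    k₀ := some kin
    k₁ := none
    Γ := StackType K Sym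
    Λ := Option (Lab p)
    main := some (entry p)
    σ := Option Sym
    initialState := none
    Γk₀Fin := inferInstanceAs (Fintype Sym)
    m := fun l => Option.elim l
      (.pop (some kres) (fun _ (o : Option Sym) => o)
        (.push none (fun v => (readBit v : Bool)) (.load (fun _ => none) .halt)))
      (code p some none) }

/-- A program that runs in polynomial time, and leaves nothing but the answer on the stack `kres`,
shows that a problem is in PTIME. -/
theorem inPTime_of_runs [DecidableEq K] [Fintype K] {α : Type} {enc : α → List Sym}
    {Pr : α → Prop} (p : Prog K Sym) (kin kres : K) (T : Polynomial ℕ)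
    (h : ∀ a, ∃ b t, (b = true ↔ Pr a) ∧ t ≤ T.eval (enc a).length ∧
      Runs p (update (fun _ => []) kin (enc a)) (update (fun _ => []) kres [.bit b]) t) :
    InPTime enc Pr := by
  classical
  refine ⟨fun a => decide (Pr a), fun a => by simp, ⟨{
    tm := machine p kin kres
    inputAlphabet := Equiv.refl Sym
    outputAlphabet := Equiv.refl Bool
    time := T + 1
    outputsFun := fun a => ?_ }⟩⟩
  have hT : (T + 1).eval (enc a).length = T.eval (enc a).length + 1 := by simp
  rw [hT]
  choose b t hb ht hr using h
  have hm := stepsTo_of_runs (m := (machine p kin kres).m) [] (hr a) some none (fun l => rfl) none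
  refine ⟨⟨t a + 1, ?_⟩, Nat.add_le_add_right (ht a) 1⟩
  obtain ⟨v', hv⟩ := hm
  have e1 : initList (machine p kin kres) (List.map (Equiv.refl Sym).invFun (enc a)) =
      ⟨some (some (entry p)), none, stks [] (update (fun _ => []) kin (enc a))⟩ := by
    refine congrArg (TM2.Cfg.mk _ _) (funext fun k => ?_)
    cases k with
    | none => exact dif_neg fun h => nomatch h
    | some k =>
      by_cases hk : k = kin
      · subst hk
        refine (dif_pos rfl).trans ?_
        change List.map id (enc a) = update (fun _ => []) k (enc a) k
        simp
      · refine (dif_neg fun h => hk (Option.some.inj h)).trans ?_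
        change [] = update (fun _ => []) kin (enc a) k
        simp [hk]
  have e2 : haltList (machine p kin kres)
        (List.map (Equiv.refl Bool).invFun (Computability.encodeBool (decide (Pr a)))) =
      ⟨none, none, stks [b a] (fun _ => [])⟩ := by
    have hba : decide (Pr a) = b a := by
      by_cases hp : Pr a
      · simp [hp, (hb a).2 hp]
      · have : b a ≠ true := fun h => hp ((hb a).1 h)
        simp [hp, this]
    rw [hba]
    refine congrArg (TM2.Cfg.mk _ _) (funext fun k => ?_)
    cases k with
    | none => exact dif_pos rfl
    | some k => exact dif_neg fun h => nomatch h
  rw [e1]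
  simp only [Option.map_some]
  rw [e2]
  refine StepsTo.trans hv (StepsTo.one (m := (machine p kin kres).m) rfl ?_)
  set S : K → List Sym := update (fun _ => []) kres [Sym.bit (b a)] with hS
  have key : ∀ l, S kres = l → TM2.stepAux ((machine p kin kres).m none) v' (stks [] S) =
      ⟨none, none, stks [readBit l.head?] (update S kres l.tail)⟩ := by
    rintro _ rfl
    refine congrArg (TM2.Cfg.mk none none) ?_
    exact (congrArg (fun S' : (k : Option K) → List (StackType K Sym k) =>
      update S' none (readBit (S kres).head? :: S' none : List Bool))
      (update_stks [] S kres (S kres).tail)).trans (update_stks_none _ _ _)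
  refine (key [Sym.bit (b a)] (by simp [hS])).trans ?_
  have e4 : update S kres [] = fun _ => [] := by
    rw [hS, update_idem]; exact update_eq_self _ _
  rw [List.tail_cons, e4]
  rfl

end Prog

open Function

/-! ### The layout of the memory -/

/-- The stacks of the machine: the word and the current table (`src true` and `src false`), scratch
stacks `ws`, `lens` and `z`, a unary copy `len` of the length `L` of the word, the stack `res` of
truth values, the table `tab` under construction, and for the variable `i` its value (`x i`) and the
difference of `L` and its value (`y i`), both in unary. -/
inductive Reg (n : ℕ) where
  | src (b : Bool) : Reg n
  | ws : Reg n
  | len : Reg n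
  | lens : Reg n
  | z : Reg n
  | res : Reg n
  | tab : Reg n
  | x (i : Fin n) : Reg n
  | y (i : Fin n) : Reg n
  deriving DecidableEq, Fintype

/-- The contents of the stacks. -/
structure Mem (n : ℕ) where
  src : Bool → List Sym
  ws : List Sym
  len : List Sym
  lens : List Sym
  z : List Sym
  res : List Sym
  tab : List Sym
  x : Fin n → List Sym
  y : Fin n → List Sym

namespace Mem

variable {n : ℕ}

/-- The contents as a function of the stack. -/
def get (m : Mem n) : Reg n → List Sym
  | .src b => m.src b
  | .ws => m.ws
  | .len => m.len
  | .lens => m.lens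
  | .z => m.z
  | .res => m.res
  | .tab => m.tab
  | .x i => m.x i
  | .y i => m.y i

variable (m : Mem n) (l : List Sym)

@[simp] theorem get_src (b : Bool) : m.get (.src b) = m.src b := rfl
@[simp] theorem get_ws : m.get .ws = m.ws := rfl
@[simp] theorem get_len : m.get .len = m.len := rfl
@[simp] theorem get_lens : m.get .lens = m.lens := rfl
@[simp] theorem get_z : m.get .z = m.z := rfl
@[simp] theorem get_res : m.get .res = m.res := rfl
@[simp] theorem get_tab : m.get .tab = m.tab := rfl
@[simp] theorem get_x (i : Fin n) : m.get (.x i) = m.x i := rfl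
@[simp] theorem get_y (i : Fin n) : m.get (.y i) = m.y i := rfl

@[simp] theorem update_src (b : Bool) :
    update m.get (.src b) l = get { m with src := update m.src b l } := by
  funext k; cases k <;> simp [update_apply]

@[simp] theorem update_ws : update m.get .ws l = get { m with ws := l } := by
  funext k; cases k <;> simp

@[simp] theorem update_len : update m.get .len l = get { m with len := l } := by
  funext k; cases k <;> simp

@[simp] theorem update_lens : update m.get .lens l = get { m with lens := l } := by
  funext k; cases k <;> simp

@[simp] theorem update_z : update m.get .z l = get { m with z := l } := by
  funext k; cases k <;> simp

@[simp] theorem update_res : update m.get .res l = get { m with res := l } := by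
  funext k; cases k <;> simp

@[simp] theorem update_tab : update m.get .tab l = get { m with tab := l } := by
  funext k; cases k <;> simp

@[simp] theorem update_x (i : Fin n) :
    update m.get (.x i) l = get { m with x := update m.x i l } := by
  funext k; cases k <;> simp [update_apply]

@[simp] theorem update_y (i : Fin n) :
    update m.get (.y i) l = get { m with y := update m.y i l } := by
  funext k; cases k <;> simp [update_apply]

end Mem

/-! ### Executions with bounded time -/

/-- `p` transforms the stacks `S` into `S'` in at most `T` steps. -/
def Exec {K : Type} [DecidableEq K] (p : Prog K Sym) (S S' : K → List Sym) (T : ℕ) : Prop :=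
  ∃ t ≤ T, Prog.Runs p S S' t

namespace Exec

open Prog

variable {K : Type} [DecidableEq K] {p q : Prog K Sym} {S S' S'' : K → List Sym} {T T' : ℕ}

theorem mono (h : Exec p S S' T) (hT : T ≤ T') : Exec p S S' T' := by
  obtain ⟨t, ht, hr⟩ := h
  exact ⟨t, ht.trans hT, hr⟩

theorem push {k : K} {a : Sym} (h : update S k (a :: S k) = S') : Exec (push k a) S S' 1 :=
  ⟨1, le_rfl, h ▸ Runs.push k a S⟩

theorem pop {k : K} (h : update S k (S k).tail = S') : Exec (pop k) S S' 1 :=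
  ⟨1, le_rfl, h ▸ Runs.pop k S⟩

theorem move {k k' : K} (hk : k' ≠ k)
    (h : update (update S k (S k).tail) k' ((S k).head?.toList ++ S k') = S') :
    Exec (move k k') S S' 1 := by
  subst h
  cases hS : S k with
  | nil =>
    have e : update (update S k ([] : List Sym).tail) k' (([] : List Sym).head?.toList ++ S k') =
        S := by
      have e' : update S k [] = S := (congrArg _ hS.symm).trans (update_eq_self k S)
      simp [e']
    rw [e]
    exact ⟨1, le_rfl, Runs.move_nil k k' S hS⟩
  | cons a l => exact ⟨1, le_rfl, Runs.move_cons k k' S a l hS hk⟩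

theorem seq (h : Exec p S S' T) (h' : Exec q S' S'' T') : Exec (seq p q) S S'' (T + T') := by
  obtain ⟨t, ht, hr⟩ := h
  obtain ⟨t', ht', hr'⟩ := h'
  exact ⟨t + t', add_le_add ht ht', hr.seq hr'⟩

theorem ite_true {k : K} {f : Option Sym → Bool} (hf : f (S k).head? = true)
    (h : Exec p S S' T) : Exec (ite k f p q) S S' (1 + T) := by
  obtain ⟨t, ht, hr⟩ := h
  exact ⟨1 + t, by omega, .ite_true hf hr⟩

theorem ite_false {k : K} {f : Option Sym → Bool} (hf : f (S k).head? = false)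
    (h : Exec q S S' T) : Exec (ite k f p q) S S' (1 + T) := by
  obtain ⟨t, ht, hr⟩ := h
  exact ⟨1 + t, by omega, .ite_false hf hr⟩

theorem loop_true {k : K} {f : Option Sym → Bool} (hf : f (S k).head? = true)
    (h : Exec p S S' T) (h' : Exec (loop k f p) S' S'' T') :
    Exec (loop k f p) S S'' (1 + (T + T')) := by
  obtain ⟨t, ht, hr⟩ := h
  obtain ⟨t', ht', hr'⟩ := h'
  exact ⟨1 + (t + t'), by omega, .loop_true hf hr hr'⟩

theorem loop_false {k : K} {f : Option Sym → Bool} (hf : f (S k).head? = false) :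
    Exec (loop k f p) S S 1 := ⟨1, le_rfl, .loop_false hf⟩

end Exec

namespace Prog

variable {K : Type} [DecidableEq K]

/-- Repeat `p` until the stack `k` is empty. -/
def drain (k : K) (p : Prog K Sym) : Prog K Sym := loop k Option.isSome p

/-- Move everything from the stack `k` to the stack `k'`, in reverse order. -/
def moveAll (k k' : K) : Prog K Sym := drain k (move k k')

theorem exec_moveAll {k k' : K} (hk : k' ≠ k) (l : List Sym) : ∀ S : K → List Sym, S k = l →
    Exec (moveAll k k') S (update (update S k []) k' (l.reverse ++ S k')) (2 * l.length + 1) := by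
  induction l with
  | nil =>
    intro S hS
    have e : update (update S k []) k' (([] : List Sym).reverse ++ S k') = S := by
      have e' : update S k [] = S := (congrArg _ hS.symm).trans (update_eq_self k S)
      simp [e']
    rw [e]
    exact Exec.loop_false (by simp [hS])
  | cons a l ih =>
    intro S hS
    have h := Exec.loop_true (k := k) (f := Option.isSome) (S := S) (by simp [hS])
      (Exec.move hk rfl) (ih _ (by simp [hS, Ne.symm hk]))
    refine Exec.mono (T := 1 + (1 + (2 * l.length + 1))) ?_ (by simp; omega)
    change Exec (moveAll k k') _ _ _ at h
    convert h using 1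
    funext j
    by_cases h1 : j = k'
    · subst h1; simp [hS]
    · by_cases h2 : j = k
      · subst h2; simp [h1]
      · simp [h1, h2]

/-- Empty the stack `k`. -/
def clear (k : K) : Prog K Sym := drain k (pop k)

theorem exec_clear {k : K} (l : List Sym) : ∀ S : K → List Sym, S k = l →
    Exec (clear k) S (update S k []) (2 * l.length + 1) := by
  induction l with
  | nil =>
    intro S hS
    have e : update S k [] = S := (congrArg _ hS.symm).trans (update_eq_self k S)
    rw [e]
    exact Exec.loop_false (by simp [hS])
  | cons a l ih =>
    intro S hS
    have h := Exec.loop_true (k := k) (f := Option.isSome) (S := S) (by simp [hS])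
      (Exec.pop rfl) (ih _ (by simp [hS]))
    rw [update_idem] at h
    exact h.mono (by simp; omega)

/-- Run `p` once for every symbol on the stack `k`; the stack `z` keeps the symbols in the
meantime. -/
def forEach (k z : K) (p : Prog K Sym) : Prog K Sym :=
  seq (drain k (seq (move k z) p)) (moveAll z k)

/-- If the `i`-th round of the loop body leads from `s i` to `s (i + 1)`, whatever the two stacks
used for counting hold, then the loop leads from `s 0` to `s N`. -/
theorem exec_forEach {k z : K} (hkz : z ≠ k) {p : Prog K Sym} {N T : ℕ} (s : ℕ → K → List Sym)
    (hp : ∀ i < N, ∀ a b, Exec p (update (update (s i) k a) z b)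
      (update (update (s (i + 1)) k a) z b) T) :
    Exec (forEach k z p) (update (update (s 0) k (List.replicate N .tally)) z [])
      (update (update (s N) k (List.replicate N .tally)) z []) (N * (T + 4) + 2) := by
  have h1 : ∀ d i, i + d = N → Exec (drain k (seq (move k z) p))
      (update (update (s i) k (List.replicate d .tally)) z (List.replicate i .tally))
      (update (update (s N) k []) z (List.replicate N .tally)) (d * (T + 2) + 1) := by
    intro d
    induction d with
    | zero =>
      intro i hi
      obtain rfl : i = N := by omega
      exact (Exec.loop_false (by simp [Ne.symm hkz])).mono (by omega)
    | succ d ih =>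
      intro i hi
      have h := Exec.loop_true (k := k) (f := Option.isSome)
        (S := update (update (s i) k (List.replicate (d + 1) .tally)) z (List.replicate i .tally))
        (by simp [Ne.symm hkz, List.replicate_succ])
        (Exec.seq (Exec.move (S' := update (update (s i) k (List.replicate d .tally)) z
          (List.replicate (i + 1) .tally)) hkz ?_) (hp i (by omega) _ _)) (ih (i + 1) (by omega))
      · exact h.mono (by rw [add_mul]; omega)
      · funext j
        by_cases h1 : j = z
        · subst h1; simp [Ne.symm hkz, List.replicate_succ]
        · by_cases h2 : j = k
          · subst h2; simp [h1, List.replicate_succ]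
          · simp [h1, h2]
  refine Exec.mono ((h1 N 0 (by omega)).seq ?_) (T := N * (T + 2) + 1 + (2 * N + 1))
    (by rw [mul_add, mul_add]; omega)
  have h2 := exec_moveAll (Ne.symm hkz) (List.replicate N Sym.tally)
    (update (update (s N) k []) z (List.replicate N .tally)) (by simp)
  rw [List.length_replicate] at h2
  convert h2 using 1
  funext j
  by_cases h1 : j = z
  · subst h1; simp [Ne.symm hkz, hkz]
  · by_cases h2 : j = k
    · subst h2; simp [Ne.symm hkz]
    · simp [h1, h2]

end Prog

/-! ### Reading a word at a computed position -/

/-- The rest of a word after its first separator. -/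
def dropSep (l : List Sym) : List Sym := (l.dropWhile (· ≠ .sep)).tail

/-- The position behind the next separator. -/
def nextSep (l : List Sym) (j : ℕ) : ℕ := j + ((l.drop j).takeWhile (· ≠ .sep)).length + 1

theorem drop_length_takeWhile {α : Type*} (f : α → Bool) (l : List α) :
    l.drop (l.takeWhile f).length = l.dropWhile f := by
  induction l with
  | nil => rfl
  | cons a l ih => by_cases h : f a <;> simp [h, ih]

theorem drop_nextSep (l : List Sym) (j : ℕ) : l.drop (nextSep l j) = dropSep (l.drop j) := by
  unfold nextSep dropSep
  rw [← List.tail_drop, ← List.drop_drop, drop_length_takeWhile]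

namespace Mem

variable {n : ℕ}

/-- The memory `m`, with the first `j` symbols of `l` already read from `src b`. -/
def readAt (m : Mem n) (b : Bool) (l : List Sym) (j : ℕ) : Mem n :=
  { m with src := update m.src b (l.drop j), ws := (l.take j).reverse }

end Mem

namespace Prog

variable {n : ℕ}

/-- The case of `exec_forEach` in which the descriptions `s i` of the stacks include the counter. -/
theorem exec_forEach' {K : Type} [DecidableEq K] {k z : K} (hkz : z ≠ k) {p : Prog K Sym}
    {N T : ℕ} (s : ℕ → K → List Sym) (hk : ∀ i, s i k = List.replicate N .tally)
    (hz : ∀ i, s i z = [])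
    (hp : ∀ i < N, ∀ a b, Exec p (update (update (s i) k a) z b)
      (update (update (s (i + 1)) k a) z b) T) :
    Exec (forEach k z p) (s 0) (s N) (N * (T + 4) + 2) := by
  have h := exec_forEach hkz s hp
  have e : ∀ i, update (update (s i) k (List.replicate N .tally)) z [] = s i := by
    intro i
    funext j
    by_cases h1 : j = z
    · subst h1; simp [hz]
    · by_cases h2 : j = k
      · subst h2; simp [h1, hk]
      · simp [h1, h2]
  rwa [e, e] at h

/-- Read one symbol from `src b`. -/
def step (b : Bool) : Prog (Reg n) Sym := move (.src b) .ws

theorem exec_step (b : Bool) (l : List Sym) (m : Mem n) (j : ℕ) :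
    Exec (step b) (m.readAt b l j).get (m.readAt b l (j + 1)).get 1 := by
  refine Exec.move (by simp) ?_
  cases h : l[j]? <;> simp [Mem.readAt, List.take_add_one, h]

/-- Read a word up to and including the next separator. -/
def skipSep (b : Bool) : Prog (Reg n) Sym :=
  seq (loop (.src b) (fun o => decide (o ≠ none ∧ o ≠ some .sep)) (step b)) (step b)

theorem exec_skipSep (b : Bool) (l : List Sym) (m : Mem n) (j : ℕ) :
    Exec (skipSep b) (m.readAt b l j).get (m.readAt b l (nextSep l j)).get
      (2 * l.length + 2) := by
  have h1 : ∀ (a : List Sym) (j : ℕ), l.drop j = a →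
      Exec (loop (.src b) (fun o => decide (o ≠ none ∧ o ≠ some .sep)) (step b))
        (m.readAt b l j).get (m.readAt b l (j + (a.takeWhile (· ≠ .sep)).length)).get
        (2 * a.length + 1) := by
    intro a
    induction a with
    | nil =>
      intro j hj
      exact Exec.loop_false (by simp [Mem.readAt, hj])
    | cons c a ih =>
      intro j hj
      by_cases hc : c = .sep
      · have h := Exec.loop_false (p := step b) (k := Reg.src b)
          (f := fun o => decide (o ≠ none ∧ o ≠ some .sep)) (S := (m.readAt b l j).get)
          (by simp [Mem.readAt, hj, hc])
        simpa [hc] using h.mono (T' := 2 * (c :: a).length + 1) (by omega)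
      · have h := Exec.loop_true (k := Reg.src b)
          (f := fun o => decide (o ≠ none ∧ o ≠ some .sep)) (S := (m.readAt b l j).get)
          (by simp [Mem.readAt, hj, hc]) (exec_step b l m j)
          (ih (j + 1) (by rw [← List.tail_drop, hj]; rfl))
        have e : ((c :: a).takeWhile (· ≠ Sym.sep)).length =
            (a.takeWhile (· ≠ Sym.sep)).length + 1 := by simp [hc]
        rw [e]
        rw [show j + ((a.takeWhile (· ≠ Sym.sep)).length + 1) =
          j + 1 + (a.takeWhile (· ≠ Sym.sep)).length by ring]
        exact h.mono (by simp; omega)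
  refine ((h1 _ j rfl).seq (exec_step b l m _)).mono ?_
  rw [List.length_drop]
  omega

theorem exec_lenSteps (b : Bool) (l : List Sym) (m : Mem n) {L : ℕ}
    (hlen : m.len = List.replicate L .tally) (hlens : m.lens = []) (j : ℕ) :
    Exec (forEach .len .lens (step b)) (m.readAt b l j).get (m.readAt b l (j + L)).get
      (L * 5 + 2) := by
  refine exec_forEach' (T := 1) (by simp) (fun c => (m.readAt b l (j + c)).get) (fun _ => hlen)
    (fun _ => hlens) fun i _ a c => ?_
  simpa [Mem.readAt, add_assoc] using exec_step b l { m with len := a, lens := c } (j + i)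

/-- `p` moves the reading position in `l` from `j` to `g j`, in time `T`. -/
def Adv (p : Prog (Reg n) Sym) (b : Bool) (l : List Sym) (L : ℕ) (g : ℕ → ℕ) (T : ℕ) : Prop :=
  ∀ m : Mem n, m.len = List.replicate L .tally → m.lens = [] → ∀ j,
    Exec p (m.readAt b l j).get (m.readAt b l (g j)).get T

theorem Adv.forEach_x {p : Prog (Reg n) Sym} {b : Bool} {l : List Sym} {L : ℕ} {g : ℕ → ℕ}
    {T : ℕ} (h : Adv p b l L g T) (m : Mem n) (hlen : m.len = List.replicate L .tally)
    (hlens : m.lens = []) (hz : m.z = []) {i : Fin n} {N : ℕ}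
    (hx : m.x i = List.replicate N .tally) (j : ℕ) :
    Exec (forEach (.x i) .z p) (m.readAt b l j).get (m.readAt b l (g^[N] j)).get
      (N * (T + 4) + 2) := by
  refine exec_forEach' (by simp) (fun c => (m.readAt b l (g^[c] j)).get) (fun _ => hx)
    (fun _ => hz) fun c _ a d => ?_
  have := h { m with x := update m.x i a, z := d } hlen hlens (g^[c] j)
  rw [← iterate_succ_apply' g] at this
  simpa [Mem.readAt] using this

theorem Adv.forEach_y {p : Prog (Reg n) Sym} {b : Bool} {l : List Sym} {L : ℕ} {g : ℕ → ℕ}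
    {T : ℕ} (h : Adv p b l L g T) (m : Mem n) (hlen : m.len = List.replicate L .tally)
    (hlens : m.lens = []) (hz : m.z = []) {i : Fin n} {N : ℕ}
    (hy : m.y i = List.replicate N .tally) (j : ℕ) :
    Exec (forEach (.y i) .z p) (m.readAt b l j).get (m.readAt b l (g^[N] j)).get
      (N * (T + 4) + 2) := by
  refine exec_forEach' (by simp) (fun c => (m.readAt b l (g^[c] j)).get) (fun _ => hy)
    (fun _ => hz) fun c _ a d => ?_
  have := h { m with y := update m.y i a, z := d } hlen hlens (g^[c] j)
  rw [← iterate_succ_apply' g] at this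
  simpa [Mem.readAt] using this

end Prog

/-- The elementary moves of the reading position, in terms of variables with values below the
length `L` of the input. -/
inductive Move (d : ℕ) where
  /-- skip one symbol -/
  | one : Move d
  /-- skip as many symbols as the value of a variable -/
  | var (i : Fin d) : Move d
  /-- skip `L - i` symbols -/
  | cvar (i : Fin d) : Move d
  /-- skip `i * L` symbols -/
  | varLen (i : Fin d) : Move d
  /-- skip up to and including the next separator -/
  | sep : Move d
  /-- skip as many separators as the value of a variable -/
  | varSep (i : Fin d) : Move d

namespace Move

open Prog

variable {d n : ℕ}

/-- The effect of a move on a reading position. -/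
def pos (l : List Sym) (L : ℕ) (e : Fin d → ℕ) : Move d → ℕ → ℕ
  | one, j => j + 1
  | var i, j => j + e i
  | cvar i, j => j + (L - e i)
  | varLen i, j => j + e i * L
  | sep, j => nextSep l j
  | varSep i, j => (nextSep l)^[e i] j

/-- The effect of a move on the part of a word that is still to be read. -/
def rest (L : ℕ) (e : Fin d → ℕ) : Move d → List Sym → List Sym
  | one, l => l.drop 1
  | var i, l => l.drop (e i)
  | cvar i, l => l.drop (L - e i)
  | varLen i, l => l.drop (e i * L)
  | sep, l => dropSep l
  | varSep i, l => dropSep^[e i] l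

theorem drop_pos (l : List Sym) (L : ℕ) (e : Fin d → ℕ) (mv : Move d) (j : ℕ) :
    l.drop (mv.pos l L e j) = mv.rest L e (l.drop j) := by
  cases mv with
  | one => simp [pos, rest]
  | var i => simp [pos, rest]
  | cvar i => simp [pos, rest]
  | varLen i => simp [pos, rest]
  | sep => exact drop_nextSep l j
  | varSep i =>
    simp only [pos, rest]
    generalize e i = c
    induction c with
    | zero => rfl
    | succ c ih => rw [iterate_succ_apply', iterate_succ_apply', drop_nextSep, ih]

/-- The program that carries out a move in `src b`. -/
def prog (b : Bool) (hd : d ≤ n) : Move d → Prog (Reg n) Sym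
  | one => step b
  | var i => forEach (.x (i.castLE hd)) .z (step b)
  | cvar i => forEach (.y (i.castLE hd)) .z (step b)
  | varLen i => forEach (.x (i.castLE hd)) .z (forEach .len .lens (step b))
  | sep => skipSep b
  | varSep i => forEach (.x (i.castLE hd)) .z (skipSep b)

/-- A time bound for a move. -/
noncomputable def time : Polynomial ℕ :=
  (Polynomial.X + 1) * (2 * (Polynomial.X * Polynomial.X + Polynomial.X) +
    5 * Polynomial.X + 8)

theorem exec_prog (b : Bool) (hd : d ≤ n) (l : List Sym) {L : ℕ} (hl : l.length ≤ L * L + L)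
    (m : Mem n) (hlen : m.len = List.replicate L .tally) (hlens : m.lens = []) (hz : m.z = [])
    (e : Fin d → ℕ) (he : ∀ i, e i ≤ L)
    (hx : ∀ i : Fin d, m.x (i.castLE hd) = List.replicate (e i) .tally)
    (hy : ∀ i : Fin d, m.y (i.castLE hd) = List.replicate (L - e i) .tally)
    (mv : Move d) (j : ℕ) :
    Exec (mv.prog b hd) (m.readAt b l j).get (m.readAt b l (mv.pos l L e j)).get
      (time.eval L) := by
  have ht : time.eval L = (L + 1) * (2 * (L * L + L) + 5 * L + 8) := by simp [time]
  have hstep : Adv (step b : Prog (Reg n) Sym) b l L (· + 1) 1 := fun m _ _ j => exec_step b l m j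
  have hadd : ∀ c j, (· + 1)^[c] j = j + c := fun c j => by
    induction c with
    | zero => rfl
    | succ c ih => rw [iterate_succ_apply', ih]; rfl
  have hb : ∀ (N T : ℕ), N ≤ L → T + 6 ≤ 2 * (L * L + L) + 5 * L + 8 →
      N * (T + 4) + 2 ≤ (L + 1) * (2 * (L * L + L) + 5 * L + 8) := by
    intro N T hN hT
    calc N * (T + 4) + 2 ≤ L * (2 * (L * L + L) + 5 * L + 8) +
          (2 * (L * L + L) + 5 * L + 8) := by
          refine Nat.add_le_add (Nat.mul_le_mul hN (by omega)) (by omega)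
      _ = _ := by ring
  have hb' : 2 * (L * L + L) + 5 * L + 8 ≤ (L + 1) * (2 * (L * L + L) + 5 * L + 8) :=
    Nat.le_mul_of_pos_left _ (Nat.succ_pos L)
  rw [ht]
  cases mv with
  | one => exact (exec_step b l m j).mono (by omega)
  | var i =>
    have := hstep.forEach_x m hlen hlens hz (hx i) j
    rw [hadd] at this
    exact this.mono (hb _ _ (he i) (by omega))
  | cvar i =>
    have := hstep.forEach_y m hlen hlens hz (hy i) j
    rw [hadd] at this
    exact this.mono (hb _ _ (Nat.sub_le _ _) (by omega))
  | varLen i =>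
    have hL : Adv (forEach .len .lens (step b) : Prog (Reg n) Sym) b l L (· + L) (L * 5 + 2) :=
      fun m h1 h2 j => exec_lenSteps b l m h1 h2 j
    have := hL.forEach_x m hlen hlens hz (hx i) j
    have hadd' : ∀ c j, (· + L)^[c] j = j + c * L := fun c j => by
      induction c with
      | zero => simp
      | succ c ih => rw [iterate_succ_apply', ih, add_mul]; ring
    rw [hadd'] at this
    exact this.mono (hb _ _ (he i) (by omega))
  | sep => exact (exec_skipSep b l m j).mono (by omega)
  | varSep i =>
    have hS : Adv (skipSep b : Prog (Reg n) Sym) b l L (nextSep l) (2 * l.length + 2) :=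
      fun m _ _ j => exec_skipSep b l m j
    exact (hS.forEach_x m hlen hlens hz (hx i) j).mono (hb _ _ (he i) (by omega))

/-- The part of a word that is still to be read after several moves. -/
def restAll (L : ℕ) (e : Fin d → ℕ) (mvs : List (Move d)) (l : List Sym) : List Sym :=
  mvs.foldl (fun l mv => mv.rest L e l) l

/-- Move the reading position several times, and push a truth value that depends on the symbol
found there. -/
def progAll (b : Bool) (hd : d ≤ n) (f : Option Sym → Bool) :
    List (Move d) → Prog (Reg n) Sym
  | [] => seq (ite (.src b) f (push .res (.bit true)) (push .res (.bit false)))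
      (moveAll .ws (.src b))
  | mv :: mvs => seq (mv.prog b hd) (progAll b hd f mvs)

/-- A time bound for several moves and the final test. -/
noncomputable def timeAll : List (Move d) → Polynomial ℕ
  | [] => 2 * (Polynomial.X * Polynomial.X + Polynomial.X) + 3
  | _ :: mvs => time + timeAll mvs

theorem exec_progAll (b : Bool) (hd : d ≤ n) (f : Option Sym → Bool) (l : List Sym) {L : ℕ}
    (hl : l.length ≤ L * L + L)
    (m : Mem n) (hlen : m.len = List.replicate L .tally) (hlens : m.lens = []) (hz : m.z = [])
    (e : Fin d → ℕ) (he : ∀ i, e i ≤ L)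
    (hx : ∀ i : Fin d, m.x (i.castLE hd) = List.replicate (e i) .tally)
    (hy : ∀ i : Fin d, m.y (i.castLE hd) = List.replicate (L - e i) .tally)
    (mvs : List (Move d)) (j : ℕ) :
    Exec (progAll b hd f mvs) (m.readAt b l j).get
      ({ m with res := .bit (f (restAll L e mvs (l.drop j)).head?) :: m.res }.readAt b l 0).get
      ((timeAll mvs).eval L) := by
  induction mvs generalizing j with
  | nil =>
    have h1 : Exec (ite (.src b) f (push .res (.bit true)) (push .res (.bit false)))
        (m.readAt b l j).get
        ({ m with res := .bit (f (l.drop j).head?) :: m.res }.readAt b l j).get 2 := by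
      cases hf : f (l.drop j).head? with
      | true =>
        refine Exec.ite_true ?_ (Exec.push (by simp [Mem.readAt]))
        simpa [Mem.readAt] using hf
      | false =>
        refine Exec.ite_false ?_ (Exec.push (by simp [Mem.readAt]))
        simpa [Mem.readAt] using hf
    have h2 := exec_moveAll (k := Reg.ws) (k' := Reg.src b) (by simp) (l.take j).reverse
      ({ m with res := .bit (f (l.drop j).head?) :: m.res }.readAt b l j).get rfl
    have h := (h1.seq (h2.mono (T' := 2 * l.length + 1) (by simp))).mono
      (T' := (timeAll ([] : List (Move d))).eval L) (by simp [timeAll]; omega)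
    simpa [Mem.readAt, restAll, progAll] using h
  | cons mv mvs ih =>
    have h1 := exec_prog b hd l hl m hlen hlens hz e he hx hy mv j
    have h2 := ih (mv.pos l L e j)
    rw [drop_pos] at h2
    refine (h1.seq h2).mono ?_
    simp [timeAll]

end Move

/-! ### Predicates evaluated by the machine -/

/-- What changes during a computation: the current table, the table under construction, and the
stack of truth values. -/
structure Dat where
  r : List Sym
  tab : List Sym
  res : List Sym

/-- The memory for the input `w` and the values `E` of the variables. -/
def mem (n : ℕ) (w : List Sym) (s : Dat) (E : ℕ → ℕ) : Mem n where
  src := fun b => cond b w s.r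
  ws := []
  len := List.replicate w.length .tally
  lens := []
  z := []
  res := s.res
  tab := s.tab
  x := fun i => List.replicate (E i) .tally
  y := fun i => List.replicate (w.length - E i) .tally

/-- The structure in which formulas are evaluated: the input `w`, and a table `r`. -/
structure Inp where
  w : List Sym
  r : List Sym

/-- The length of the input, which is the range of all variables. -/
abbrev Inp.L (I : Inp) : ℕ := I.w.length

/-- The table has at most as many entries as there are pairs of values of variables. -/
def Inp.Small (I : Inp) : Prop := I.r.length ≤ I.L * I.L

/-- The values of the variables: those below `d` are in range, the others are still `0`. -/
def ValidEnv (L d : ℕ) (E : ℕ → ℕ) : Prop := (∀ i, E i < L) ∧ ∀ i, d ≤ i → E i = 0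

theorem ValidEnv.update {L d : ℕ} {E : ℕ → ℕ} (h : ValidEnv L d E) {v : ℕ} (hv : v < L) :
    ValidEnv L (d + 1) (update E d v) := by
  refine ⟨fun i => ?_, fun i hi => ?_⟩
  · by_cases hi : i = d
    · subst hi; simpa using hv
    · simpa [hi] using h.1 i
  · have : i ≠ d := by omega
    simpa [this] using h.2 i (by omega)

/-- The predicate `f` on structures with `d` variables is evaluated in polynomial time by a
program, which pushes the truth value. The number of variables of the machine is arbitrary, but
large enough. -/
def Ev (d : ℕ) (f : Inp → (Fin d → ℕ) → Prop) : Prop :=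
  ∃ N, ∀ n ≥ N, ∃ (p : Prog (Reg n) Sym) (T : Polynomial ℕ), ∀ (w : List Sym) (s : Dat)
    (E : ℕ → ℕ), ValidEnv w.length d E → (Inp.mk w s.r).Small →
      ∃ b : Bool, (b = true ↔ f ⟨w, s.r⟩ fun i => E i) ∧
        Exec p (mem n w s E).get (mem n w { s with res := .bit b :: s.res } E).get
          (T.eval w.length)

namespace Ev

open Prog

variable {d : ℕ} {f g : Inp → (Fin d → ℕ) → Prop}

/-- Equivalence is only needed for values in range. -/
theorem congr (h : Ev d f)
    (hfg : ∀ I e, I.Small → (∀ i, e i < I.L) → (f I e ↔ g I e)) : Ev d g := by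
  obtain ⟨N, h⟩ := h
  refine ⟨N, fun n hn => ?_⟩
  obtain ⟨p, T, h⟩ := h n hn
  refine ⟨p, T, fun w s E hE hs => ?_⟩
  obtain ⟨b, hb, hx⟩ := h w s E hE hs
  exact ⟨b, hb.trans (hfg _ _ hs fun i => hE.1 i), hx⟩

/-- The basic predicates test the symbol at a computed position. -/
theorem atom (b : Bool) (mvs : List (Move d)) (t : Option Sym → Bool) :
    Ev d fun I e => t (Move.restAll I.L e mvs (cond b I.w I.r)).head? = true := by
  refine ⟨d, fun n hn => ⟨Move.progAll b hn t mvs, Move.timeAll mvs, fun w s E hE hs =>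
    ⟨_, Iff.rfl, ?_⟩⟩⟩
  have h := Move.exec_progAll b hn t (cond b w s.r) (L := w.length)
    (by
      cases b with
      | true => exact Nat.le_add_left _ _
      | false => exact Nat.le_trans hs (Nat.le_add_right _ _))
    (mem n w s E) rfl rfl rfl (fun i => E i) (fun i => (hE.1 i).le) (fun _ => rfl) (fun _ => rfl)
    mvs 0
  have e : ∀ s, (mem n w s E).readAt b (cond b w s.r) 0 = mem n w s E := by
    intro s
    simp [Mem.readAt, mem]
  rw [e] at h
  have e' := e { s with res := .bit (t (Move.restAll w.length (fun i => E i) mvs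
    (cond b w s.r)).head?) :: s.res }
  rw [← e']
  exact h

theorem not (h : Ev d f) : Ev d fun I e => ¬ f I e := by
  obtain ⟨N, h⟩ := h
  refine ⟨N, fun n hn => ?_⟩
  obtain ⟨p, T, h⟩ := h n hn
  refine ⟨seq p (ite .res (fun o => decide (o = some (.bit true)))
    (seq (pop .res) (push .res (.bit false))) (seq (pop .res) (push .res (.bit true)))),
    T + 3, fun w s E hE hs => ?_⟩
  obtain ⟨b, hb, hx⟩ := h w s E hE hs
  refine ⟨!b, by cases b <;> simpa using hb, ?_⟩
  rw [Polynomial.eval_add, Polynomial.eval_ofNat]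
  refine hx.seq ?_
  cases b with
  | true =>
    refine Exec.ite_true (T := 1 + 1) (by simp [mem]) (.seq (.pop rfl) (.push ?_))
    simp [mem]
  | false =>
    refine Exec.ite_false (T := 1 + 1) (by simp [mem]) (.seq (.pop rfl) (.push ?_))
    simp [mem]

/-- Replace the two topmost truth values by their disjunction. -/
def orProg (n : ℕ) : Prog (Reg n) Sym :=
  ite .res (fun o => decide (o = some (.bit true)))
    (seq (pop .res) (seq (pop .res) (push .res (.bit true)))) (pop .res)

theorem exec_orProg (n : ℕ) (w : List Sym) (s : Dat) (E : ℕ → ℕ) (b c : Bool) :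
    Exec (orProg n) (mem n w { s with res := .bit b :: .bit c :: s.res } E).get
      (mem n w { s with res := .bit (b || c) :: s.res } E).get 4 := by
  cases b with
  | true =>
    refine (Exec.ite_true (T := 1 + (1 + 1)) (by simp [mem])
      (.seq (.pop rfl) (.seq (.pop rfl) (.push ?_)))).mono (by omega)
    simp [mem]
  | false =>
    refine (Exec.ite_false (T := 1) (by simp [mem]) (.pop ?_)).mono (by omega)
    simp [mem]

theorem or (h : Ev d f) (h' : Ev d g) : Ev d fun I e => f I e ∨ g I e := by
  obtain ⟨N, h⟩ := h
  obtain ⟨N', h'⟩ := h'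
  refine ⟨max N N', fun n hn => ?_⟩
  obtain ⟨p, T, h⟩ := h n (le_of_max_le_left hn)
  obtain ⟨p', T', h'⟩ := h' n (le_of_max_le_right hn)
  refine ⟨seq p (seq p' (orProg n)), T + (T' + 4), fun w s E hE hs => ?_⟩
  obtain ⟨b, hb, hx⟩ := h w s E hE hs
  obtain ⟨b', hb', hx'⟩ := h' w { s with res := .bit b :: s.res } E hE hs
  refine ⟨b' || b, by rw [Bool.or_eq_true, hb, hb', or_comm], ?_⟩
  rw [Polynomial.eval_add, Polynomial.eval_add, Polynomial.eval_ofNat]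
  exact hx.seq (hx'.seq (exec_orProg n w s E b' b))

theorem and (h : Ev d f) (h' : Ev d g) : Ev d fun I e => f I e ∧ g I e :=
  (h.not.or h'.not).not.congr fun I e _ _ => by tauto

theorem imp (h : Ev d f) (h' : Ev d g) : Ev d fun I e => f I e → g I e :=
  (h.not.or h').congr fun I e _ _ => by tauto

end Ev

namespace Prog

variable {n : ℕ}

/-- Run `p` for all values of a variable, which is increased by moving one symbol from its
complement to its value. -/
def forVar (i : Fin n) (p : Prog (Reg n) Sym) : Prog (Reg n) Sym :=
  seq (drain (.y i) (seq p (move (.y i) (.x i)))) (moveAll (.x i) (.y i))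

/-- A loop over all values of a variable, with an invariant `J` on the data that change. -/
theorem exec_forVar {d : ℕ} (hd : d < n) (p : Prog (Reg n) Sym) (w : List Sym) (E : ℕ → ℕ)
    (hE : E d = 0) (T : ℕ) (J : ℕ → Dat → Prop)
    (hp : ∀ v < w.length, ∀ s, J v s → ∃ s', J (v + 1) s' ∧
      Exec p (mem n w s (update E d v)).get (mem n w s' (update E d v)).get T)
    (s : Dat) (hs : J 0 s) :
    ∃ s', J w.length s' ∧
      Exec (forVar ⟨d, hd⟩ p) (mem n w s E).get (mem n w s' E).get (w.length * (T + 4) + 2) := by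
  have hstep : ∀ s v, v < w.length → Exec (move (.y ⟨d, hd⟩) (.x ⟨d, hd⟩))
      (mem n w s (update E d v)).get (mem n w s (update E d (v + 1))).get 1 := by
    intro s v hv
    refine Exec.move (by simp) ?_
    have e1 : update (mem n w s (update E d v)).x ⟨d, hd⟩ (List.replicate (v + 1) Sym.tally) =
        (mem n w s (update E d (v + 1))).x := by
      funext i
      by_cases h : i = ⟨d, hd⟩
      · subst h; simp [mem]
      · have : (i : ℕ) ≠ d := fun h' => h (Fin.ext h')
        simp [mem, h, this]
    have e2 : update (mem n w s (update E d v)).y ⟨d, hd⟩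
        (List.replicate (w.length - (v + 1)) Sym.tally) = (mem n w s (update E d (v + 1))).y := by
      funext i
      by_cases h : i = ⟨d, hd⟩
      · subst h; simp [mem]
      · have : (i : ℕ) ≠ d := fun h' => h (Fin.ext h')
        simp [mem, h, this]
    have h1 : w.length - v = w.length - (v + 1) + 1 := by omega
    have e3 : (mem n w s (update E d v)).y ⟨d, hd⟩ =
        .tally :: List.replicate (w.length - (v + 1)) Sym.tally := by
      simp [mem, h1, List.replicate_succ]
    have e4 : (mem n w s (update E d v)).x ⟨d, hd⟩ = List.replicate v Sym.tally := by simp [mem]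
    simp only [Mem.get_y, Mem.update_y, e3, List.tail_cons, e2, Mem.get_x, e4, List.head?_cons,
      Option.toList_some, List.singleton_append]
    rw [← List.replicate_succ, Mem.update_x, e1]
    rfl
  have hloop : ∀ k v s, v + k = w.length → J v s → ∃ s', J w.length s' ∧
      Exec (drain (.y ⟨d, hd⟩) (seq p (move (.y ⟨d, hd⟩) (.x ⟨d, hd⟩))))
        (mem n w s (update E d v)).get (mem n w s' (update E d w.length)).get
        (k * (T + 2) + 1) := by
    intro k
    induction k with
    | zero =>
      intro v s hv hJ
      obtain rfl : v = w.length := by omega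
      exact ⟨s, hJ, (Exec.loop_false (by simp [mem])).mono (by omega)⟩
    | succ k ih =>
      intro v s hv hJ
      obtain ⟨s', hJ', hx⟩ := hp v (by omega) s hJ
      obtain ⟨s'', hJ'', hx'⟩ := ih (v + 1) s' (by omega) hJ'
      refine ⟨s'', hJ'', (Exec.loop_true ?_ (hx.seq (hstep s' v (by omega))) hx').mono ?_⟩
      · have : w.length - v = k + 1 := by omega
        simp [mem, this, List.replicate_succ]
      · rw [add_mul]; omega
  obtain ⟨s', hJ', hx⟩ := hloop w.length 0 s (by omega) hs
  refine ⟨s', hJ', ?_⟩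
  have e0 : update E d 0 = E := by rw [← hE, update_eq_self]
  rw [e0] at hx
  have h2 := exec_moveAll (k := Reg.x (⟨d, hd⟩ : Fin n)) (k' := .y ⟨d, hd⟩) (by simp)
    (List.replicate w.length .tally) (mem n w s' (update E d w.length)).get (by simp [mem])
  have e5 : update (mem n w s' (update E d w.length)).x ⟨d, hd⟩ [] = (mem n w s' E).x := by
    funext i
    by_cases h : i = ⟨d, hd⟩
    · subst h; simp [mem, hE]
    · have : (i : ℕ) ≠ d := fun h' => h (Fin.ext h')
      simp [mem, h, this]
  have e6 : update (mem n w s' (update E d w.length)).y ⟨d, hd⟩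
      (List.replicate w.length .tally) = (mem n w s' E).y := by
    funext i
    by_cases h : i = ⟨d, hd⟩
    · subst h; simp [mem, hE]
    · have : (i : ℕ) ≠ d := fun h' => h (Fin.ext h')
      simp [mem, h, this]
  have e7 : (mem n w s' (update E d w.length)).y ⟨d, hd⟩ = [] := by simp [mem]
  simp only [Mem.get_y, Mem.update_x, Mem.update_y, List.reverse_replicate, e7, List.append_nil,
    e5, e6, List.length_replicate] at h2
  exact (hx.seq h2).mono (by rw [mul_add, mul_add]; omega)

end Prog

namespace Ev

open Prog

variable {d : ℕ}

/-- Bounded quantification is a loop that collects the disjunction of the truth values. -/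
theorem ex {f : Inp → (Fin d → ℕ) → ℕ → Prop}
    (h : Ev (d + 1) fun I e => f I (Fin.init e) (e (Fin.last d))) :
    Ev d fun I e => ∃ v, v < I.L ∧ f I e v := by
  obtain ⟨N, h⟩ := h
  refine ⟨max N (d + 1), fun n hn => ?_⟩
  have hd : d < n := le_of_max_le_right hn
  obtain ⟨p, T, h⟩ := h n (le_of_max_le_left hn)
  refine ⟨seq (push .res (.bit false)) (forVar ⟨d, hd⟩ (seq p (orProg n))),
    1 + (Polynomial.X * (T + 8) + 2), fun w s E hE hs => ?_⟩
  have hx := exec_forVar hd (seq p (orProg n)) w E (hE.2 d le_rfl) (T.eval w.length + 4)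
    (fun v s' => ∃ b : Bool, (b = true ↔ ∃ u, u < v ∧ f ⟨w, s.r⟩ (fun i => E i) u) ∧
      s' = { s with res := .bit b :: s.res }) ?_ { s with res := .bit false :: s.res }
    ⟨false, by simp, rfl⟩
  · obtain ⟨s', ⟨b, hb, rfl⟩, hx⟩ := hx
    refine ⟨b, hb, ?_⟩
    refine ((Exec.push ?_).seq hx).mono ?_
    · simp [mem]
    · simp [add_assoc]
  · rintro v hv s' ⟨b, hb, rfl⟩
    obtain ⟨c, hc, hx⟩ := h w { s with res := .bit b :: s.res } (update E d v) (hE.update hv) hs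
    refine ⟨_, ⟨c || b, ?_, rfl⟩, hx.seq (exec_orProg n w s _ c b)⟩
    have e1 : (Fin.init fun i : Fin (d + 1) => update E d v i) = fun i : Fin d => E i := by
      funext i
      have : (i : ℕ) ≠ d := by omega
      simp [Fin.init, this]
    have e2 : update E d v (Fin.last d : Fin (d + 1)) = v := by simp
    change c = true ↔ f ⟨w, s.r⟩ (Fin.init fun i : Fin (d + 1) => update E d v i)
      (update E d v (Fin.last d : Fin (d + 1))) at hc
    rw [e1, e2] at hc
    rw [Bool.or_eq_true, hb, hc]
    constructor
    · rintro (h | ⟨u, hu, h⟩)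
      · exact ⟨v, by omega, h⟩
      · exact ⟨u, by omega, h⟩
    · rintro ⟨u, hu, h⟩
      rcases Nat.lt_succ_iff_lt_or_eq.1 hu with h' | rfl
      · exact Or.inr ⟨u, h', h⟩
      · exact Or.inl h

theorem all {f : Inp → (Fin d → ℕ) → ℕ → Prop}
    (h : Ev (d + 1) fun I e => f I (Fin.init e) (e (Fin.last d))) :
    Ev d fun I e => ∀ v, v < I.L → f I e v :=
  (Ev.ex (f := fun I e v => ¬ f I e v) h.not).not.congr fun I e _ _ => by push Not; rfl

end Ev

/-! ### Iterated updates of the table -/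

open Classical in
/-- The table of a binary relation on numbers below `L`; the entry for `(x, y)` is at position
`x * L + y`. -/
noncomputable def tableOf (L : ℕ) (f : ℕ → ℕ → Prop) : List Sym :=
  (List.range (L * L)).map fun i => .bit (decide (f (i / L) (i % L)))

@[simp] theorem length_tableOf (L : ℕ) (f : ℕ → ℕ → Prop) :
    (tableOf L f).length = L * L := by simp [tableOf]

theorem getElem?_tableOf {L : ℕ} {f : ℕ → ℕ → Prop} {x y : ℕ} (hx : x < L) (hy : y < L) :
    (tableOf L f)[x * L + y]? = some (.bit true) ↔ f x y := by
  have h : x * L + y < L * L := by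
    calc x * L + y < x * L + L := by omega
      _ = (x + 1) * L := by ring
      _ ≤ L * L := Nat.mul_le_mul_right _ hx
  have h1 : (x * L + y) / L = x := by
    rw [mul_comm, Nat.mul_add_div (by omega), Nat.div_eq_of_lt hy, add_zero]
  have h2 : (x * L + y) % L = y := by
    rw [mul_comm, Nat.mul_add_mod, Nat.mod_eq_of_lt hy]
  simp [tableOf, h, h1, h2]

/-- The transformation `G` of tables is carried out in polynomial time by a program. -/
def Cmd (d : ℕ) (G : List Sym → List Sym → List Sym) : Prop :=
  ∃ N, ∀ n ≥ N, ∃ (p : Prog (Reg n) Sym) (T : Polynomial ℕ), ∀ (w r : List Sym)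
    (E : ℕ → ℕ), ValidEnv w.length d E → (Inp.mk w r).Small →
      Exec p (mem n w ⟨r, [], []⟩ E).get (mem n w ⟨G w r, [], []⟩ E).get (T.eval w.length)

namespace Cmd

open Prog

variable {d : ℕ}

/-- A table is computed entry by entry. It is built up in reverse order on the stack `tab`, while
the old table is still needed, and then replaces the old one. -/
theorem table {f : Inp → ℕ → ℕ → Prop}
    (h : Ev (d + 2) fun I e => f I (e (Fin.last d).castSucc) (e (Fin.last (d + 1)))) :
    Cmd d fun w r => tableOf w.length (f ⟨w, r⟩) := by
  classical
  obtain ⟨N, h⟩ := h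
  refine ⟨max N (d + 2), fun n hn => ?_⟩
  have hd1 : d + 1 < n := le_of_max_le_right hn
  have hd : d < n := by omega
  obtain ⟨p, T, h⟩ := h n (le_of_max_le_left hn)
  refine ⟨seq (forVar ⟨d, hd⟩ (forVar ⟨d + 1, hd1⟩ (seq p (move .res .tab))))
    (seq (clear (.src false)) (moveAll .tab (.src false))),
    Polynomial.X * ((Polynomial.X * (T + 1 + 4) + 2) + 4) + 2 +
      ((2 * (Polynomial.X * Polynomial.X) + 1) + (2 * (Polynomial.X * Polynomial.X) + 1)),
    fun w r E hE hs => ?_⟩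
  set L := w.length with hL
  set c : ℕ → Sym := fun i => .bit (decide (f ⟨w, r⟩ (i / L) (i % L))) with hc
  have hin : ∀ v < L, ∀ u < L, ∀ s : Dat, s = ⟨r, ((List.range (v * L + u)).map c).reverse, []⟩ →
      ∃ s' : Dat, s' = ⟨r, ((List.range (v * L + (u + 1))).map c).reverse, []⟩ ∧
        Exec (seq p (move .res .tab)) (mem n w s (update (update E d v) (d + 1) u)).get
          (mem n w s' (update (update E d v) (d + 1) u)).get (T.eval L + 1) := by
    rintro v hv u hu _ rfl
    obtain ⟨b, hb, hx⟩ := h w ⟨r, ((List.range (v * L + u)).map c).reverse, []⟩ _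
      ((hE.update hv).update hu) hs
    have e1 : update (update E d v) (d + 1) u ((Fin.last d).castSucc : Fin (d + 2)) = v := by
      simp
    have e2 : update (update E d v) (d + 1) u (Fin.last (d + 1) : Fin (d + 2)) = u := by
      simp
    change b = true ↔ f ⟨w, r⟩ (update (update E d v) (d + 1) u ((Fin.last d).castSucc))
      (update (update E d v) (d + 1) u (Fin.last (d + 1))) at hb
    rw [e1, e2] at hb
    have h1 : (v * L + u) / L = v := by
      rw [mul_comm, Nat.mul_add_div (by omega), Nat.div_eq_of_lt hu, add_zero]
    have h2 : (v * L + u) % L = u := by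
      rw [mul_comm, Nat.mul_add_mod, Nat.mod_eq_of_lt hu]
    have hcb : c (v * L + u) = .bit b := by
      rw [hc]
      simp only [h1, h2]
      congr 1
      by_cases hf : f ⟨w, r⟩ v u
      · simp [hf, hb.2 hf]
      · have : b ≠ true := fun h => hf (hb.1 h)
        simp [hf, this]
    refine ⟨_, rfl, hx.seq (Exec.move (by simp) ?_)⟩
    have e3 : ((List.range (v * L + (u + 1))).map c).reverse =
        .bit b :: ((List.range (v * L + u)).map c).reverse := by
      rw [← add_assoc, List.range_succ]
      simp [hcb]
    rw [e3]
    simp [mem]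
  obtain ⟨s', rfl, hx⟩ := exec_forVar hd (forVar ⟨d + 1, hd1⟩ (seq p (move .res .tab))) w E
    (hE.2 d le_rfl) (L * (T.eval L + 1 + 4) + 2)
    (fun v s => s = ⟨r, ((List.range (v * L)).map c).reverse, []⟩) (by
      rintro v hv _ rfl
      obtain ⟨s', hs', hx⟩ := exec_forVar hd1 (seq p (move .res .tab)) w (update E d v)
        (by simpa using hE.2 (d + 1) (by omega)) (T.eval L + 1)
        (fun u s => s = ⟨r, ((List.range (v * L + u)).map c).reverse, []⟩) (hin v hv) _ rfl
      refine ⟨s', ?_, hx⟩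
      rw [hs', add_mul, one_mul]) ⟨r, [], []⟩ (by simp)
  have hx2 := exec_clear (k := Reg.src (n := n) false) r
    (mem n w ⟨r, ((List.range (L * L)).map c).reverse, []⟩ E).get rfl
  rw [Mem.update_src] at hx2
  have e5 : ({ mem n w ⟨r, ((List.range (L * L)).map c).reverse, []⟩ E with
      src := update (mem n w ⟨r, ((List.range (L * L)).map c).reverse, []⟩ E).src false [] } :
        Mem n) = mem n w ⟨[], ((List.range (L * L)).map c).reverse, []⟩ E := by
    have : update (fun b => cond b w r) false [] = fun b => cond b w [] := by
      funext b; cases b <;> simp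
    simp [mem, this]
  rw [e5] at hx2
  have hx3 := exec_moveAll (k := Reg.tab (n := n)) (k' := .src false) (by simp)
    ((List.range (L * L)).map c).reverse
    (mem n w ⟨[], ((List.range (L * L)).map c).reverse, []⟩ E).get rfl
  rw [Mem.update_tab, Mem.update_src] at hx3
  have e6 : ({ mem n w ⟨[], ((List.range (L * L)).map c).reverse, []⟩ E with
      tab := []
      src := update (mem n w ⟨[], ((List.range (L * L)).map c).reverse, []⟩ E).src false
        (((List.range (L * L)).map c).reverse.reverse ++ []) } :
        Mem n) = mem n w ⟨tableOf L (f ⟨w, r⟩), [], []⟩ E := by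
    have : update (fun b => cond b w []) false ((List.range (L * L)).map c) =
        fun b => cond b w (tableOf L (f ⟨w, r⟩)) := by
      funext b; cases b <;> simp [tableOf, hc]
    simp [mem, this]
  have hx3' : Exec (moveAll .tab (.src false))
      (mem n w ⟨[], ((List.range (L * L)).map c).reverse, []⟩ E).get
      (mem n w ⟨tableOf L (f ⟨w, r⟩), [], []⟩ E).get
      (2 * ((List.range (L * L)).map c).reverse.length + 1) := e6 ▸ hx3
  have hr : r.length ≤ L * L := hs
  refine (hx.seq (hx2.seq hx3')).mono ?_
  simp [← hL]
  omega

/-- Iterating a transformation as often as the length of the word. -/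
theorem loop {G : List Sym → List Sym → List Sym} (h : Cmd (d + 1) G)
    (hG : ∀ w r, (Inp.mk w r).Small → (Inp.mk w (G w r)).Small) :
    Cmd d fun w => (G w)^[w.length] := by
  obtain ⟨N, h⟩ := h
  refine ⟨max N (d + 1), fun n hn => ?_⟩
  have hd : d < n := le_of_max_le_right hn
  obtain ⟨p, T, h⟩ := h n (le_of_max_le_left hn)
  refine ⟨forVar ⟨d, hd⟩ p, Polynomial.X * (T + 4) + 2, fun w r E hE hs => ?_⟩
  obtain ⟨s', ⟨rfl, -⟩, hx⟩ := exec_forVar hd p w E (hE.2 d le_rfl) (T.eval w.length)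
    (fun v s => s = ⟨(G w)^[v] r, [], []⟩ ∧ (Inp.mk w ((G w)^[v] r)).Small) (by
      rintro v hv _ ⟨rfl, hr⟩
      rw [iterate_succ_apply']
      exact ⟨_, ⟨rfl, hG w _ hr⟩, h w _ _ (hE.update hv) hr⟩) ⟨r, [], []⟩ ⟨rfl, hs⟩
  simpa using hx

end Cmd

/-! ### The machine for an iterated update -/

namespace Prog

variable {n : ℕ}

/-- Run `p i` for all variables `i` in a list. -/
def forAll (p : Fin n → Prog (Reg n) Sym) : List (Fin n) → Prog (Reg n) Sym
  | [] => loop .z (fun _ => false) (pop .z)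
  | i :: l => seq (p i) (forAll p l)

theorem exec_forAll (p : Fin n → Prog (Reg n) Sym) (g : List Sym → List Sym) (T : ℕ)
    (l : List (Fin n)) (hl : l.Nodup) (m : Mem n)
    (hp : ∀ i, ∀ m' : Mem n, m'.y i = m.y i →
      Exec (p i) m'.get { m' with y := update m'.y i (g (m.y i)) }.get T) :
    Exec (forAll p l) m.get { m with y := fun i => if i ∈ l then g (m.y i) else m.y i }.get
      (l.length * T + 1) := by
  have : ∀ (l : List (Fin n)), l.Nodup → ∀ m' : Mem n, (∀ i ∈ l, m'.y i = m.y i) →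
      Exec (forAll p l) m'.get { m' with y := fun i => if i ∈ l then g (m.y i) else m'.y i }.get
      (l.length * T + 1) := by
    intro l
    induction l with
    | nil =>
      intro _ m' _
      have h := Exec.loop_false (k := Reg.z) (f := fun _ => false) (p := pop .z)
        (S := m'.get) rfl
      simpa [forAll] using h
    | cons i l ih =>
      intro hl m' hm'
      rw [List.nodup_cons] at hl
      have h1 := hp i m' (hm' i List.mem_cons_self)
      have h2 := ih hl.2 { m' with y := update m'.y i (g (m.y i)) } fun j hj => by
        have : j ≠ i := by rintro rfl; exact hl.1 hj
        simpa [this] using hm' j (List.mem_cons_of_mem i hj)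
      refine Exec.mono (T := T + (l.length * T + 1)) ?_ (by rw [List.length_cons]; linarith)
      have h := h1.seq h2
      change Exec (forAll p (i :: l)) _ _ _ at h
      convert h using 3
      funext j
      by_cases hj : j = i
      · subst hj; simp [hl.1]
      · simp [hj]
  exact this l hl m fun _ _ => rfl

/-- The memory while the input is being read: the first `j` symbols have been moved to `ws`, and
were counted on `len` and on all the stacks `y i`. -/
def inputMem (n : ℕ) (w : List Sym) (j : ℕ) : Mem n where
  src := fun b => cond b (w.drop j) []
  ws := (w.take j).reverse
  len := List.replicate j .tally
  lens := []
  z := []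
  res := []
  tab := []
  x := fun _ => []
  y := fun _ => List.replicate j .tally

/-- Make all the unary copies of the length of the input, which correspond to the value `0` of all
variables. -/
def setup (n : ℕ) : Prog (Reg n) Sym :=
  seq (drain (.src true) (seq (move (.src true) .ws) (seq (push .len .tally)
    (forAll (fun i => push (.y i) .tally) (List.finRange n))))) (moveAll .ws (.src true))

theorem exec_setup (n : ℕ) (w : List Sym) :
    Exec (setup n) (inputMem n w 0).get (mem n w ⟨[], [], []⟩ 0).get
      (w.length * (n + 6) + 2) := by
  have hupd : ∀ l l' : List Sym, update (fun b => cond b l []) true l' = fun b => cond b l' [] := by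
    intro l l'
    funext b; cases b <;> simp
  have h : ∀ k j, j + k = w.length → Exec (drain (.src true) (seq (move (.src true) .ws)
      (seq (push .len .tally) (forAll (fun i => push (.y i) .tally) (List.finRange n)))))
      (inputMem n w j).get (inputMem n w w.length).get (k * (n + 4) + 1) := by
    intro k
    induction k with
    | zero =>
      intro j hj
      obtain rfl : j = w.length := by omega
      exact (Exec.loop_false (by simp [inputMem])).mono (by omega)
    | succ k ih =>
      intro j hj
      have hj' : j < w.length := by omega
      obtain ⟨m0, hm0⟩ : ∃ m0 : Mem n, m0 =
          { inputMem n w (j + 1) with y := fun _ => List.replicate j .tally } := ⟨_, rfl⟩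
      have h3 := exec_forAll (fun i => push (.y i) .tally) (fun l => .tally :: l) 1
        (List.finRange n) (List.nodup_finRange n) m0 fun i m' hm' => Exec.push (by simp [hm'])
      have e : ({ m0 with y := fun i => if i ∈ List.finRange n then
          (Sym.tally :: m0.y i) else m0.y i } : Mem n) = inputMem n w (j + 1) := by
        simp [hm0, inputMem, List.replicate_succ]
      rw [e, List.length_finRange] at h3
      refine (Exec.loop_true (by simp [inputMem, hj'])
        (.seq (.move (by simp) rfl) (.seq (.push ?_) h3)) (ih (j + 1) (by omega))).mono ?_
      · have hl : List.replicate (j + 1) Sym.tally = .tally :: List.replicate j .tally := rfl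
        cases h : w[j]? <;> simp [hm0, inputMem, List.take_add_one, hupd, hl, h]
      · rw [add_mul]; omega
  refine ((h w.length 0 (by omega)).seq (T' := 2 * w.length + 1) ?_).mono ?_
  · have h2 := exec_moveAll (k := Reg.ws (n := n)) (k' := .src true) (by simp) w.reverse
      (inputMem n w w.length).get (by simp [inputMem])
    have e : ({ inputMem n w w.length with
        ws := []
        src := update (inputMem n w w.length).src true (w.reverse.reverse ++ []) } : Mem n) =
        mem n w ⟨[], [], []⟩ 0 := by
      have hu : update (fun _ => []) true w = fun b => cond b w [] := by
        funext b; cases b <;> simp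
      simp [inputMem, hu, mem]
    rw [List.length_reverse] at h2
    rw [← e]
    simpa [inputMem] using h2
  · rw [mul_add, mul_add]; omega

/-- Empty all stacks, except the one that holds the result. -/
def cleanup (n : ℕ) : Prog (Reg n) Sym :=
  seq (clear (.src true)) (seq (clear (.src false)) (seq (clear .len)
    (forAll (fun i => clear (.y i)) (List.finRange n))))

theorem exec_cleanup (n : ℕ) (w r : List Sym) (hr : r.length ≤ w.length * w.length) (b : Sym) :
    Exec (cleanup n) (mem n w ⟨r, [], [b]⟩ 0).get (update (fun _ => []) Reg.res [b])
      ((2 * w.length + 1) + ((2 * (w.length * w.length) + 1) + ((2 * w.length + 1) +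
        (n * (2 * w.length + 1) + 1)))) := by
  set m : Mem n := { mem n w ⟨r, [], [b]⟩ 0 with src := fun _ => [], len := [] } with hm
  have h4 := exec_forAll (fun i => clear (.y i)) (fun _ => []) (2 * w.length + 1)
    (List.finRange n) (List.nodup_finRange n) m fun i m' hm' => by
      have h := exec_clear (k := Reg.y i) (m'.y i) m'.get rfl
      rw [hm'] at h
      simpa [hm, mem] using h
  rw [List.length_finRange] at h4
  have e4 : update (fun _ => []) Reg.res [b] =
      ({ m with y := fun i => if i ∈ List.finRange n then [] else m.y i } : Mem n).get := by
    funext k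
    cases k <;> simp [hm, mem]
  rw [e4]
  have h1 := exec_clear (k := Reg.src (n := n) true) w (mem n w ⟨r, [], [b]⟩ 0).get rfl
  have h2 := exec_clear (k := Reg.src (n := n) false) r
    (update (mem n w ⟨r, [], [b]⟩ 0).get (Reg.src true) []) (by simp [mem])
  have h3 := exec_clear (k := Reg.len (n := n)) (List.replicate w.length .tally)
    (update (update (mem n w ⟨r, [], [b]⟩ 0).get (Reg.src true) []) (Reg.src false) [])
    (by simp [mem])
  have e3 : update (update (update (mem n w ⟨r, [], [b]⟩ 0).get (Reg.src true) [])
      (Reg.src false) []) Reg.len [] = m.get := by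
    have : update (update (fun b => cond b w r) true []) false [] = fun _ => [] := by
      funext b; cases b <;> simp
    simp [hm, mem, this]
  rw [e3, List.length_replicate] at h3
  exact h1.seq ((h2.mono (by omega)).seq (h3.seq h4))

end Prog

open Prog in
/-- Iterating an update of a table, where both the update and the final test are predicates in the
sense of `Ev`, leads to a problem in PTIME. -/
theorem inPTime_of_iterate {α : Type} {enc : α → List Sym} (hne : ∀ a, enc a ≠ [])
    {f : Inp → ℕ → ℕ → Prop} (hf : Ev 5 fun I e => f I (e 3) (e 4))
    {ψ : Inp → Prop} (hψ : Ev 0 fun I _ => ψ I) :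
    InPTime enc fun a => ψ ⟨enc a, (fun r => tableOf (enc a).length (f ⟨enc a, r⟩))^[
      (enc a).length * (enc a).length * (enc a).length] []⟩ := by
  have hsmall : ∀ (w r : List Sym), (Inp.mk w (tableOf w.length (f ⟨w, r⟩))).Small :=
    fun w r => (length_tableOf _ _).le
  have hiter : ∀ (G : List Sym → List Sym → List Sym),
      (∀ w r, (Inp.mk w r).Small → (Inp.mk w (G w r)).Small) → ∀ c w r, (Inp.mk w r).Small →
        (Inp.mk w ((G w)^[c] r)).Small := by
    intro G hG c w r hr
    induction c with
    | zero => exact hr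
    | succ c ih => rw [iterate_succ_apply']; exact hG w _ ih
  have h1 : Cmd 3 fun w r => tableOf w.length (f ⟨w, r⟩) := Cmd.table hf
  have h2 := h1.loop fun w r _ => hsmall w r
  have h3 := h2.loop fun w r hr => hiter _ (fun w r _ => hsmall w r) _ w r hr
  have h4 := h3.loop fun w r hr =>
    hiter _ (fun w r hr => hiter _ (fun w r _ => hsmall w r) _ w r hr) _ w r hr
  obtain ⟨N, h4⟩ := h4
  obtain ⟨N', h5⟩ := hψ
  have hn1 : N ≤ max N N' := le_max_left _ _
  have hn2 : N' ≤ max N N' := le_max_right _ _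
  generalize max N N' = n at hn1 hn2
  obtain ⟨p, T, hp⟩ := h4 n hn1
  obtain ⟨q, T', hq⟩ := h5 n hn2
  refine inPTime_of_runs (seq (setup n) (seq p (seq q (cleanup n)))) (.src true) .res
    (Polynomial.X * (Polynomial.C n + 6) + 2 + (T + (T' + ((2 * Polynomial.X + 1) +
      ((2 * (Polynomial.X * Polynomial.X) + 1) + ((2 * Polynomial.X + 1) +
        (Polynomial.C n * (2 * Polynomial.X + 1) + 1))))))) fun a => ?_
  set w := enc a with hw
  set L := w.length with hL
  have hE : ValidEnv L 0 0 := ⟨fun i => List.length_pos_iff.2 (hne a), fun i _ => rfl⟩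
  have hx1 := exec_setup n w
  have hx2 := hp w [] 0 hE (Nat.zero_le _)
  simp only [← iterate_mul] at hx2
  set r := (fun r => tableOf L (f ⟨w, r⟩))^[L * L * L] [] with hr
  have hrs : (Inp.mk w r).Small :=
    hiter _ (fun w r _ => hsmall w r) _ w [] (Nat.zero_le _)
  obtain ⟨b, hb, hx3⟩ := hq w ⟨r, [], []⟩ 0 hE hrs
  have hx4 := exec_cleanup n w r hrs (.bit b)
  have e0 : update (fun _ => []) (Reg.src true) w = (inputMem n w 0).get := by
    funext k
    rcases k with (_ | _) | _ <;> simp [inputMem]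
  obtain ⟨t, ht, hrun⟩ := hx1.seq (hx2.seq (hx3.seq hx4))
  refine ⟨b, t, hb, ?_, e0 ▸ hrun⟩
  simpa using ht

/-! ### Reading a protocol from a word -/

/-- The number of symbols before the first separator. -/
def num (l : List Sym) : ℕ := (l.takeWhile (· ≠ .sep)).length

theorem num_le (l : List Sym) : num l ≤ l.length :=
  (List.takeWhile_sublist _).length_le

/-- The number at the head of a word is characterised by single symbols of the word, which makes it
accessible to first-order formulas. -/
theorem num_eq_iff (l : List Sym) (x : ℕ) :
    num l = x ↔ (∀ t < x, ∃ a, (l.drop t).head? = some a ∧ a ≠ .sep) ∧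
      ¬ ∃ a, (l.drop x).head? = some a ∧ a ≠ .sep := by
  induction l generalizing x with
  | nil => cases x <;> simp [num]; exact ⟨0, Nat.zero_le _⟩
  | cons a l ih =>
    by_cases ha : a = .sep
    · subst ha
      cases x with
      | zero => simp [num]
      | succ x =>
        simp only [num, ne_eq, not_true_eq_false, decide_false, Bool.false_eq_true,
          not_false_eq_true, List.takeWhile_cons_of_neg, List.length_nil, Nat.right_eq_add,
          Nat.add_eq_zero_iff, one_ne_zero, and_false, false_iff, not_and]
        intro h
        obtain ⟨a, h1, h2⟩ := h 0 (Nat.succ_pos x)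
        simp at h1
        exact absurd h1.symm h2
    · have e : num (a :: l) = num l + 1 := by simp [num, ha]
      rw [e]
      cases x with
      | zero => simp [ha]
      | succ x =>
        rw [Nat.add_right_cancel_iff, ih, List.drop_succ_cons]
        refine and_congr_left fun _ => ⟨fun h t ht => ?_, fun h t ht => ?_⟩
        · cases t with
          | zero => exact ⟨a, rfl, ha⟩
          | succ t => exact h t (by omega)
        · exact h (t + 1) (by omega)

theorem length_dropSep_le (l : List Sym) : (dropSep l).length ≤ l.length := by
  rw [dropSep, List.length_tail]
  exact (Nat.sub_le _ _).trans (List.dropWhile_suffix _).length_le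

/-- The word `s` starts with a description of the given transition. -/
def TransAt : ℕ × Action ℕ × ℕ → List Sym → Prop
  | (q, .tau, q'), s => s.head? = some .tau ∧ num (s.drop 1) = q ∧ num (dropSep (s.drop 1)) = q'
  | (q, .send m, q'), s => s.head? = some .send ∧ num (s.drop 1) = q ∧
      num (dropSep (s.drop 1)) = m ∧ num (dropSep (dropSep (s.drop 1))) = q'
  | (q, .recv m, q'), s => s.head? = some .recv ∧ num (s.drop 1) = q ∧
      num (dropSep (s.drop 1)) = m ∧ num (dropSep (dropSep (s.drop 1))) = q'

/-- The protocol described by a word, with numbers as states and messages. A transition is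
recognised by its mark, at any position; marks occur nowhere else in the encoding of an input. -/
def wordProtocol (w : List Sym) : Protocol ℕ ℕ where
  init := num (dropSep (dropSep w))
  final := num (dropSep (dropSep (dropSep w)))
  T := {t | ∃ i, TransAt t (w.drop i)}

/-- The entry of a table at a pair of numbers below `L`. -/
def Entry (L : ℕ) (r : List Sym) (x y : ℕ) : Prop :=
  x < L ∧ y < L ∧ r[x * L + y]? = some (.bit true)

/-- The abstract set described by a table: column `0` is the set of states, column `m + 1` is the
set of tokens for the message `m`. -/
def tableAbs (L : ℕ) (r : List Sym) : AbsSet ℕ ℕ where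
  S := {q | Entry L r q 0}
  Toks := {t | Entry L r t.1 (t.2 + 1)}

/-- The protocol in which predicates are evaluated. -/
abbrev Inp.P (I : Inp) : Protocol ℕ ℕ := wordProtocol I.w

/-- The abstract set in which predicates are evaluated. -/
abbrev Inp.abs (I : Inp) : AbsSet ℕ ℕ := tableAbs I.L I.r

section bounds

variable {w : List Sym} {q q' m i : ℕ} {a : Action ℕ}

theorem pos_lt_of_transAt {t : ℕ × Action ℕ × ℕ} (h : TransAt t (w.drop i)) : i < w.length := by
  have : (w.drop i).head? ≠ none := by
    obtain ⟨q, _ | m | m, q'⟩ := t <;> rw [h.1] <;> simp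
  by_contra hi
  exact this (by simp [List.drop_eq_nil_of_le (not_lt.1 hi)])

theorem bounds_of_transAt (h : TransAt (q, a, q') (w.drop i)) :
    q < w.length ∧ q' < w.length ∧ ∀ m, a = .send m ∨ a = .recv m → m < w.length := by
  have hi := pos_lt_of_transAt h
  have h0 : ((w.drop i).drop 1).length < w.length := by simp; omega
  have h1 := (length_dropSep_le _).trans_lt h0
  have h2 := (length_dropSep_le _).trans_lt h1
  have n0 := (num_le _).trans_lt h0
  have n1 := (num_le _).trans_lt h1
  have n2 := (num_le _).trans_lt h2
  cases a with
  | tau =>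
    obtain ⟨-, rfl, rfl⟩ := h
    exact ⟨n0, n1, by simp⟩
  | send m =>
    obtain ⟨-, rfl, rfl, rfl⟩ := h
    refine ⟨n0, n2, ?_⟩
    rintro m (h | h) <;> cases h
    exact n1
  | recv m =>
    obtain ⟨-, rfl, rfl, rfl⟩ := h
    refine ⟨n0, n2, ?_⟩
    rintro m (h | h) <;> cases h
    exact n1

theorem src_lt (h : (q, a, q') ∈ (wordProtocol w).T) : q < w.length :=
  (bounds_of_transAt h.choose_spec).1

theorem tgt_lt (h : (q, a, q') ∈ (wordProtocol w).T) : q' < w.length :=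
  (bounds_of_transAt h.choose_spec).2.1

theorem send_lt (h : (q, .send m, q') ∈ (wordProtocol w).T) : m < w.length :=
  (bounds_of_transAt h.choose_spec).2.2 m (.inl rfl)

theorem recv_lt (h : (q, .recv m, q') ∈ (wordProtocol w).T) : m < w.length :=
  (bounds_of_transAt h.choose_spec).2.2 m (.inr rfl)

theorem tok_lt {L : ℕ} {r : List Sym} (h : (q, m) ∈ (tableAbs L r).Toks) : q < L ∧ m < L :=
  ⟨h.1, (Nat.lt_succ_self m).trans h.2.1⟩

theorem toks2_lt {r : List Sym} {t : ℕ × ℕ}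
    (h : (wordProtocol w).Toks2 (tableAbs w.length r) t) : t.1 < w.length ∧ t.2 < w.length := by
  cases h with
  | base _ h => exact tok_lt h
  | newTok p p' a h => exact ⟨tgt_lt h, send_lt h⟩
  | tokStep q q' a m h h' => exact ⟨tgt_lt h, (tok_lt h').2⟩

end bounds

/-! ### Predicates on protocols evaluated by the machine -/

/-- `x` is the value of a variable. -/
def IsVar {d : ℕ} (x : (Fin d → ℕ) → ℕ) : Prop := ∃ i, x = fun e => e i

/-- A move, read with one more variable in scope. -/
def Move.lift {d : ℕ} : Move d → Move (d + 1)
  | one => one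
  | var i => var i.castSucc
  | cvar i => cvar i.castSucc
  | varLen i => varLen i.castSucc
  | sep => sep
  | varSep i => varSep i.castSucc

theorem Move.restAll_lift {d : ℕ} (L : ℕ) (e : Fin (d + 1) → ℕ) (mvs : List (Move d))
    (l : List Sym) : restAll L e (mvs.map lift) l = restAll L (Fin.init e) mvs l := by
  unfold restAll
  rw [List.foldl_map]
  congr
  funext l mv
  cases mv <;> rfl

namespace Ev

variable {d : ℕ} {x y z : (Fin d → ℕ) → ℕ}

/-- A quantifier needs no explicit bound if the formula implies one. -/
theorem exB {f : Inp → (Fin d → ℕ) → ℕ → Prop}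
    (h : Ev (d + 1) fun I e => f I (Fin.init e) (e (Fin.last d)))
    (hb : ∀ I e v, f I e v → v < I.L) : Ev d fun I e => ∃ v, f I e v :=
  (Ev.ex h).congr fun I e _ _ =>
    ⟨fun ⟨v, _, h⟩ => ⟨v, h⟩, fun ⟨v, h⟩ => ⟨v, hb I e v h, h⟩⟩

/-- `x < y` holds if and only if skipping `x`, and then `L - y` symbols of the word does not lead
beyond its end. -/
theorem lt (hx : IsVar x := by exact ⟨_, rfl⟩) (hy : IsVar y := by exact ⟨_, rfl⟩) :
    Ev d fun _ e => x e < y e := by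
  obtain ⟨i, rfl⟩ := hx
  obtain ⟨j, rfl⟩ := hy
  refine (atom true [.var i, .cvar j] Option.isSome).congr fun I e _ he => ?_
  have : e j < I.w.length := he j
  simp [Move.restAll, Move.rest, Inp.L]
  omega

theorem eq (hx : IsVar x := by exact ⟨_, rfl⟩) (hy : IsVar y := by exact ⟨_, rfl⟩) :
    Ev d fun _ e => x e = y e :=
  ((lt hx hy).not.and (lt hy hx).not).congr fun _ _ _ _ => by omega

theorem succ (hx : IsVar x := by exact ⟨_, rfl⟩) (hy : IsVar y := by exact ⟨_, rfl⟩) :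
    Ev d fun _ e => x e = y e + 1 := by
  have h : Ev d fun _ e => y e + 1 < x e := by
    obtain ⟨i, rfl⟩ := hx
    obtain ⟨j, rfl⟩ := hy
    refine (atom true [.one, .var j, .cvar i] Option.isSome).congr fun I e _ he => ?_
    have : e i < I.w.length := he i
    simp [Move.restAll, Move.rest, Inp.L]
    omega
  exact ((lt hy hx).and h.not).congr fun _ _ _ _ => by omega

theorem zero (hx : IsVar x := by exact ⟨_, rfl⟩) : Ev d fun _ e => x e = 0 := by
  obtain ⟨i, rfl⟩ := hx
  refine (Ev.ex (f := fun _ e v => v < e i) lt).not.congr fun I e _ he => ⟨fun h => ?_, fun h => ?_⟩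
  · by_contra h0
    exact h ⟨0, (Nat.zero_le _).trans_lt (he i), Nat.pos_of_ne_zero h0⟩
  · rintro ⟨v, -, hv⟩
    exact Nat.ne_zero_of_lt hv h

/-- A variable is the number found at a computed position of the word. -/
theorem num (mvs : List (Move d)) (hx : IsVar x := by exact ⟨_, rfl⟩) :
    Ev d fun I e => Rendezvous.num (Move.restAll I.L e mvs I.w) = x e := by
  obtain ⟨i, rfl⟩ := hx
  have h : Ev (d + 1) fun I e => ∃ a, ((Move.restAll I.L (Fin.init e) mvs I.w).drop
      (e (Fin.last d))).head? = some a ∧ a ≠ .sep := by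
    refine (atom true (mvs.map Move.lift ++ [.var (Fin.last d)])
      (fun o => decide (o ≠ none ∧ o ≠ some .sep))).congr fun I e _ _ => ?_
    have : Move.restAll I.L e (mvs.map Move.lift ++ [.var (Fin.last d)]) I.w =
        (Move.restAll I.L (Fin.init e) mvs I.w).drop (e (Fin.last d)) := by
      rw [← Move.restAll_lift]
      simp [Move.restAll, Move.rest]
    simp only [cond_true, this]
    cases h : ((Move.restAll I.L (Fin.init e) mvs I.w).drop (e (Fin.last d))).head? <;> simp
  refine ((Ev.all (f := fun I e v => v < e i → ∃ a, ((Move.restAll I.L e mvs I.w).drop v).head? =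
    some a ∧ a ≠ .sep) (.imp lt h)).and (Ev.ex (f := fun I e v => v = e i ∧
      ∃ a, ((Move.restAll I.L e mvs I.w).drop v).head? = some a ∧ a ≠ .sep)
      (.and eq h)).not).congr fun I e _ he => ?_
  rw [num_eq_iff]
  refine and_congr ⟨fun h t ht => h t (ht.trans (he i)) ht, fun h t _ ht => h t ht⟩
    (not_congr ⟨?_, ?_⟩)
  · rintro ⟨_, -, rfl, h⟩; exact h
  · rintro h; exact ⟨_, he i, rfl, h⟩

theorem symbol (mvs : List (Move d)) (a : Sym) :
    Ev d fun I e => (Move.restAll I.L e mvs I.w).head? = some a :=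
  (atom true mvs fun o => decide (o = some a)).congr fun _ _ _ _ => by simp

theorem isInit (hx : IsVar x := by exact ⟨_, rfl⟩) : Ev d fun I e => I.P.init = x e :=
  num [.sep, .sep] hx

theorem isFinal (hx : IsVar x := by exact ⟨_, rfl⟩) : Ev d fun I e => I.P.final = x e :=
  num [.sep, .sep, .sep] hx

theorem tau (hx : IsVar x := by exact ⟨_, rfl⟩) (hy : IsVar y := by exact ⟨_, rfl⟩) :
    Ev d fun I e => (x e, .tau, y e) ∈ I.P.T := by
  obtain ⟨i, rfl⟩ := hx
  obtain ⟨j, rfl⟩ := hy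
  exact exB (((symbol [.var (Fin.last d)] .tau).and ((num [.var (Fin.last d), .one]).and
    (num [.var (Fin.last d), .one, .sep])))) fun I e v h => pos_lt_of_transAt h

theorem send (hx : IsVar x := by exact ⟨_, rfl⟩) (hy : IsVar y := by exact ⟨_, rfl⟩)
    (hz : IsVar z := by exact ⟨_, rfl⟩) : Ev d fun I e => (x e, .send (y e), z e) ∈ I.P.T := by
  obtain ⟨i, rfl⟩ := hx
  obtain ⟨j, rfl⟩ := hy
  obtain ⟨k, rfl⟩ := hz
  exact exB ((symbol [.var (Fin.last d)] .send).and ((num [.var (Fin.last d), .one]).and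
    ((num [.var (Fin.last d), .one, .sep]).and (num [.var (Fin.last d), .one, .sep, .sep]))))
    fun I e v h => pos_lt_of_transAt h

theorem recv (hx : IsVar x := by exact ⟨_, rfl⟩) (hy : IsVar y := by exact ⟨_, rfl⟩)
    (hz : IsVar z := by exact ⟨_, rfl⟩) : Ev d fun I e => (x e, .recv (y e), z e) ∈ I.P.T := by
  obtain ⟨i, rfl⟩ := hx
  obtain ⟨j, rfl⟩ := hy
  obtain ⟨k, rfl⟩ := hz
  exact exB ((symbol [.var (Fin.last d)] .recv).and ((num [.var (Fin.last d), .one]).and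
    ((num [.var (Fin.last d), .one, .sep]).and (num [.var (Fin.last d), .one, .sep, .sep]))))
    fun I e v h => pos_lt_of_transAt h

theorem entry (hx : IsVar x := by exact ⟨_, rfl⟩) (hy : IsVar y := by exact ⟨_, rfl⟩) :
    Ev d fun I e => Entry I.L I.r (x e) (y e) := by
  obtain ⟨i, rfl⟩ := hx
  obtain ⟨j, rfl⟩ := hy
  refine (atom false [.varLen i, .var j] fun o => decide (o = some (.bit true))).congr
    fun I e _ he => ?_
  simp [Move.restAll, Move.rest, Entry, he i, he j]

theorem state (hx : IsVar x := by exact ⟨_, rfl⟩) : Ev d fun I e => x e ∈ I.abs.S := by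
  obtain ⟨i, rfl⟩ := hx
  refine (exB (f := fun I e v => v = 0 ∧ Entry I.L I.r (e i) v) (.and zero entry)
    fun I e v h => h.2.2.1).congr fun I e _ _ => ⟨?_, fun h => ⟨0, rfl, h⟩⟩
  rintro ⟨_, rfl, h⟩
  exact h

theorem token (hx : IsVar x := by exact ⟨_, rfl⟩) (hy : IsVar y := by exact ⟨_, rfl⟩) :
    Ev d fun I e => (x e, y e) ∈ I.abs.Toks := by
  obtain ⟨i, rfl⟩ := hx
  obtain ⟨j, rfl⟩ := hy
  refine (exB (f := fun I e v => v = e j + 1 ∧ Entry I.L I.r (e i) v) (.and succ entry)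
    fun I e v h => h.2.2.1).congr fun I e _ _ => ⟨?_, fun h => ⟨_, rfl, h⟩⟩
  rintro ⟨_, rfl, h⟩
  exact h

theorem mem_rec (hx : IsVar x := by exact ⟨_, rfl⟩) (hy : IsVar y := by exact ⟨_, rfl⟩) :
    Ev d fun I e => x e ∈ I.P.Rec (y e) := by
  obtain ⟨i, rfl⟩ := hx
  obtain ⟨j, rfl⟩ := hy
  exact exB recv fun I e v h => tgt_lt h

theorem canSend (hx : IsVar x := by exact ⟨_, rfl⟩) :
    Ev d fun I e => I.P.CanSend I.abs.S (x e) := by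
  obtain ⟨i, rfl⟩ := hx
  exact exB (exB (.and send state) fun I e v h => tgt_lt h.1) fun I e v ⟨_, h⟩ => src_lt h.1

theorem canReceive (hx : IsVar x := by exact ⟨_, rfl⟩) :
    Ev d fun I e => I.P.CanReceive I.abs.S (x e) := by
  obtain ⟨i, rfl⟩ := hx
  exact exB (exB (.and recv state) fun I e v h => tgt_lt h.1) fun I e v ⟨_, h⟩ => src_lt h.1

end Ev

/-! ### The abstraction function as a predicate -/

namespace Protocol

variable {Q M : Type*} (P : Protocol Q M) (γ : AbsSet Q M)

theorem s2_iff (q : Q) : P.S2 γ q ↔ q ∈ γ.S ∨ (∃ p, (p, .tau, q) ∈ P.T ∧ p ∈ γ.S) ∨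
    (∃ p a, (p, .send a, q) ∈ P.T ∧ p ∈ γ.S ∧ (a ∉ P.Rec q ∨ P.CanReceive γ.S a)) ∨
    (∃ p a, (p, .recv a, q) ∈ P.T ∧ (p ∈ γ.S ∨ (p, a) ∈ γ.Toks) ∧ P.CanSend γ.S a) ∨
    ∃ p a m, (p, .recv a, q) ∈ P.T ∧ (p, m) ∈ γ.Toks ∧ m ≠ a ∧ P.CanSend γ.S a ∧
      m ∉ P.Rec q := by
  constructor
  · rintro (⟨_, h⟩ | ⟨p, _, h1, h2⟩ | ⟨p, _, a, h1, h2, h3⟩ | ⟨p, _, a, h1, h2, h3⟩ |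
      ⟨p, _, a, m, h1, h2, h3, h4, h5⟩)
    · exact .inl h
    · exact .inr (.inl ⟨p, h1, h2⟩)
    · exact .inr (.inr (.inl ⟨p, a, h1, h2, h3⟩))
    · exact .inr (.inr (.inr (.inl ⟨p, a, h1, h2, h3⟩)))
    · exact .inr (.inr (.inr (.inr ⟨p, a, m, h1, h2, h3, h4, h5⟩)))
  · rintro (h | ⟨p, h1, h2⟩ | ⟨p, a, h1, h2, h3⟩ | ⟨p, a, h1, h2, h3⟩ |
      ⟨p, a, m, h1, h2, h3, h4, h5⟩)
    · exact .base q h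
    · exact .internal p q h1 h2
    · exact .send p q a h1 h2 h3
    · exact .recv p q a h1 h2 h3
    · exact .tokEnd p q a m h1 h2 h3 h4 h5

theorem toks2_iff (q : Q) (m : M) : P.Toks2 γ (q, m) ↔ (q, m) ∈ γ.Toks ∨
    (∃ p, (p, .send m, q) ∈ P.T ∧ p ∈ γ.S ∧ m ∈ P.Rec q ∧ ¬ P.CanReceive γ.S m) ∨
    ∃ p a, (p, .recv a, q) ∈ P.T ∧ (p, m) ∈ γ.Toks ∧ m ≠ a ∧ P.CanSend γ.S a ∧ m ∈ P.Rec q := by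
  constructor
  · rintro (⟨_, h⟩ | ⟨p, _, _, h1, h2, h3, h4⟩ | ⟨p, _, a, _, h1, h2, h3, h4, h5⟩)
    · exact .inl h
    · exact .inr (.inl ⟨p, h1, h2, h3, h4⟩)
    · exact .inr (.inr ⟨p, a, h1, h2, h3, h4, h5⟩)
  · rintro (h | ⟨p, h1, h2, h3, h4⟩ | ⟨p, a, h1, h2, h3, h4, h5⟩)
    · exact .base _ h
    · exact .newTok p q m h1 h2 h3 h4
    · exact .tokStep p q a m h1 h2 h3 h4 h5

theorem s1_iff (q : Q) : P.S1 γ q ↔ P.S2 γ q ∨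
    (∃ q₂ m₁ m₂, P.Toks2 γ (q, m₁) ∧ P.Toks2 γ (q₂, m₂) ∧ m₁ ≠ m₂ ∧
      m₂ ∉ P.Rec q ∧ m₁ ∈ P.Rec q₂) ∨
    (∃ q₂ q₃ m₁ m₂, P.Toks2 γ (q, m₁) ∧ P.Toks2 γ (q₂, m₂) ∧ P.Toks2 γ (q₃, m₂) ∧ m₁ ≠ m₂ ∧
      (q₂, .recv m₁, q₃) ∈ P.T) ∨
    ∃ q₂ q₃ m₁ m₂ m₃, P.Toks2 γ (q, m₁) ∧ P.Toks2 γ (q₂, m₂) ∧ P.Toks2 γ (q₃, m₃) ∧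
      m₁ ≠ m₂ ∧ m₁ ≠ m₃ ∧ m₂ ≠ m₃ ∧ m₁ ∉ P.Rec q₂ ∧ m₁ ∈ P.Rec q₃ ∧ m₂ ∉ P.Rec q ∧
      m₂ ∈ P.Rec q₃ ∧ m₃ ∈ P.Rec q₂ ∧ m₃ ∈ P.Rec q := by
  constructor
  · rintro (h | ⟨q₂, m₁, m₂, h1, h2, h3, h4, h5⟩ | ⟨q₂, q₃, m₁, m₂, h1, h2, h3, h4, h5⟩ |
      ⟨q₂, q₃, m₁, m₂, m₃, h1, h2, h3, h4, h5, h6, h7, h8, h9, h10, h11, h12⟩)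
    · exact .inl h
    · exact .inr (.inl ⟨q₂, m₁, m₂, h1, h2, h3, h4, h5⟩)
    · exact .inr (.inr (.inl ⟨q₂, q₃, m₁, m₂, h1, h2, h3, h4, h5⟩))
    · exact .inr (.inr (.inr ⟨q₂, q₃, m₁, m₂, m₃, h1, h2, h3, h4, h5, h6, h7, h8, h9, h10,
        h11, h12⟩))
  · rintro (h | ⟨q₂, m₁, m₂, h1, h2, h3, h4, h5⟩ | ⟨q₂, q₃, m₁, m₂, h1, h2, h3, h4, h5⟩ |
      ⟨q₂, q₃, m₁, m₂, m₃, h1, h2, h3, h4, h5, h6, h7, h8, h9, h10, h11, h12⟩)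
    · exact .base q h
    · exact .twoToks q q₂ m₁ m₂ h1 h2 h3 h4 h5
    · exact .threeToks q q₂ q₃ m₁ m₂ h1 h2 h3 h4 h5
    · exact .threeToks' q q₂ q₃ m₁ m₂ m₃ h1 h2 h3 h4 h5 h6 h7 h8 h9 h10 h11 h12

/-- A protocol is wait-only if and only if the set of all states without receptions is a valid
choice for the set of active states. -/
theorem waitOnly_iff : P.WaitOnly ↔ (¬ ∃ m, m ∈ P.Rec P.init) ∧ ¬ ∃ q, (∃ m, m ∈ P.Rec q) ∧
    ((∃ q', (q, .tau, q') ∈ P.T) ∨ ∃ m q', (q, .send m, q') ∈ P.T) := by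
  constructor
  · rintro ⟨A, h0, h1, h2⟩
    have h3 : ∀ q m, m ∈ P.Rec q → q ∉ A := fun q m ⟨q', h⟩ hq => h1 q hq q m q' h rfl
    refine ⟨fun ⟨m, h⟩ => h3 _ m h h0, ?_⟩
    rintro ⟨q, ⟨m, h⟩, ⟨q', h'⟩ | ⟨m', q', h'⟩⟩
    · exact (h2 q (h3 q m h)).2 q q' h' rfl
    · exact (h2 q (h3 q m h)).1 q m' q' h' rfl
  · rintro ⟨h0, h1⟩
    refine ⟨{q | ¬ ∃ m, m ∈ P.Rec q}, h0, fun q hq q' m q'' h e => ?_, fun q hq => ⟨?_, ?_⟩⟩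
    · exact hq ⟨m, q'', e ▸ h⟩
    · rintro q' m q'' h rfl
      exact h1 ⟨q', not_not.1 hq, .inr ⟨m, q'', h⟩⟩
    · rintro q' q'' h rfl
      exact h1 ⟨q', not_not.1 hq, .inl ⟨q'', h⟩⟩

end Protocol

namespace Ev

variable {d : ℕ} {x y : (Fin d → ℕ) → ℕ}

theorem s2 (hx : IsVar x := by exact ⟨_, rfl⟩) : Ev d fun I e => I.P.S2 I.abs (x e) := by
  obtain ⟨i, rfl⟩ := hx
  refine Ev.congr (f := fun I e => e i ∈ I.abs.S ∨ (∃ p, (p, .tau, e i) ∈ I.P.T ∧ p ∈ I.abs.S) ∨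
    (∃ p a, (p, .send a, e i) ∈ I.P.T ∧ p ∈ I.abs.S ∧
      (a ∉ I.P.Rec (e i) ∨ I.P.CanReceive I.abs.S a)) ∨
    (∃ p a, (p, .recv a, e i) ∈ I.P.T ∧ (p ∈ I.abs.S ∨ (p, a) ∈ I.abs.Toks) ∧
      I.P.CanSend I.abs.S a) ∨
    ∃ p a m, (p, .recv a, e i) ∈ I.P.T ∧ (p, m) ∈ I.abs.Toks ∧ m ≠ a ∧ I.P.CanSend I.abs.S a ∧
      m ∉ I.P.Rec (e i)) ?_ fun I e _ _ => (I.P.s2_iff I.abs (e i)).symm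
  refine .or state (.or ?_ (.or ?_ (.or ?_ ?_)))
  · exact exB (.and tau state) fun I e v h => src_lt h.1
  · exact exB (exB (.and send (.and state (.or (.not mem_rec) canReceive)))
      fun I e v h => send_lt h.1) fun I e v ⟨_, h⟩ => src_lt h.1
  · exact exB (exB (.and recv (.and (.or state token) canSend))
      fun I e v h => recv_lt h.1) fun I e v ⟨_, h⟩ => src_lt h.1
  · exact exB (exB (exB (.and recv (.and token (.and (.not eq) (.and canSend (.not mem_rec)))))
      fun I e v h => (tok_lt h.2.1).2) fun I e v ⟨_, h⟩ => recv_lt h.1)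
      fun I e v ⟨_, _, h⟩ => src_lt h.1

theorem toks2 (hx : IsVar x := by exact ⟨_, rfl⟩) (hy : IsVar y := by exact ⟨_, rfl⟩) :
    Ev d fun I e => I.P.Toks2 I.abs (x e, y e) := by
  obtain ⟨i, rfl⟩ := hx
  obtain ⟨j, rfl⟩ := hy
  refine Ev.congr (f := fun I e => (e i, e j) ∈ I.abs.Toks ∨
    (∃ p, (p, .send (e j), e i) ∈ I.P.T ∧ p ∈ I.abs.S ∧ e j ∈ I.P.Rec (e i) ∧
      ¬ I.P.CanReceive I.abs.S (e j)) ∨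
    ∃ p a, (p, .recv a, e i) ∈ I.P.T ∧ (p, e j) ∈ I.abs.Toks ∧ e j ≠ a ∧
      I.P.CanSend I.abs.S a ∧ e j ∈ I.P.Rec (e i)) ?_
    fun I e _ _ => (I.P.toks2_iff I.abs (e i) (e j)).symm
  refine .or token (.or ?_ ?_)
  · exact exB (.and send (.and state (.and mem_rec (.not canReceive))))
      fun I e v h => src_lt h.1
  · exact exB (exB (.and recv (.and token (.and (.not eq) (.and canSend mem_rec))))
      fun I e v h => recv_lt h.1) fun I e v ⟨_, h⟩ => src_lt h.1

theorem s1 (hx : IsVar x := by exact ⟨_, rfl⟩) : Ev d fun I e => I.P.S1 I.abs (x e) := by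
  obtain ⟨i, rfl⟩ := hx
  refine Ev.congr (f := fun I e => I.P.S2 I.abs (e i) ∨
    (∃ q₂ m₁ m₂, I.P.Toks2 I.abs (e i, m₁) ∧ I.P.Toks2 I.abs (q₂, m₂) ∧ m₁ ≠ m₂ ∧
      m₂ ∉ I.P.Rec (e i) ∧ m₁ ∈ I.P.Rec q₂) ∨
    (∃ q₂ q₃ m₁ m₂, I.P.Toks2 I.abs (e i, m₁) ∧ I.P.Toks2 I.abs (q₂, m₂) ∧
      I.P.Toks2 I.abs (q₃, m₂) ∧ m₁ ≠ m₂ ∧ (q₂, .recv m₁, q₃) ∈ I.P.T) ∨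
    ∃ q₂ q₃ m₁ m₂ m₃, I.P.Toks2 I.abs (e i, m₁) ∧ I.P.Toks2 I.abs (q₂, m₂) ∧
      I.P.Toks2 I.abs (q₃, m₃) ∧ m₁ ≠ m₂ ∧ m₁ ≠ m₃ ∧ m₂ ≠ m₃ ∧ m₁ ∉ I.P.Rec q₂ ∧
      m₁ ∈ I.P.Rec q₃ ∧ m₂ ∉ I.P.Rec (e i) ∧ m₂ ∈ I.P.Rec q₃ ∧ m₃ ∈ I.P.Rec q₂ ∧
      m₃ ∈ I.P.Rec (e i)) ?_
    fun I e _ _ => (I.P.s1_iff I.abs (e i)).symm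
  refine .or s2 (.or ?_ (.or ?_ ?_))
  · exact exB (exB (exB (.and toks2 (.and toks2 (.and (.not eq) (.and (.not mem_rec) mem_rec))))
      fun I e v h => (toks2_lt h.2.1).2) fun I e v ⟨_, h⟩ => (toks2_lt h.1).2)
      fun I e v ⟨_, _, h⟩ => (toks2_lt h.2.1).1
  · exact exB (exB (exB (exB (.and toks2 (.and toks2 (.and toks2 (.and (.not eq) recv))))
      fun I e v h => (toks2_lt h.2.1).2) fun I e v ⟨_, h⟩ => (toks2_lt h.1).2)
      fun I e v ⟨_, _, h⟩ => (toks2_lt h.2.2.1).1) fun I e v ⟨_, _, _, h⟩ => (toks2_lt h.2.1).1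
  · exact exB (exB (exB (exB (exB (.and toks2 (.and toks2 (.and toks2 (.and (.not eq)
      (.and (.not eq) (.and (.not eq) (.and (.not mem_rec) (.and mem_rec (.and (.not mem_rec)
      (.and mem_rec (.and mem_rec mem_rec)))))))))))
      fun I e v h => (toks2_lt h.2.2.1).2) fun I e v ⟨_, h⟩ => (toks2_lt h.2.1).2)
      fun I e v ⟨_, _, h⟩ => (toks2_lt h.1).2) fun I e v ⟨_, _, _, h⟩ => (toks2_lt h.2.2.1).1)
      fun I e v ⟨_, _, _, _, h⟩ => (toks2_lt h.2.1).1

end Ev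

/-- The update of tables that corresponds to `F`. It also puts the initial state into `S`, so that
it leads from the empty table to the table of `γ₀`. -/
def Inp.Update (I : Inp) (x y : ℕ) : Prop :=
  (y = 0 ∧ (I.P.S1 I.abs x ∨ I.P.init = x)) ∨
    ∃ m, y = m + 1 ∧ I.P.Toks2 I.abs (x, m) ∧ ¬ I.P.S1 I.abs x

theorem Ev.update {d : ℕ} {x y : (Fin d → ℕ) → ℕ} (hx : IsVar x := by exact ⟨_, rfl⟩)
    (hy : IsVar y := by exact ⟨_, rfl⟩) : Ev d fun I e => I.Update (x e) (y e) := by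
  obtain ⟨i, rfl⟩ := hx
  obtain ⟨j, rfl⟩ := hy
  exact .or (.and zero (.or s1 isInit)) (exB (.and succ (.and toks2 (.not s1)))
    fun I e v h => (toks2_lt h.2.1).2)

/-! ### The final tests as predicates -/

theorem Ev.waitOnly : Ev 0 fun I _ => I.P.WaitOnly := by
  refine Ev.congr (f := fun I _ => (¬ ∃ q, I.P.init = q ∧ ∃ m, m ∈ I.P.Rec q) ∧
    ¬ ∃ q, (∃ m, m ∈ I.P.Rec q) ∧
      ((∃ q', (q, .tau, q') ∈ I.P.T) ∨ ∃ m q', (q, .send m, q') ∈ I.P.T)) ?_ fun I _ _ _ => by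
    rw [I.P.waitOnly_iff]; simp
  refine .and (.not (exB (.and isInit (exB mem_rec ?_)) ?_)) (.not (exB (.and (exB mem_rec ?_)
    (.or (exB tau ?_) (exB (exB send ?_) ?_))) ?_))
  · exact fun I e v ⟨_, h⟩ => recv_lt h
  · rintro I e v ⟨_, _, _, h⟩; exact src_lt h
  · exact fun I e v ⟨_, h⟩ => recv_lt h
  · exact fun I e v h => tgt_lt h
  · exact fun I e v h => tgt_lt h
  · exact fun I e v ⟨_, h⟩ => send_lt h
  · rintro I e v ⟨⟨_, _, h⟩, _⟩; exact src_lt h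

theorem Ev.st {d : ℕ} {x : (Fin d → ℕ) → ℕ} (hx : IsVar x := by exact ⟨_, rfl⟩) :
    Ev d fun I e => x e ∈ I.abs.st := by
  obtain ⟨i, rfl⟩ := hx
  exact exB token fun I e v h => (tok_lt h).2

theorem Ev.conflictFree {d : ℕ} {x y : (Fin d → ℕ) → ℕ} (hx : IsVar x := by exact ⟨_, rfl⟩)
    (hy : IsVar y := by exact ⟨_, rfl⟩) :
    Ev d fun I e => I.abs.ConflictFree I.P (x e) (y e) := by
  obtain ⟨i, rfl⟩ := hx
  obtain ⟨j, rfl⟩ := hy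
  exact exB (exB (.and (.not eq) (.and token (.and token (.and (.not mem_rec) (.not mem_rec)))))
    fun I e v h => (tok_lt h.2.2.1).2) fun I e v ⟨_, h⟩ => (tok_lt h.2.1).2

/-- The test for `SCover`: the final state occurs in the abstract set. -/
theorem Ev.final : Ev 0 fun I _ => I.P.final ∈ I.abs.S ∨ I.P.final ∈ I.abs.st := by
  refine Ev.congr (f := fun I _ => ∃ q, I.P.final = q ∧ (q ∈ I.abs.S ∨ q ∈ I.abs.st))
    (exB (.and isFinal (.or state st)) ?_) fun I _ _ _ => by simp
  rintro I e v ⟨-, h | ⟨_, h⟩⟩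
  · exact h.1
  · exact (tok_lt h).1

/-- A configuration, of which it is known which states occur at least once, and which occur at
least twice, respects an abstract set. -/
def RespectsCounts (P : Protocol ℕ ℕ) (γ : AbsSet ℕ ℕ) (one two : ℕ → Prop) : Prop :=
  ¬ ∃ q, one q ∧ ¬ (q ∈ γ.S ∨ (q ∈ γ.st ∧ ¬ two q ∧
    ¬ ∃ q', q' ∈ γ.st ∧ q' ≠ q ∧ one q' ∧ ¬ two q' ∧ ¬ γ.ConflictFree P q q'))

/-- Some bit of the word is followed by exactly as many separators as there are numbers from `q`
up to the number of states, so that it belongs to the multiplicity of `q`. If `b` holds, then the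
bit is not the last one of its block. The exact number of separators is expressed by two numbers of
the form `num (w.drop _)`, because `w` starts with the number of states in unary. -/
def HasBit (b : Bool) (w : List Sym) (q : ℕ) : Prop :=
  num w < w.length ∧ q < num w ∧ ∃ i, (∃ c, (w.drop i).head? = some (.bit c)) ∧
    (b = true → ∃ c, ((w.drop i).drop 1).head? = some (.bit c)) ∧
    dropSep^[num (w.drop q)] (w.drop i) = [] ∧
    dropSep^[num ((w.drop 1).drop q)] (w.drop i) ≠ []

theorem HasBit.lt {b : Bool} {w : List Sym} {q : ℕ} (h : HasBit b w q) : q < w.length :=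
  h.2.1.trans h.1

namespace Ev

variable {d : ℕ} {x : (Fin d → ℕ) → ℕ}

theorem nil (mvs : List (Move d)) : Ev d fun I e => Move.restAll I.L e mvs I.w = [] :=
  (atom true mvs fun o => decide (o = none)).congr fun _ _ _ _ => by simp

theorem bit (mvs : List (Move d)) :
    Ev d fun I e => ∃ c, (Move.restAll I.L e mvs I.w).head? = some (.bit c) := by
  refine ((symbol mvs (.bit true)).or (symbol mvs (.bit false))).congr fun I e _ _ => ?_
  simp [or_comm]

theorem const_imp (b : Bool) {f : Inp → (Fin d → ℕ) → Prop} (h : Ev d f) :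
    Ev d fun I e => b = true → f I e := by
  cases b with
  | true => exact h.congr fun _ _ _ _ => by simp
  | false => exact (h.or h.not).congr fun I e _ _ => by simp [Classical.em]

theorem hasBit (b : Bool) (hx : IsVar x := by exact ⟨_, rfl⟩) :
    Ev d fun I e => HasBit b I.w (x e) := by
  obtain ⟨j, rfl⟩ := hx
  have h1 : Ev d fun I e => ∃ c, c < I.L ∧ Rendezvous.num (I.w.drop (e j)) = c ∧
      ∃ c', c' < I.L ∧ Rendezvous.num ((I.w.drop 1).drop (e j)) = c' ∧
      ∃ i, (∃ c, (I.w.drop i).head? = some (.bit c)) ∧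
      (b = true → ∃ c, ((I.w.drop i).drop 1).head? = some (.bit c)) ∧
      dropSep^[c] (I.w.drop i) = [] ∧ dropSep^[c'] (I.w.drop i) ≠ [] := by
    refine ex (.and (num [.var j.castSucc]) (ex (.and
      (num [.one, .var j.castSucc.castSucc]) (exB (.and (bit [.var (Fin.last (d + 2))])
        (.and (const_imp b (bit [.var (Fin.last (d + 2)), .one])) (.and
        (nil [.var (Fin.last (d + 2)), .varSep (Fin.last d).castSucc.castSucc])
          (nil [.var (Fin.last (d + 2)), .varSep (Fin.last (d + 1)).castSucc]).not))) ?_))))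
    rintro I e v ⟨⟨c, h⟩, -⟩
    by_contra hv
    rw [List.drop_eq_nil_of_le (not_lt.1 hv)] at h
    cases h
  refine ((Ev.ex (f := fun I e n => Rendezvous.num I.w = n ∧ e j < n)
    (.and (num []) lt)).and h1).congr fun I e _ he => ⟨?_, ?_⟩
  · rintro ⟨⟨_, hc, rfl, hj⟩, _, -, rfl, _, -, rfl, h⟩
    exact ⟨hc, hj, h⟩
  · rintro ⟨hc, hj, h⟩
    have hL : e j < I.w.length := he j
    refine ⟨⟨_, hc, rfl, hj⟩, _, ?_, rfl, _, (num_le _).trans_lt ?_, rfl, h⟩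
    · obtain h0 | h0 := Nat.eq_zero_or_pos (e j)
      · rwa [h0]
      · refine (num_le _).trans_lt ?_
        simp only [List.length_drop, Inp.L]
        omega
    · simp only [List.length_drop, Inp.L]
      omega

theorem respectsCounts {one two : Inp → ℕ → Prop} (hb : ∀ I q, one I q → q < I.L)
    (h1 : ∀ d (x : (Fin d → ℕ) → ℕ), IsVar x → Ev d fun I e => one I (x e))
    (h2 : ∀ d (x : (Fin d → ℕ) → ℕ), IsVar x → Ev d fun I e => two I (x e)) :
    Ev 0 fun I _ => RespectsCounts I.P I.abs (one I) (two I) := by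
  refine .not (exB (.and (h1 _ _ ⟨_, rfl⟩) (.not (.or state (.and st (.and (.not (h2 _ _ ⟨_, rfl⟩))
    (.not (exB (.and st (.and (.not eq) (.and (h1 _ _ ⟨_, rfl⟩) (.and (.not (h2 _ _ ⟨_, rfl⟩))
      (.not conflictFree))))) ?_))))))) ?_)
  · exact fun I e v h => hb _ _ h.2.2.1
  · exact fun I e v h => hb _ _ h.1

end Ev

/-! ### Renaming states and messages -/

/-- Rename the message of an action. -/
def Action.map {M M' : Type*} (g : M → M') : Action M → Action M'
  | tau => tau
  | send m => send (g m)
  | recv m => recv (g m)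

/-- Rename the states and the messages of a protocol. -/
def Protocol.map {Q Q' M M' : Type*} (f : Q → Q') (g : M → M') (P : Protocol Q M) :
    Protocol Q' M' where
  init := f P.init
  final := f P.final
  T := (fun t => (f t.1, t.2.1.map g, f t.2.2)) '' P.T

/-- Rename the states and the messages of an abstract set. -/
def AbsSet.map {Q Q' M M' : Type*} (f : Q → Q') (g : M → M') (γ : AbsSet Q M) : AbsSet Q' M' where
  S := f '' γ.S
  Toks := (fun t => (f t.1, g t.2)) '' γ.Toks

section map

variable {Q Q' M M' : Type*} {f : Q → Q'} {g : M → M'} {P : Protocol Q M} {γ : AbsSet Q M}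

theorem exists_of_tau_map {x y : Q'} (h : (x, .tau, y) ∈ (P.map f g).T) :
    ∃ q q', f q = x ∧ f q' = y ∧ (q, .tau, q') ∈ P.T := by
  obtain ⟨⟨q, _ | m | m, q'⟩, h, e⟩ := h <;>
    simp only [Action.map, Prod.mk.injEq] at e <;> cases e.2.1
  exact ⟨q, q', e.1, e.2.2, h⟩

theorem exists_of_send_map {x y : Q'} {a : M'} (h : (x, .send a, y) ∈ (P.map f g).T) :
    ∃ q m q', f q = x ∧ g m = a ∧ f q' = y ∧ (q, .send m, q') ∈ P.T := by
  obtain ⟨⟨q, _ | m | m, q'⟩, h, e⟩ := h <;>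
    simp only [Action.map, Prod.mk.injEq] at e <;> cases e.2.1
  exact ⟨q, m, q', e.1, rfl, e.2.2, h⟩

theorem exists_of_recv_map {x y : Q'} {a : M'} (h : (x, .recv a, y) ∈ (P.map f g).T) :
    ∃ q m q', f q = x ∧ g m = a ∧ f q' = y ∧ (q, .recv m, q') ∈ P.T := by
  obtain ⟨⟨q, _ | m | m, q'⟩, h, e⟩ := h <;>
    simp only [Action.map, Prod.mk.injEq] at e <;> cases e.2.1
  exact ⟨q, m, q', e.1, rfl, e.2.2, h⟩

theorem exists_of_toks_map {x : Q'} {a : M'} (h : (x, a) ∈ (γ.map f g).Toks) :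
    ∃ q m, f q = x ∧ g m = a ∧ (q, m) ∈ γ.Toks := by
  obtain ⟨⟨q, m⟩, h, e⟩ := h
  simp only [Prod.mk.injEq] at e
  exact ⟨q, m, e.1, e.2, h⟩

theorem tau_map {q q' : Q} (h : (q, .tau, q') ∈ P.T) : (f q, .tau, f q') ∈ (P.map f g).T :=
  ⟨_, h, rfl⟩

theorem send_map {q q' : Q} {m : M} (h : (q, .send m, q') ∈ P.T) :
    (f q, .send (g m), f q') ∈ (P.map f g).T := ⟨_, h, rfl⟩

theorem recv_map {q q' : Q} {m : M} (h : (q, .recv m, q') ∈ P.T) :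
    (f q, .recv (g m), f q') ∈ (P.map f g).T := ⟨_, h, rfl⟩

theorem mem_S_map (hf : Injective f) {q : Q} : f q ∈ (γ.map f g).S ↔ q ∈ γ.S :=
  hf.mem_set_image

theorem mem_toks_map (hf : Injective f) (hg : Injective g) {q : Q} {m : M} :
    (f q, g m) ∈ (γ.map f g).Toks ↔ (q, m) ∈ γ.Toks := by
  refine ⟨fun h => ?_, fun h => ⟨_, h, rfl⟩⟩
  obtain ⟨q', m', e1, e2, k⟩ := exists_of_toks_map h
  rwa [← hf e1, ← hg e2]

theorem mem_st_map (hf : Injective f) {q : Q} : f q ∈ (γ.map f g).st ↔ q ∈ γ.st := by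
  refine ⟨fun ⟨a, h⟩ => ?_, fun ⟨m, h⟩ => ⟨g m, _, h, rfl⟩⟩
  obtain ⟨q', m, e, -, k⟩ := exists_of_toks_map h
  exact ⟨m, hf e ▸ k⟩

theorem mem_rec_map (hf : Injective f) (hg : Injective g) {q : Q} {m : M} :
    g m ∈ (P.map f g).Rec (f q) ↔ m ∈ P.Rec q := by
  refine ⟨fun ⟨x, h⟩ => ?_, fun ⟨q', h⟩ => ⟨f q', recv_map h⟩⟩
  obtain ⟨q', m', q'', e1, e2, -, k⟩ := exists_of_recv_map h
  exact ⟨q'', hf e1 ▸ hg e2 ▸ k⟩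

theorem exists_mem_rec_map (hf : Injective f) {q : Q} :
    (∃ m, m ∈ (P.map f g).Rec (f q)) ↔ ∃ m, m ∈ P.Rec q := by
  refine ⟨fun ⟨a, x, h⟩ => ?_, fun ⟨m, q', h⟩ => ⟨g m, f q', recv_map h⟩⟩
  obtain ⟨q', m', q'', e1, -, -, k⟩ := exists_of_recv_map h
  exact ⟨m', q'', hf e1 ▸ k⟩

theorem canSend_map (hf : Injective f) (hg : Injective g) {m : M} :
    (P.map f g).CanSend (γ.map f g).S (g m) ↔ P.CanSend γ.S m := by
  refine ⟨fun ⟨x, y, h, hx⟩ => ?_, fun ⟨p, p', h, hp⟩ => ⟨f p, f p', send_map h, p, hp, rfl⟩⟩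
  obtain ⟨p, m', p', rfl, e, rfl, k⟩ := exists_of_send_map h
  exact ⟨p, p', hg e ▸ k, (mem_S_map hf).1 hx⟩

theorem canReceive_map (hf : Injective f) (hg : Injective g) {m : M} :
    (P.map f g).CanReceive (γ.map f g).S (g m) ↔ P.CanReceive γ.S m := by
  refine ⟨fun ⟨x, y, h, hx⟩ => ?_, fun ⟨p, p', h, hp⟩ => ⟨f p, f p', recv_map h, p, hp, rfl⟩⟩
  obtain ⟨p, m', p', rfl, e, rfl, k⟩ := exists_of_recv_map h
  exact ⟨p, p', hg e ▸ k, (mem_S_map hf).1 hx⟩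

theorem s2_map (hf : Injective f) (hg : Injective g) {x : Q'} :
    (P.map f g).S2 (γ.map f g) x ↔ ∃ q, f q = x ∧ P.S2 γ q := by
  constructor
  · intro h
    cases h with
    | base _ h =>
      obtain ⟨q, h, rfl⟩ := h
      exact ⟨q, rfl, .base q h⟩
    | internal p _ h1 h2 =>
      obtain ⟨p, q, rfl, rfl, k1⟩ := exists_of_tau_map h1
      exact ⟨q, rfl, .internal p q k1 ((mem_S_map hf).1 h2)⟩
    | send p _ a h1 h2 h3 =>
      obtain ⟨p, m, q, rfl, rfl, rfl, k1⟩ := exists_of_send_map h1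
      rw [mem_S_map hf] at h2
      rw [mem_rec_map hf hg, canReceive_map hf hg] at h3
      exact ⟨q, rfl, .send p q m k1 h2 h3⟩
    | recv p _ a h1 h2 h3 =>
      obtain ⟨p, m, q, rfl, rfl, rfl, k1⟩ := exists_of_recv_map h1
      rw [mem_S_map hf, mem_toks_map hf hg] at h2
      rw [canSend_map hf hg] at h3
      exact ⟨q, rfl, .recv p q m k1 h2 h3⟩
    | tokEnd p _ a m h1 h2 h3 h4 h5 =>
      obtain ⟨p, a, q, rfl, rfl, rfl, k1⟩ := exists_of_recv_map h1
      obtain ⟨p', m, e, rfl, k2⟩ := exists_of_toks_map h2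
      obtain rfl := hf e
      rw [hg.ne_iff] at h3
      rw [canSend_map hf hg] at h4
      rw [mem_rec_map hf hg] at h5
      exact ⟨q, rfl, .tokEnd p' q a m k1 k2 h3 h4 h5⟩
  · rintro ⟨q, rfl, h⟩
    cases h with
    | base _ h => exact .base _ ((mem_S_map hf).2 h)
    | internal p _ h1 h2 => exact .internal _ _ (tau_map h1) ((mem_S_map hf).2 h2)
    | send p _ a h1 h2 h3 =>
      rw [← mem_rec_map hf hg, ← canReceive_map hf hg] at h3
      exact .send _ _ _ (send_map h1) ((mem_S_map hf).2 h2) h3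
    | recv p _ a h1 h2 h3 =>
      rw [← mem_S_map hf (g := g), ← mem_toks_map hf hg] at h2
      rw [← canSend_map hf hg] at h3
      exact .recv _ _ _ (recv_map h1) h2 h3
    | tokEnd p _ a m h1 h2 h3 h4 h5 =>
      rw [← mem_rec_map hf hg] at h5
      exact .tokEnd _ _ _ _ (recv_map h1) ((mem_toks_map hf hg).2 h2) (hg.ne h3)
        ((canSend_map hf hg).2 h4) h5

theorem exists_of_toks2_map (hf : Injective f) (hg : Injective g) {t : Q' × M'}
    (h : (P.map f g).Toks2 (γ.map f g) t) : ∃ q m, f q = t.1 ∧ g m = t.2 ∧ P.Toks2 γ (q, m) := by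
  cases h with
  | base _ h =>
    obtain ⟨q, m, e1, e2, k⟩ := exists_of_toks_map h
    exact ⟨q, m, e1, e2, .base _ k⟩
  | newTok p p' a h1 h2 h3 h4 =>
    obtain ⟨p, m, q, rfl, rfl, rfl, k1⟩ := exists_of_send_map h1
    rw [mem_S_map hf] at h2
    rw [mem_rec_map hf hg] at h3
    rw [canReceive_map hf hg] at h4
    exact ⟨q, m, rfl, rfl, .newTok p q m k1 h2 h3 h4⟩
  | tokStep p _ a m h1 h2 h3 h4 h5 =>
    obtain ⟨p, a, q, rfl, rfl, rfl, k1⟩ := exists_of_recv_map h1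
    obtain ⟨p', m, e, rfl, k2⟩ := exists_of_toks_map h2
    obtain rfl := hf e
    rw [hg.ne_iff] at h3
    rw [canSend_map hf hg] at h4
    rw [mem_rec_map hf hg] at h5
    exact ⟨q, m, rfl, rfl, .tokStep p' q a m k1 k2 h3 h4 h5⟩

theorem toks2_map (hf : Injective f) (hg : Injective g) {q : Q} {m : M} :
    (P.map f g).Toks2 (γ.map f g) (f q, g m) ↔ P.Toks2 γ (q, m) := by
  constructor
  · intro h
    obtain ⟨q', m', e1, e2, k⟩ := exists_of_toks2_map hf hg h
    exact hf e1 ▸ hg e2 ▸ k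
  · intro h
    cases h with
    | base _ h => exact .base _ ((mem_toks_map hf hg).2 h)
    | newTok p p' a h1 h2 h3 h4 =>
      rw [← canReceive_map hf hg] at h4
      exact .newTok _ _ _ (send_map h1) ((mem_S_map hf).2 h2) ((mem_rec_map hf hg).2 h3) h4
    | tokStep p _ a m h1 h2 h3 h4 h5 =>
      exact .tokStep _ _ _ _ (recv_map h1) ((mem_toks_map hf hg).2 h2) (hg.ne h3)
        ((canSend_map hf hg).2 h4) ((mem_rec_map hf hg).2 h5)

theorem s1_map (hf : Injective f) (hg : Injective g) {x : Q'} :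
    (P.map f g).S1 (γ.map f g) x ↔ ∃ q, f q = x ∧ P.S1 γ q := by
  constructor
  · intro h
    cases h with
    | base h =>
      obtain ⟨q, rfl, k⟩ := (s2_map hf hg).1 h
      exact ⟨q, rfl, .base q k⟩
    | twoToks q₂ m₁ m₂ h1 h2 h3 h4 h5 =>
      obtain ⟨q₁, m₁, rfl, rfl, k1⟩ := exists_of_toks2_map hf hg h1
      obtain ⟨q₂, m₂, rfl, rfl, k2⟩ := exists_of_toks2_map hf hg h2
      rw [hg.ne_iff] at h3
      rw [mem_rec_map hf hg] at h4 h5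
      exact ⟨q₁, rfl, .twoToks q₁ q₂ m₁ m₂ k1 k2 h3 h4 h5⟩
    | threeToks q₂ q₃ m₁ m₂ h1 h2 h3 h4 h5 =>
      obtain ⟨q₁, m₁, rfl, rfl, k1⟩ := exists_of_toks2_map hf hg h1
      obtain ⟨q₂, m₂, rfl, rfl, k2⟩ := exists_of_toks2_map hf hg h2
      obtain ⟨r₂, n₁, r₃, e1, e2, rfl, k5⟩ := exists_of_recv_map h5
      obtain rfl := hf e1
      obtain rfl := hg e2
      rw [toks2_map hf hg] at h3
      rw [hg.ne_iff] at h4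
      exact ⟨q₁, rfl, .threeToks q₁ r₂ r₃ n₁ m₂ k1 k2 h3 h4 k5⟩
    | threeToks' q₂ q₃ m₁ m₂ m₃ h1 h2 h3 h4 h5 h6 h7 h8 h9 h10 h11 h12 =>
      obtain ⟨q₁, m₁, rfl, rfl, k1⟩ := exists_of_toks2_map hf hg h1
      obtain ⟨q₂, m₂, rfl, rfl, k2⟩ := exists_of_toks2_map hf hg h2
      obtain ⟨q₃, m₃, rfl, rfl, k3⟩ := exists_of_toks2_map hf hg h3
      rw [hg.ne_iff] at h4 h5 h6
      rw [mem_rec_map hf hg] at h7 h8 h9 h10 h11 h12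
      exact ⟨q₁, rfl, .threeToks' q₁ q₂ q₃ m₁ m₂ m₃ k1 k2 k3 h4 h5 h6 h7 h8 h9 h10 h11 h12⟩
  · rintro ⟨q, rfl, h⟩
    cases h with
    | base h => exact .base _ ((s2_map hf hg).2 ⟨q, rfl, h⟩)
    | twoToks q₂ m₁ m₂ h1 h2 h3 h4 h5 =>
      rw [← mem_rec_map hf hg] at h4 h5
      rw [← toks2_map hf hg] at h1 h2
      exact .twoToks _ _ _ _ h1 h2 (hg.ne h3) h4 h5
    | threeToks q₂ q₃ m₁ m₂ h1 h2 h3 h4 h5 =>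
      rw [← toks2_map hf hg] at h1 h2 h3
      exact .threeToks _ _ _ _ _ h1 h2 h3 (hg.ne h4) (recv_map h5)
    | threeToks' q₂ q₃ m₁ m₂ m₃ h1 h2 h3 h4 h5 h6 h7 h8 h9 h10 h11 h12 =>
      rw [← toks2_map hf hg] at h1 h2 h3
      rw [← mem_rec_map hf hg] at h7 h8 h9 h10 h11 h12
      exact .threeToks' _ _ _ _ _ _ h1 h2 h3 (hg.ne h4) (hg.ne h5) (hg.ne h6) h7 h8 h9 h10 h11 h12

theorem waitOnly_map (hf : Injective f) : (P.map f g).WaitOnly ↔ P.WaitOnly := by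
  rw [Protocol.waitOnly_iff, Protocol.waitOnly_iff]
  refine and_congr (not_congr (exists_mem_rec_map hf)) (not_congr ⟨?_, ?_⟩)
  · rintro ⟨x, h, ⟨y, h'⟩ | ⟨m, y, h'⟩⟩
    · obtain ⟨q, q', rfl, rfl, k'⟩ := exists_of_tau_map h'
      exact ⟨q, (exists_mem_rec_map hf).1 h, .inl ⟨q', k'⟩⟩
    · obtain ⟨q, m, q', rfl, rfl, rfl, k'⟩ := exists_of_send_map h'
      exact ⟨q, (exists_mem_rec_map hf).1 h, .inr ⟨m, q', k'⟩⟩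
  · rintro ⟨q, h, ⟨q', h'⟩ | ⟨m, q', h'⟩⟩
    · exact ⟨f q, (exists_mem_rec_map hf).2 h, .inl ⟨f q', tau_map h'⟩⟩
    · exact ⟨f q, (exists_mem_rec_map hf).2 h, .inr ⟨g m, f q', send_map h'⟩⟩

theorem conflictFree_map (hf : Injective f) (hg : Injective g) {q q' : Q} :
    (γ.map f g).ConflictFree (P.map f g) (f q) (f q') ↔ γ.ConflictFree P q q' := by
  constructor
  · rintro ⟨m₁, m₂, h1, h2, h3, h4, h5⟩
    obtain ⟨p, m₁, e, rfl, k2⟩ := exists_of_toks_map h2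
    obtain rfl := hf e
    obtain ⟨p', m₂, e', rfl, k3⟩ := exists_of_toks_map h3
    obtain rfl := hf e'
    rw [mem_rec_map hf hg] at h4 h5
    exact ⟨m₁, m₂, hg.ne_iff.1 h1, k2, k3, h4, h5⟩
  · rintro ⟨m₁, m₂, h1, h2, h3, h4, h5⟩
    rw [← mem_rec_map hf hg] at h4 h5
    exact ⟨_, _, hg.ne h1, ⟨_, h2, rfl⟩, ⟨_, h3, rfl⟩, h4, h5⟩

end map

/-- `RespectsCounts` is membership in `⟦γ⟧`, up to a renaming of states and messages. -/
theorem respectsCounts_map {Q M : Type*} [DecidableEq Q] {f : Q → ℕ} {g : M → ℕ}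
    (hf : Injective f) (hg : Injective g) {P : Protocol Q M} {γ : AbsSet Q M} {C : Multiset Q}
    {one two : ℕ → Prop} (h1 : ∀ x, one x ↔ ∃ q, f q = x ∧ 1 ≤ C.count q)
    (h2 : ∀ x, two x ↔ ∃ q, f q = x ∧ 2 ≤ C.count q) :
    RespectsCounts (P.map f g) (γ.map f g) one two ↔ γ.Respects P C := by
  have h1' : ∀ q, one (f q) ↔ 1 ≤ C.count q := fun q => by
    rw [h1]
    exact ⟨fun ⟨q', e, h⟩ => hf e ▸ h, fun h => ⟨q, rfl, h⟩⟩
  have h2' : ∀ q, two (f q) ↔ 2 ≤ C.count q := fun q => by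
    rw [h2]
    exact ⟨fun ⟨q', e, h⟩ => hf e ▸ h, fun h => ⟨q, rfl, h⟩⟩
  have h3 : ∀ q, 1 ≤ C.count q → ((∃ x, x ∈ (γ.map f g).st ∧ x ≠ f q ∧ one x ∧ ¬ two x ∧
      ¬ (γ.map f g).ConflictFree (P.map f g) (f q) x) ↔ ¬ ∀ q' ∈ γ.st \ {q}, C.count q' = 1 →
        γ.ConflictFree P q q') := by
    intro q hq
    constructor
    · rintro ⟨x, h4, h5, h6, h7, h8⟩ h
      obtain ⟨q', rfl, h6⟩ := (h1 x).1 h6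
      rw [mem_st_map hf] at h4
      rw [conflictFree_map hf hg] at h8
      rw [h2'] at h7
      exact h8 (h q' ⟨h4, fun e => h5 (congrArg f e)⟩ (by omega))
    · intro h
      push Not at h
      obtain ⟨q', h4, h5, h6⟩ := h
      refine ⟨f q', (mem_st_map hf).2 h4.1, hf.ne h4.2, (h1' q').2 (by omega), ?_, ?_⟩
      · rw [h2']; omega
      · rwa [conflictFree_map hf hg]
  unfold RespectsCounts AbsSet.Respects
  constructor
  · intro h q hq
    by_contra h'
    refine h ⟨f q, (h1' q).2 hq, fun h'' => h' ?_⟩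
    rw [mem_S_map hf, mem_st_map hf, h2', h3 q hq, not_not] at h''
    exact h''.imp_right fun ⟨a, b, c⟩ => ⟨a, by omega, c⟩
  · rintro h ⟨x, hx, h'⟩
    obtain ⟨q, rfl, hq⟩ := (h1 x).1 hx
    refine h' ?_
    rw [mem_S_map hf, mem_st_map hf, h2', h3 q hq, not_not]
    exact (h q hq).imp_right fun ⟨a, b, c⟩ => ⟨a, by omega, c⟩

/-! ### The iterated tables -/

/-- One update of the table is one application of `F`, except that the empty table, with which the
computation starts, becomes the table of `γ₀`. -/
theorem tableAbs_tableOf_update {Q M : Type*} {f : Q → ℕ} {g : M → ℕ} (hf : Injective f)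
    (hg : Injective g) {P : Protocol Q M} {γ : AbsSet Q M} {w r : List Sym}
    (hw : wordProtocol w = P.map f g) (hr : tableAbs w.length r = γ.map f g)
    (hfL : ∀ q, f q < w.length) (hgL : ∀ m, g m + 1 < w.length) :
    (P.init ∈ γ.S → tableAbs w.length (tableOf w.length (Inp.mk w r).Update) =
      (P.F γ).map f g) ∧
    (γ = ⟨∅, ∅⟩ → tableAbs w.length (tableOf w.length (Inp.mk w r).Update) =
      AbsSet.map f g ⟨{P.init}, ∅⟩) := by
  have hS : ∀ x, x ∈ (tableAbs w.length (tableOf w.length (Inp.mk w r).Update)).S ↔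
      ∃ q, (P.S1 γ q ∨ q = P.init) ∧ f q = x := by
    intro x
    have : x ∈ (tableAbs w.length (tableOf w.length (Inp.mk w r).Update)).S ↔ x < w.length ∧
        0 < w.length ∧ (Inp.mk w r).Update x 0 := by
      refine and_congr_right fun hx => and_congr_right fun h0 => ?_
      rw [getElem?_tableOf hx h0]
    rw [this, Inp.Update, Inp.P, Inp.abs, Inp.L, hw, hr, s1_map hf hg]
    constructor
    · rintro ⟨-, -, ⟨-, ⟨q, rfl, h⟩ | rfl⟩ | ⟨_, h, -⟩⟩
      · exact ⟨q, .inl h, rfl⟩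
      · exact ⟨_, .inr rfl, rfl⟩
      · cases h
    · rintro ⟨q, h, rfl⟩
      refine ⟨hfL q, (Nat.zero_le _).trans_lt (hfL q), .inl ⟨rfl, ?_⟩⟩
      exact h.imp (fun h => ⟨q, rfl, h⟩) fun h => (congrArg f h).symm
  have hT : ∀ x a, (x, a) ∈ (tableAbs w.length (tableOf w.length (Inp.mk w r).Update)).Toks ↔
      ∃ q m, P.Toks2 γ (q, m) ∧ ¬ P.S1 γ q ∧ f q = x ∧ g m = a := by
    intro x a
    have : (x, a) ∈ (tableAbs w.length (tableOf w.length (Inp.mk w r).Update)).Toks ↔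
        x < w.length ∧ a + 1 < w.length ∧ (Inp.mk w r).Update x (a + 1) := by
      refine and_congr_right fun hx => and_congr_right fun h0 => ?_
      rw [getElem?_tableOf hx h0]
    rw [this, Inp.Update]
    simp only [Inp.P, Inp.abs, Inp.L, hw, hr, s1_map hf hg]
    constructor
    · rintro ⟨-, -, ⟨h, -⟩ | ⟨_, h, h1, h2⟩⟩
      · cases h
      · obtain rfl := Nat.succ.inj h
        obtain ⟨q, m, rfl, rfl, k⟩ := exists_of_toks2_map hf hg h1
        exact ⟨q, m, k, fun h' => h2 ⟨q, rfl, h'⟩, rfl, rfl⟩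
    · rintro ⟨q, m, h1, h2, rfl, rfl⟩
      refine ⟨hfL q, hgL m, .inr ⟨_, rfl, (toks2_map hf hg).2 h1, ?_⟩⟩
      rintro ⟨q', e, h⟩
      exact h2 (hf e ▸ h)
  constructor
  · intro hin
    ext t
    · rw [hS]
      refine exists_congr fun q => and_congr_left fun _ => or_iff_left_of_imp ?_
      rintro rfl
      exact .base _ (.base _ hin)
    · obtain ⟨x, a⟩ := t
      rw [hT]
      constructor
      · rintro ⟨q, m, h1, h2, rfl, rfl⟩
        exact ⟨(q, m), ⟨h1, h2⟩, rfl⟩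
      · intro h
        obtain ⟨q, m, rfl, rfl, h1, h2⟩ := exists_of_toks_map h
        exact ⟨q, m, h1, h2, rfl, rfl⟩
  · rintro rfl
    have e2 : ∀ t, ¬ P.Toks2 ⟨∅, ∅⟩ t := by
      rintro _ (⟨_, h⟩ | ⟨_, _, _, _, h, _⟩ | ⟨_, _, _, _, _, h, _⟩) <;> exact h
    have e1 : ∀ q, ¬ P.S1 ⟨∅, ∅⟩ q := by
      intro q h
      cases h with
      | base h =>
        rw [Protocol.s2_iff] at h
        simp [Protocol.CanSend] at h
      | twoToks _ _ _ h => exact e2 _ h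
      | threeToks _ _ _ _ h => exact e2 _ h
      | threeToks' _ _ _ _ _ h => exact e2 _ h
    ext t
    · rw [hS]
      simp [e1, AbsSet.map, eq_comm]
    · obtain ⟨x, a⟩ := t
      rw [hT]
      simp [e2, AbsSet.map]

/-- The first update produces `γ₀`, so that `γ_i` is the result of `i + 1` updates. -/
theorem tableAbs_iterate {Q M : Type*} {f : Q → ℕ} {g : M → ℕ} (hf : Injective f)
    (hg : Injective g) {P : Protocol Q M} {w : List Sym}
    (hw : wordProtocol w = P.map f g)
    (hfL : ∀ q, f q < w.length) (hgL : ∀ m, g m + 1 < w.length) (i : ℕ) :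
    tableAbs w.length ((fun r => tableOf w.length (Inp.mk w r).Update)^[i + 1] []) =
      (P.absSeq i).map f g := by
  induction i with
  | zero =>
    refine (tableAbs_tableOf_update hf hg (γ := ⟨∅, ∅⟩) hw ?_ hfL hgL).2 rfl
    ext t <;> simp [tableAbs, Entry, AbsSet.map]
  | succ i ih =>
    rw [iterate_succ_apply', Protocol.absSeq_succ]
    exact (tableAbs_tableOf_update hf hg hw ih hfL hgL).1 (Protocol.init_mem_absSeq P i)

/-! ### Decoding the input -/

theorem num_append {A : List Sym} (hA : ∀ a ∈ A, a ≠ .sep) (r : List Sym) :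
    num (A ++ .sep :: r) = A.length := by
  rw [num, List.takeWhile_append_of_pos (by simpa using hA)]
  simp

theorem dropSep_append {A : List Sym} (hA : ∀ a ∈ A, a ≠ .sep) (r : List Sym) :
    dropSep (A ++ .sep :: r) = r := by
  rw [dropSep, List.dropWhile_append_of_pos (by simpa using hA)]
  simp

theorem encUnary_append (n : ℕ) (r : List Sym) :
    encUnary n ++ r = List.replicate n .tally ++ .sep :: r := by simp [encUnary]

theorem num_encUnary (n : ℕ) (r : List Sym) : num (encUnary n ++ r) = n := by
  rw [encUnary_append, num_append (by simp +contextual [List.mem_replicate]), List.length_replicate]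

theorem dropSep_encUnary (n : ℕ) (r : List Sym) : dropSep (encUnary n ++ r) = r := by
  rw [encUnary_append, dropSep_append (by simp +contextual [List.mem_replicate])]

theorem drop_encUnary {n x : ℕ} (h : x ≤ n) (r : List Sym) :
    (encUnary n ++ r).drop x = encUnary (n - x) ++ r := by
  rw [encUnary, List.append_assoc, List.drop_append_of_le_length (by simpa using h),
    List.drop_replicate, encUnary, List.append_assoc]

theorem exists_drop_cons {Φ : List Sym → Prop} {a : Sym} {l : List Sym} :
    (∃ i, Φ ((a :: l).drop i)) ↔ Φ (a :: l) ∨ ∃ i, Φ (l.drop i) := by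
  constructor
  · rintro ⟨_ | i, h⟩
    · exact .inl h
    · exact .inr ⟨i, h⟩
  · rintro (h | ⟨i, h⟩)
    · exact ⟨0, h⟩
    · exact ⟨i + 1, h⟩

/-- Symbols at which a pattern cannot start may be skipped in the search for that pattern. -/
theorem exists_drop_append {Φ : List Sym → Prop} {A B : List Sym}
    (hA : ∀ a ∈ A, ∀ s, ¬ Φ (a :: s)) :
    (∃ i, Φ ((A ++ B).drop i)) ↔ ∃ i, Φ (B.drop i) := by
  induction A with
  | nil => rfl
  | cons a A ih =>
    rw [List.cons_append, exists_drop_cons, ih fun b hb => hA b (List.mem_cons_of_mem a hb)]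
    exact or_iff_right (hA a List.mem_cons_self _)

/-- The symbols that mark the beginning of a transition. -/
def Sym.IsMark : Sym → Prop
  | tau | send | recv => True
  | _ => False

theorem not_transAt {a : Sym} (ha : ¬ a.IsMark) (s : List Sym) (t : ℕ × Action ℕ × ℕ) :
    ¬ TransAt t (a :: s) := by
  intro h
  obtain ⟨q, _ | m | m, q'⟩ := t <;> · cases h.1; exact ha trivial

theorem not_isMark_of_mem_encUnary {n : ℕ} {a : Sym} (h : a ∈ encUnary n) : ¬ a.IsMark := by
  rw [encUnary, List.mem_append, List.mem_replicate, List.mem_singleton] at h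
  rcases h with ⟨-, rfl⟩ | rfl <;> exact id

theorem not_isMark_of_mem_encBinary {n : ℕ} {a : Sym} (h : a ∈ encBinary n) : ¬ a.IsMark := by
  rw [encBinary, List.mem_append, List.mem_map, List.mem_singleton] at h
  rcases h with ⟨_, -, rfl⟩ | rfl <;> exact id

/-- The positions at which a transition starts are exactly those of the marks in the list of
transitions. -/
theorem exists_transAt {n k : ℕ} (l : List (Fin n × Action (Fin k) × Fin n)) (r : List Sym)
    (hr : ∀ a ∈ r, ¬ a.IsMark) (t : ℕ × Action ℕ × ℕ) :
    (∃ i, TransAt t ((l.flatMap encTransition ++ r).drop i)) ↔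
      ∃ u ∈ l, ((u.1 : ℕ), u.2.1.map Fin.val, (u.2.2 : ℕ)) = t := by
  have hu : ∀ (n : ℕ), ∀ a ∈ encUnary n, ∀ s, ¬ TransAt t (a :: s) :=
    fun n a ha s => not_transAt (not_isMark_of_mem_encUnary ha) s t
  induction l with
  | nil =>
    have := exists_drop_append (Φ := TransAt t) (A := r) (B := [])
      fun a ha s => not_transAt (hr a ha) s t
    rw [List.append_nil] at this
    simp only [List.flatMap_nil, List.nil_append, this, List.drop_nil, List.not_mem_nil,
      false_and, exists_false, iff_false, not_exists]
    rintro -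
    obtain ⟨q, _ | m | m, q'⟩ := t <;> rintro ⟨h, -⟩ <;> cases h
  | cons u l ih =>
    simp only [List.flatMap_cons, List.append_assoc, List.mem_cons, exists_eq_or_imp, ← ih]
    obtain ⟨q, _ | m | m, q'⟩ := u
    · simp only [encTransition, List.cons_append, List.append_assoc]
      rw [exists_drop_cons, exists_drop_append (hu _), exists_drop_append (hu _)]
      refine or_congr_left ?_
      obtain ⟨p, _ | m' | m', p'⟩ := t <;>
        simp [TransAt, Action.map, num_encUnary, dropSep_encUnary]
    · simp only [encTransition, List.cons_append, List.append_assoc]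
      rw [exists_drop_cons, exists_drop_append (hu _), exists_drop_append (hu _),
        exists_drop_append (hu _)]
      refine or_congr_left ?_
      obtain ⟨p, _ | m' | m', p'⟩ := t <;>
        simp [TransAt, Action.map, num_encUnary, dropSep_encUnary]
    · simp only [encTransition, List.cons_append, List.append_assoc]
      rw [exists_drop_cons, exists_drop_append (hu _), exists_drop_append (hu _),
        exists_drop_append (hu _)]
      refine or_congr_left ?_
      obtain ⟨p, _ | m' | m', p'⟩ := t <;>
        simp [TransAt, Action.map, num_encUnary, dropSep_encUnary]

theorem wordProtocol_encode (I : ProtocolInput) (r : List Sym) (hr : ∀ a ∈ r, ¬ a.IsMark) :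
    wordProtocol (I.encode ++ r) = I.toProtocol.map Fin.val Fin.val := by
  have hu : ∀ (n : ℕ) t, ∀ a ∈ encUnary n, ∀ s, ¬ TransAt t (a :: s) :=
    fun n t a ha s => not_transAt (not_isMark_of_mem_encUnary ha) s t
  unfold wordProtocol Protocol.map
  simp only [ProtocolInput.encode, List.append_assoc, dropSep_encUnary, num_encUnary]
  congr 1
  ext t
  rw [Set.mem_ofPred_eq, exists_drop_append (hu _ t), exists_drop_append (hu _ t),
    exists_drop_append (hu _ t), exists_drop_append (hu _ t), exists_transAt I.trans r hr t]
  rfl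

/-! ### Decoding the configuration -/

/-- A binary numeral without leading zeros has at least one (two) digits if and only if the number
is at least `1` (`2`). -/
theorem one_add_toNat_le_length_encodeNat (b : Bool) (n : ℕ) :
    1 + b.toNat ≤ (Computability.encodeNat n).length ↔ 1 + b.toNat ≤ n := by
  have hpos : ∀ p, 1 ≤ (Computability.encodePosNum p).length := fun p =>
    List.length_pos_iff.2 (Computability.encodePosNum_nonempty p)
  rw [Computability.encodeNat]
  have hn : ((n : Num) : ℕ) = n := Num.to_of_nat n
  conv_rhs => rw [← hn]
  generalize (n : Num) = m
  rcases m with _ | (_ | p | p)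
  · cases b <;> simp [Computability.encodeNum]
  · cases b <;> simp [Computability.encodeNum, Computability.encodePosNum]
  · have := hpos p
    have h0 : 1 ≤ (p : ℕ) := p.to_nat_pos
    cases b <;> simp [Computability.encodeNum, Computability.encodePosNum]
    omega
  · have := hpos p
    have h0 : 1 ≤ (p : ℕ) := p.to_nat_pos
    cases b <;> simp [Computability.encodeNum, Computability.encodePosNum] <;> omega

theorem ne_sep_of_mem_map_bit {B : List Bool} : ∀ a ∈ B.map Sym.bit, a ≠ .sep := by
  intro a ha
  obtain ⟨_, -, rfl⟩ := List.mem_map.1 ha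
  simp

theorem dropSep_encBinary (n : ℕ) (r : List Sym) : dropSep (encBinary n ++ r) = r := by
  rw [encBinary, List.append_assoc, List.singleton_append, dropSep_append ne_sep_of_mem_map_bit]

theorem iterate_dropSep_blocks {α : Type*} (g : α → ℕ) (l : List α) (c : ℕ) :
    dropSep^[c] (l.flatMap fun q => encBinary (g q)) =
      (l.drop c).flatMap fun q => encBinary (g q) := by
  induction c generalizing l with
  | zero => rfl
  | succ c ih =>
    cases l with
    | nil =>
      rw [iterate_succ_apply]
      exact (ih []).trans (by simp)
    | cons q l =>
      rw [iterate_succ_apply, List.flatMap_cons, dropSep_encBinary, ih]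
      rfl

theorem blocks_eq_nil {α : Type*} (g : α → ℕ) (l : List α) :
    (l.flatMap fun q => encBinary (g q)) = [] ↔ l = [] := by
  cases l <;> simp [encBinary]

/-- The pattern of `HasBit`, for a block followed by `c` more blocks. -/
def BitAt (b : Bool) (c : ℕ) (s : List Sym) : Prop :=
  (∃ a, s.head? = some (.bit a)) ∧ (b = true → ∃ a, (s.drop 1).head? = some (.bit a)) ∧
    dropSep^[c + 1] s = [] ∧ dropSep^[c] s ≠ []

/-- In a list of binary numerals, the pattern occurs if and only if the numeral that is followed by
exactly `c` others has at least one digit, or two digits if `b` holds. -/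
theorem exists_bitAt {α : Type*} (g : α → ℕ) (b : Bool) (c : ℕ) (l : List α) :
    (∃ i, BitAt b c ((l.flatMap fun q => encBinary (g q)).drop i)) ↔
      ∃ l₁ q l₂, l = l₁ ++ q :: l₂ ∧ l₂.length = c ∧ 1 + b.toNat ≤ g q := by
  induction l with
  | nil => simp [BitAt]
  | cons q l ih =>
    set R := l.flatMap fun q => encBinary (g q) with hR
    have key : ∀ B : List Bool, (∃ i, BitAt b c ((B.map Sym.bit ++ .sep :: R).drop i)) ↔
        (1 + b.toNat ≤ B.length ∧ l.length = c) ∨ ∃ i, BitAt b c (R.drop i) := by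
      intro B
      induction B with
      | nil =>
        rw [List.map_nil, List.nil_append, exists_drop_cons]
        refine or_congr_left ⟨?_, ?_⟩
        · rintro ⟨⟨a, h⟩, -⟩; cases h
        · rintro ⟨h, -⟩; simp at h
      | cons a B ihB =>
        rw [List.map_cons, List.cons_append, exists_drop_cons, ihB, ← or_assoc]
        refine or_congr_left ?_
        have e1 : dropSep (.bit a :: (B.map Sym.bit ++ .sep :: R)) = R := by
          rw [← List.cons_append, ← List.map_cons, dropSep_append ne_sep_of_mem_map_bit]
        have e2 : dropSep^[c + 1] (.bit a :: (B.map Sym.bit ++ .sep :: R)) = [] ↔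
            l.length ≤ c := by
          rw [iterate_succ_apply, e1, hR, iterate_dropSep_blocks, blocks_eq_nil,
            List.drop_eq_nil_iff]
        have e3 : dropSep^[c] (.bit a :: (B.map Sym.bit ++ .sep :: R)) ≠ [] ↔ c ≤ l.length := by
          cases c with
          | zero => simp
          | succ c =>
            rw [iterate_succ_apply, e1, hR, iterate_dropSep_blocks, ne_eq, blocks_eq_nil,
              List.drop_eq_nil_iff]
            omega
        rw [BitAt, e2, e3]
        cases B <;> cases b <;> simp <;> omega
    have e : (q :: l).flatMap (fun q => encBinary (g q)) =
        (Computability.encodeNat (g q)).map Sym.bit ++ .sep :: R := by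
      simp [encBinary, hR]
    rw [e, key, ih, one_add_toNat_le_length_encodeNat]
    constructor
    · rintro (⟨h1, h2⟩ | ⟨l₁, q', l₂, rfl, h1, h2⟩)
      · exact ⟨[], q, l, rfl, h2, h1⟩
      · exact ⟨q :: l₁, q', l₂, rfl, h1, h2⟩
    · rintro ⟨_ | ⟨p, l₁⟩, q', l₂, h, h1, h2⟩
      · obtain ⟨rfl, rfl⟩ := List.cons.inj h
        exact .inl ⟨h2, h1⟩
      · obtain ⟨-, rfl⟩ := List.cons.inj h
        exact .inr ⟨l₁, q', l₂, rfl, h1, h2⟩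

/-- The multiplicity of a state is at least `1` or `2`, respectively, if and only if its binary
numeral has that many digits. -/
theorem hasBit_encode (I : ConfigInput) (b : Bool) (x : ℕ) :
    HasBit b I.encode x ↔ ∃ q : Fin I.numStates, (q : ℕ) = x ∧ 1 + b.toNat ≤ I.config.count q := by
  obtain ⟨A, hA, hw⟩ : ∃ A, (∀ a ∈ A, ∀ c, a ≠ Sym.bit c) ∧ I.encode =
      encUnary I.numStates ++ (A ++ (List.finRange I.numStates).flatMap fun q =>
        encBinary (I.config.count q)) := by
    refine ⟨encUnary I.numMsgs ++ encUnary I.init ++ encUnary I.final ++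
      I.trans.flatMap encTransition, ?_, by simp [ConfigInput.encode, ProtocolInput.encode]⟩
    have hu : ∀ n, ∀ a ∈ encUnary n, ∀ c, a ≠ Sym.bit c := by
      intro n a ha c
      rw [encUnary, List.mem_append, List.mem_replicate, List.mem_singleton] at ha
      rcases ha with ⟨-, rfl⟩ | rfl <;> simp
    intro a ha c
    simp only [List.mem_append, List.mem_flatMap] at ha
    rcases ha with ((ha | ha) | ha) | ⟨⟨q, _ | m | m, q'⟩, -, ha⟩
    · exact hu _ a ha c
    · exact hu _ a ha c
    · exact hu _ a ha c
    · simp only [encTransition, List.mem_cons, List.mem_append] at ha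
      rcases ha with rfl | ha | ha
      · simp
      · exact hu _ a ha c
      · exact hu _ a ha c
    · simp only [encTransition, List.mem_cons, List.mem_append] at ha
      rcases ha with rfl | (ha | ha) | ha
      · simp
      all_goals exact hu _ a ha c
    · simp only [encTransition, List.mem_cons, List.mem_append] at ha
      rcases ha with rfl | (ha | ha) | ha
      · simp
      all_goals exact hu _ a ha c
  have hu : ∀ c, ∀ a ∈ encUnary I.numStates, ∀ s, ¬ BitAt b c (a :: s) := by
    rintro c a ha s ⟨⟨d, h⟩, -⟩
    rw [encUnary, List.mem_append, List.mem_replicate, List.mem_singleton] at ha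
    rcases ha with ⟨-, rfl⟩ | rfl <;> cases h
  have hA' : ∀ c, ∀ a ∈ A, ∀ s, ¬ BitAt b c (a :: s) := by
    rintro c a ha s ⟨⟨d, h⟩, -⟩
    exact hA a ha d (Option.some.inj h)
  have hn : num I.encode = I.numStates := by rw [hw, num_encUnary]
  have hlen : num I.encode < I.encode.length := by
    rw [hn, hw]
    simp [encUnary]
  by_cases hx : x < I.numStates
  · have h0 : num (I.encode.drop x) = I.numStates - (x + 1) + 1 := by
      rw [hw, drop_encUnary hx.le, num_encUnary]
      omega
    have h1 : num ((I.encode.drop 1).drop x) = I.numStates - (x + 1) := by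
      rw [List.drop_drop, add_comm, hw, drop_encUnary hx, num_encUnary]
    have h2 : HasBit b I.encode x ↔ ∃ i, BitAt b (I.numStates - (x + 1)) (I.encode.drop i) := by
      rw [HasBit, h0, h1, hn]
      exact ⟨fun h => h.2.2, fun h => ⟨hn ▸ hlen, hx, h⟩⟩
    rw [h2, hw, exists_drop_append (hu _), exists_drop_append (hA' _), exists_bitAt]
    constructor
    · rintro ⟨l₁, q, l₂, h, h3, h4⟩
      refine ⟨q, ?_, h4⟩
      have h5 := congrArg List.length h
      have h6 := congrArg (fun l => l[l₁.length]?) h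
      simp at h5 h6
      obtain ⟨h7, rfl⟩ := List.getElem?_eq_some_iff.1 h6
      simp
      omega
    · rintro ⟨q, rfl, h⟩
      refine ⟨(List.finRange I.numStates).take q, q, (List.finRange I.numStates).drop (q + 1),
        ?_, by simp, h⟩
      conv_lhs => rw [← List.take_append_drop q (List.finRange I.numStates)]
      rw [List.drop_eq_getElem_cons (by simp)]
      simp
  · refine iff_of_false (fun h => hx (hn ▸ h.2.1)) ?_
    rintro ⟨q, rfl, -⟩
    exact hx q.2

/-! ### The decision problems -/

/-- The length `L` of the input exceeds `|Q| + |Σ|`, so that all states and messages are in range,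
and `L³` updates suffice to reach the fixpoint, even though the first one only produces `γ₀`. -/
theorem exists_iterations (I : ProtocolInput) (r : List Sym) :
    (∀ q : Fin I.numStates, (q : ℕ) < (I.encode ++ r).length) ∧
    (∀ m : Fin I.numMsgs, (m : ℕ) + 1 < (I.encode ++ r).length) ∧
    ∃ i, iterBound (Fin I.numStates) (Fin I.numMsgs) ≤ i ∧
      (I.encode ++ r).length * (I.encode ++ r).length * (I.encode ++ r).length = i + 1 := by
  obtain ⟨c, hc⟩ : ∃ c, (I.encode ++ r).length = I.numStates + I.numMsgs + 2 + c := by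
    refine ⟨I.init + I.final + 2 + (I.trans.flatMap encTransition).length + r.length, ?_⟩
    simp only [ProtocolInput.encode, encUnary, List.length_append, List.length_replicate,
      List.length_singleton]
    ring
  rw [hc]
  refine ⟨fun q => by omega, fun m => by omega, _, ?_, (Nat.succ_pred_eq_of_pos ?_).symm⟩
  · refine Nat.le_pred_of_lt ?_
    rw [iterBound, Fintype.card_fin, Fintype.card_fin, pow_two]
    refine (Nat.mul_le_mul (Nat.mul_le_mul ?_ ?_) ?_).trans_lt
      (Nat.mul_lt_mul_of_pos_left (n := I.numStates + I.numMsgs + 1 + c) ?_ ?_)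
    all_goals first | omega | positivity
  · positivity

/-- After the last iteration, the table holds the fixpoint of the abstraction function. -/
theorem tableAbs_final (I : ProtocolInput) (r : List Sym) (hr : ∀ a ∈ r, ¬ a.IsMark) :
    ∃ i, iterBound (Fin I.numStates) (Fin I.numMsgs) ≤ i ∧
      tableAbs (I.encode ++ r).length
        ((fun s => tableOf (I.encode ++ r).length (Inp.mk (I.encode ++ r) s).Update)^[
          (I.encode ++ r).length * (I.encode ++ r).length * (I.encode ++ r).length] []) =
      (I.toProtocol.absSeq i).map Fin.val Fin.val := by
  obtain ⟨h1, h2, i, hi, h⟩ := exists_iterations I r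
  refine ⟨i, hi, ?_⟩
  rw [h]
  exact tableAbs_iterate Fin.val_injective Fin.val_injective (wordProtocol_encode I r hr) h1 h2 i

theorem encode_ne_nil (I : ProtocolInput) : I.encode ≠ [] := by
  simp [ProtocolInput.encode, encUnary]

theorem inPTime_cCover : InPTime ConfigInput.encode
    fun I => I.toProtocol.WaitOnly ∧ I.toProtocol.CCover I.config := by
  have h := inPTime_of_iterate (enc := ConfigInput.encode) (ψ := fun I => I.P.WaitOnly ∧
      RespectsCounts I.P I.abs (HasBit false I.w) (HasBit true I.w))
    (fun I h => encode_ne_nil _ (List.append_eq_nil_iff.1 h).1) Ev.update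
    (Ev.waitOnly.and (Ev.respectsCounts (one := fun I => HasBit false I.w)
      (two := fun I => HasBit true I.w) (fun _ _ h => h.lt) (fun _ _ h => Ev.hasBit false h)
      fun _ _ h => Ev.hasBit true h))
  convert h using 2 with I
  set r := (List.finRange I.numStates).flatMap fun q => encBinary (I.config.count q) with hr
  have hm : ∀ a ∈ r, ¬ a.IsMark := by
    intro a ha
    obtain ⟨q, -, ha⟩ := List.mem_flatMap.1 ha
    exact not_isMark_of_mem_encBinary ha
  have e : I.encode = I.toProtocolInput.encode ++ r := rfl
  obtain ⟨i, hi, ht⟩ := tableAbs_final I.toProtocolInput r hm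
  have h1 := hasBit_encode I false
  have h2 := hasBit_encode I true
  rw [← e] at ht
  simp only [Inp.P, Inp.abs, Inp.L]
  rw [ht, e, wordProtocol_encode _ _ hm, waitOnly_map Fin.val_injective, ← e,
    respectsCounts_map Fin.val_injective Fin.val_injective h1 h2]
  exact and_congr_right fun ⟨A, hA⟩ => Protocol.ccover_iff_respects hA hi I.config

theorem Protocol.sCover_iff {Q M : Type*} [DecidableEq Q] (P : Protocol Q M) :
    P.SCover ↔ P.CCover {P.final} := by
  simp only [SCover, CCover, Multiset.singleton_le, Multiset.count_pos]

theorem AbsSet.respects_singleton {Q M : Type*} [DecidableEq Q] (P : Protocol Q M)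
    (γ : AbsSet Q M) (q : Q) : γ.Respects P {q} ↔ q ∈ γ.S ∨ q ∈ γ.st := by
  constructor
  · intro h
    exact (h q (by simp)).imp_right fun h => h.1
  · intro h p hp
    obtain rfl : p = q := Multiset.mem_singleton.1 (Multiset.count_pos.1 hp)
    refine h.imp_right fun h => ⟨h, by simp, fun q' hq' h1 => ?_⟩
    have : q' ∈ ({p} : Multiset Q) := Multiset.count_pos.1 (by omega)
    exact absurd (Multiset.mem_singleton.1 this) hq'.2

theorem inPTime_sCover : InPTime ProtocolInput.encode
    fun I => I.toProtocol.WaitOnly ∧ I.toProtocol.SCover := by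
  have h := inPTime_of_iterate (enc := ProtocolInput.encode) (ψ := fun I => I.P.WaitOnly ∧
    (I.P.final ∈ I.abs.S ∨ I.P.final ∈ I.abs.st)) encode_ne_nil Ev.update
    (Ev.waitOnly.and Ev.final)
  convert h using 2 with I
  obtain ⟨i, hi, ht⟩ := tableAbs_final I [] (by simp)
  have hw := wordProtocol_encode I [] (by simp)
  rw [List.append_nil] at ht hw
  simp only [Inp.P, Inp.abs, Inp.L]
  rw [ht, hw, waitOnly_map Fin.val_injective]
  refine and_congr_right fun ⟨A, hA⟩ => ?_
  rw [Protocol.sCover_iff, Protocol.ccover_iff_respects hA hi, AbsSet.respects_singleton]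
  exact or_congr (mem_S_map Fin.val_injective).symm (mem_st_map Fin.val_injective).symm

end Rendezvous

theorem mainTheorem5 :
    Rendezvous.InPTime Rendezvous.ConfigInput.encode
      (fun I => I.toProtocol.WaitOnly ∧ I.toProtocol.CCover I.config) ∧
    Rendezvous.InPTime Rendezvous.ProtocolInput.encode
      (fun I => I.toProtocol.WaitOnly ∧ I.toProtocol.SCover) ∧
    -- the iteration of `F` stays among the abstract sets, is stationary after polynomially many
    -- steps, and its fixpoint is sound and complete for coverability
    (∀ (Q M : Type*) [Fintype Q] [Fintype M] [DecidableEq Q]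
      (P : Rendezvous.Protocol Q M) (A : Set Q), P.WaitOnlyWith A →
      (∀ i, (P.absSeq i).IsAbstract A) ∧
      (∀ i, Rendezvous.iterBound Q M ≤ i →
        Function.IsFixedPt P.F (P.absSeq i) ∧ P.absSeq i = P.absSeq (Rendezvous.iterBound Q M)) ∧
      (∀ C : Multiset Q, C ≠ 0 →
        (P.CCover C ↔
          ∃ C'', C'' ≠ 0 ∧ (P.absSeq (Rendezvous.iterBound Q M)).Respects P C'' ∧ C ≤ C''))) := by
  refine ⟨Rendezvous.inPTime_cCover, Rendezvous.inPTime_sCover, fun Q M _ _ _ P A hA =>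
    ⟨fun i => hA.isAbstract_absSeq i, fun i hi => ⟨P.isFixedPt_absSeq hi, P.absSeq_eq hi⟩,
      fun C hC => ⟨fun h => ⟨C, hC, (Rendezvous.Protocol.ccover_iff_respects hA le_rfl C).1 h,
        le_rfl⟩, ?_⟩⟩⟩
  rintro ⟨C'', -, h, hle⟩
  exact ((Rendezvous.Protocol.ccover_iff_respects hA le_rfl C'').2 h).mono hle
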